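/- For $n\in\mathbb N$ let $f_{(1,1)},f_{(1,2)},f_{(1,3)},f_{(1,4)},f_{(2,1)},f_{(2,2)},f_{(3,1)}$ be seven functions $\{0,1\}^{2n}\to\{0,1\}^n$, collectively denoted $f$. For $g_0,g_1,g_2:\{0,1\}^{2n}\to\{0,1\}^n$ put $$\mathsf{ABR}^{g_0,g_1,g_2}(x_1,x_2,x_3,x_4,m)=g_0\bigl(m\oplus g_1(x_1,x_2),\,m\oplus g_2(x_3,x_4)\bigr)\oplus g_2(x_3,x_4),$$ and define $C^f:\{0,1\}^{10n}\to\{0,1\}^n$ (the $\mathsf{ABR}^+$ mode), for $n$-bit blocks $m_1,\dots,m_{10}$, by $$C^f(m_1,\dots,m_{10})=f_{(3,1)}\Bigl(\mathsf{ABR}^{f_{(2,1)},f_{(1,1)},f_{(1,2)}}(m_1,m_2,m_3,m_4,m_9),\ \mathsf{ABR}^{f_{(2,2)},f_{(1,3)},f_{(1,4)}}(m_5,m_6,m_7,m_8,m_{10})\Bigr).$$ **Theorem.** There are an algorithm $S$ (the simulator: one randomized, stateful program for a unit-cost random access machine on $n$-bit words and counters, with oracle access to a function $\mathcal F:\{0,1\}^{10n}\to\{0,1\}^n$)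 and absolute constants $c,K$ such that for all $n,q\in\mathbb N$: 1. in any sequence of at most $q$ invocations, for every oracle $\mathcal F$ and every outcome of its coins, $S$ runs in total time at most $c\,q^2$; 2. $S$ makes at most one query to $\mathcal F$ per invocation; 3. for every computationally unbounded, adaptive, possibly randomized distinguisher $A$ making at most $q$ queries in total to its two oracles, $$\Bigl|\Pr\bigl[A^{(C^f,f)}=1\bigr]-\Pr\bigl[A^{(\mathcal F,S^{\mathcal F})}=1\bigr]\Bigr|\le K\,\frac{n^2q^2}{2^n},$$ where $f$ is a family of seven independent uniformly random functions $\{0,1\}^{2n}\to\{0,1\}^n$ and $\mathcal F$ is a uniformly random function $\{0,1\}^{10n}\to\{0,1\}^n$. That is, $(C^f,f)$ is $(t_S,q_S,q,\varepsilon)$-indifferentiable from a random oracle $\mathcal F:\{0,1\}^{10n}\to\{0,1\}^n$ with $\varepsilon=O(n^2q^2/2^n)$, $t_S=O(q^2)$ and $q_S=1$. -/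

import Mathlib

namespace ABRPlus

/-! ### Blocks, the compression functions and the mode -/

/-- `{0,1}^n`. -/
abbrev Block (n : ℕ) : Type := BitVec n

/-- `{0,1}^{10n}`, as ten blocks; `M k` is the block usually written `m_{k+1}`. -/
abbrev Message (n : ℕ) : Type := Fin 10 → Block n

/-- Seven functions `{0,1}^{2n} → {0,1}^n`; the `2n`-bit input is a pair of blocks.
Indices `0, 1, 2, 3` are the leaves `f_(1,1), …, f_(1,4)`, indices `4, 5` are `f_(2,1), f_(2,2)`,
and index `6` is the root `f_(3,1)`. -/
abbrev Family (n : ℕ) : Type := Fin 7 → Block n × Block n → Block n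

/-- `𝓕 : {0,1}^{10n} → {0,1}^n`. -/
abbrev BigFun (n : ℕ) : Type := Message n → Block n

/-- The height-2 ABR tree with root `f₀` and leaves `f₁`, `f₂`. -/
def abr {n : ℕ} (f₀ f₁ f₂ : Block n × Block n → Block n) (x₁ x₂ x₃ x₄ m : Block n) : Block n :=
  f₀ (m ^^^ f₁ (x₁, x₂), m ^^^ f₂ (x₃, x₄)) ^^^ f₂ (x₃, x₄)

/-- The ABR⁺ mode on ten blocks: two height-2 ABR trees merged by a final compression call. -/
def abrPlus {n : ℕ} (f : Family n) : BigFun n := fun M =>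
  f 6 (abr (f 4) (f 0) (f 1) (M 0) (M 1) (M 2) (M 3) (M 8),
       abr (f 5) (f 2) (f 3) (M 4) (M 5) (M 6) (M 7) (M 9))

/-! ### Distinguishers -/

/-- A query of a distinguisher: to the construction (or `𝓕`), or to a compression function
(or the simulator). -/
inductive Query (n : ℕ) : Type
  | construction (M : Message n) : Query n
  | primitive (i : Fin 7) (x : Block n × Block n) : Query n

/-- A deterministic, adaptive, computationally unbounded distinguisher making at most `q` queries
in total. -/
inductive DecisionTree (n : ℕ) : ℕ → Type
  | output {q : ℕ} (b : Bool) : DecisionTree n q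
  | query {q : ℕ} (x : Query n) (next : Block n → DecisionTree n q) : DecisionTree n (q + 1)

/-- A (possibly randomized) distinguisher making at most `q` queries in total: its coins select a
deterministic one. -/
abbrev Distinguisher (n q : ℕ) : Type := PMF (DecisionTree n q)

/-! ### The machine that runs the simulator

A random access machine. Its registers and its memory cells hold natural numbers, an `n`-bit block
being held as the number it represents in binary. The memory consists of banks of cells; a program
mentions finitely many registers and banks. A program does not depend on `n`. -/

/-- Programs. Registers and banks are named by numerals. -/
inductive Program : Type
  /-- `R[r] := k` -/
  | const (r k : ℕ) : Program
  /-- `R[r] := R[a]` -/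
  | copy (r a : ℕ) : Program
  /-- `R[r] := R[r] + 1` -/
  | succ (r : ℕ) : Program
  /-- `R[r] := R[a] ⊕ R[b]`, bitwise -/
  | xor (r a b : ℕ) : Program
  /-- `R[r] := Mem[bank][R[a]]` -/
  | load (r bank a : ℕ) : Program
  /-- `Mem[bank][R[a]] := R[r]` -/
  | store (bank a r : ℕ) : Program
  /-- `R[r]` becomes a fresh uniformly random `n`-bit block -/
  | sample (r : ℕ) : Program
  /-- `R[r] := 𝓕(R[a 0], …, R[a 9])`, a call to the oracle -/
  | call (r : ℕ) (a : Fin 10 → ℕ) : Program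
  /-- first `p`, then `p'` -/
  | seq (p p' : Program) : Program
  /-- if `R[a] = R[b]` then `p` else `p'` -/
  | ifEq (a b : ℕ) (p p' : Program) : Program
  /-- execute `p` as many times as the value of `R[a]` on entry of the loop -/
  | loop (a : ℕ) (p : Program) : Program

/-- A state of the machine. The last two fields are counters that no program can read. -/
structure State : Type where
  reg : ℕ → ℕ
  mem : ℕ → ℕ → ℕ
  /-- number of elementary steps executed so far -/
  steps : ℕ
  /-- number of oracle calls made so far -/
  calls : ℕ

namespace State

/-- All registers and cells are `0`. -/
def init : State := ⟨fun _ => 0, fun _ _ => 0, 0, 0⟩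

/-- Charge one step. -/
def tick (s : State) : State := { s with steps := s.steps + 1 }

/-- Charge one oracle call. -/
def tickCall (s : State) : State := { s with calls := s.calls + 1 }

def setReg (s : State) (r v : ℕ) : State := { s with reg := Function.update s.reg r v }

def setMem (s : State) (bank a v : ℕ) : State :=
  { s with mem := Function.update s.mem bank (Function.update (s.mem bank) a v) }

end State

/-- `k`-fold sequential repetition of a random state transformation. -/
noncomputable def iter (g : State → PMF State) : ℕ → State → PMF State
  | 0, s => PMF.pure s
  | k + 1, s => (g s).bind (iter g k)

/-- Execution of a program with oracle `F`. Every elementary instruction, every test of an `ifEq`,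
every entry into a loop and every iteration of a loop costs one step. -/
noncomputable def Program.run {n : ℕ} (F : BigFun n) : Program → State → PMF State
  | .const r k, s => PMF.pure (s.tick.setReg r k)
  | .copy r a, s => PMF.pure (s.tick.setReg r (s.reg a))
  | .succ r, s => PMF.pure (s.tick.setReg r (s.reg r + 1))
  | .xor r a b, s => PMF.pure (s.tick.setReg r (s.reg a ^^^ s.reg b))
  | .load r bank a, s => PMF.pure (s.tick.setReg r (s.mem bank (s.reg a)))
  | .store bank a r, s => PMF.pure (s.tick.setMem bank (s.reg a) (s.reg r))
  | .sample r, s => (PMF.uniformOfFintype (Block n)).map fun z => s.tick.setReg r z.toNat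
  | .call r a, s =>
      PMF.pure (s.tick.tickCall.setReg r (F fun k => BitVec.ofNat n (s.reg (a k))).toNat)
  | .seq p p', s => (p.run F s).bind (p'.run F)
  | .ifEq a b p p', s => if s.reg a = s.reg b then p.run F s.tick else p'.run F s.tick
  | .loop a p, s => iter (fun t => p.run F t.tick) (s.reg a) s.tick

/-! ### Simulators -/

/-- Write the query `(i, u, v)` to the registers `0, 1, 2`; everything else is kept from the
previous invocation. -/
def State.input {n : ℕ} (s : State) (i : Fin 7) (x : Block n × Block n) : State :=
  ((s.setReg 0 i).setReg 1 x.1.toNat).setReg 2 x.2.toNat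

/-- The answer is the block in register `0`. -/
def State.answer (n : ℕ) (s : State) : Block n := BitVec.ofNat n (s.reg 0)

/-- One invocation of the simulator `S` on the query `(i, x)`. -/
noncomputable def invoke {n : ℕ} (S : Program) (F : BigFun n) (i : Fin 7) (x : Block n × Block n)
    (s : State) : PMF State :=
  S.run F (s.input i x)

/-- The state of the simulator after a sequence of invocations. -/
noncomputable def invokeAll {n : ℕ} (S : Program) (F : BigFun n) :
    List (Fin 7 × (Block n × Block n)) → State → PMF State
  | [], s => PMF.pure s
  | (i, x) :: l, s => (invoke S F i x s).bind (invokeAll S F l)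

/-- The total running time of the simulator `S` over any at most `q` invocations, for all oracles
and all outcomes of its coins, is at most `t`. -/
def RunsInTime (n : ℕ) (S : Program) (q t : ℕ) : Prop :=
  ∀ (F : BigFun n) (l : List (Fin 7 × (Block n × Block n))), l.length ≤ q →
    ∀ s ∈ (invokeAll S F l State.init).support, s.steps ≤ t

/-- Each invocation of the simulator `S`, after any earlier ones, makes at most `k` oracle calls. -/
def CallsPerInvocation (n : ℕ) (S : Program) (k : ℕ) : Prop :=
  ∀ (F : BigFun n) (l : List (Fin 7 × (Block n × Block n))),
    ∀ s ∈ (invokeAll S F l State.init).support,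
      ∀ (i : Fin 7) (x : Block n × Block n), ∀ s' ∈ (invoke S F i x s).support,
        s'.calls ≤ s.calls + k

/-! ### The indifferentiability game -/

/-- The output of a deterministic distinguisher in the real world `(C^f, f)`. -/
def DecisionTree.realEval {n : ℕ} (C : Family n → BigFun n) (f : Family n) :
    {q : ℕ} → DecisionTree n q → Bool
  | _, .output b => b
  | _, .query (.construction M) next => (next (C f M)).realEval C f
  | _, .query (.primitive i x) next => (next (f i x)).realEval C f

/-- The output of a deterministic distinguisher in the ideal world `(𝓕, S^𝓕)`, where `s` is the
current state of the simulator. -/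
noncomputable def DecisionTree.idealEval {n : ℕ} (S : Program) (F : BigFun n) :
    {q : ℕ} → DecisionTree n q → State → PMF Bool
  | _, .output b, _ => PMF.pure b
  | _, .query (.construction M) next, s => (next (F M)).idealEval S F s
  | _, .query (.primitive i x) next, s =>
      (invoke S F i x s).bind fun s' => (next (s'.answer n)).idealEval S F s'

/-- The real world: `f` is a family of independent uniformly random functions. -/
noncomputable def realGame {n q : ℕ} (C : Family n → BigFun n) (A : Distinguisher n q) : PMF Bool :=
  A.bind fun D => (PMF.uniformOfFintype (Family n)).map fun f => D.realEval C f

/-- The ideal world: `𝓕` is a uniformly random function. -/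
noncomputable def idealGame {n q : ℕ} (S : Program) (A : Distinguisher n q) : PMF Bool :=
  A.bind fun D => (PMF.uniformOfFintype (BigFun n)).bind fun F => D.idealEval S F State.init

/-- `|Pr[A^{(C^f, f)} = 1] - Pr[A^{(𝓕, S^𝓕)} = 1]|`. -/
noncomputable def advantage {n q : ℕ} (C : Family n → BigFun n) (S : Program)
    (A : Distinguisher n q) : ℝ :=
  |(realGame C A true).toReal - (idealGame S A true).toReal|

/-- `(C^f, f)` is `(t, k, q, ε)`-indifferentiable from a random oracle, as witnessed by the
simulator `S`. -/
structure IndifferentiableVia {n : ℕ} (C : Family n → BigFun n) (S : Program)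
    (t k q : ℕ) (ε : ℝ) : Prop where
  time : RunsInTime n S q t
  calls : CallsPerInvocation n S k
  adv : ∀ A : Distinguisher n q, advantage C S A ≤ ε

end ABRPlus

open Finset
open scoped BigOperators

namespace ABRPlus

/-! ### Averages over finite sets of functions -/

/-! The simulator answers queries below the root with fresh coins. For a root query it searches its
history for a completed left evaluation and a completed right evaluation whose values are the two
inputs. Such a pair of triples determines all ten blocks of a message, and the answer is then the
oracle's value there; if there is no such pair, the answer is random.

To compare the two worlds, fix the six functions below the root and sample lazily both the real root
(partial map `ρ`) and the ideal oracle (partial map `α`). The root value at `inner f M` corresponds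
to the oracle value at `M`, and `Coupled` expresses that the determined values match. The worlds can
separate only if two messages lead to the same root input, or if an evaluation is completed after
its value has been used in a root query. The simulator does not see the evaluations inside
construction queries. Therefore `DecisionTree.play` fixes the coins in advance as a family `f` and
appends those inner queries at the very end. Badness of this final history covers every failure, so
`abs_realProb_sub_le` bounds the advantage by the probability of `BadHistory`.

For that probability, let `(e₀, e₁, e₂)` be a triple with output `y`. Then `e₁.val ⊕ e₂.val` is the
xor of the inputs of `e₀`, `e₀.val ⊕ e₂.val = y`, and hence `e₀.dm ⊕ e₁.val = y`. Whichever entry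
comes last, the other two represent a prescribed block as a sum of two recorded values. If no block
has more than `k` representations, there are at most `Q (k + 1)` targets, and at most `Q (k + 1) k`
answers hit one, besides at most `2 Q` colliding answers (`Side.card_hits_le`, `card_collides_le`).
The multiplicities are controlled by the exponential potential `∑ z, 2 ^ mult A B z`, which grows in
expectation by a factor of at most `1 + Q / 2 ^ n` per answer. `Side.expect_le_bound` combines both
estimates; `Q = 6 q` and `k = 2 n` give `O(n² q² / 2 ^ n)`.

The program keeps a table of the latest position of every leaf answer. A middle entry and the
desired output force both leaf answers, so a search is one pass through the history and the total
time is quadratic. `invoke_spec` and `idealEval_eq` connect the program with `DecisionTree.play`. -/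

/-- The indicator of a proposition, as a real number. -/
noncomputable def ind (p : Prop) : ℝ := open Classical in if p then 1 else 0

theorem ind_nonneg (p : Prop) : 0 ≤ ind p := by unfold ind; split_ifs <;> norm_num

theorem ind_le_one (p : Prop) : ind p ≤ 1 := by unfold ind; split_ifs <;> norm_num

theorem ind_of_true {p : Prop} (h : p) : ind p = 1 := if_pos h

theorem ind_of_false {p : Prop} (h : ¬p) : ind p = 0 := if_neg h

theorem ind_or_le (p r : Prop) : ind (p ∨ r) ≤ ind p + ind r := by
  by_cases hp : p
  · rw [ind_of_true hp, ind_of_true (Or.inl hp)]; linarith [ind_nonneg r]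
  · by_cases hr : r
    · rw [ind_of_true hr, ind_of_true (Or.inr hr)]; linarith [ind_nonneg p]
    · rw [ind_of_false (by tauto : ¬(p ∨ r))]; linarith [ind_nonneg p, ind_nonneg r]

/-- Resampling one value of a uniformly random function does not change averages. -/
theorem expect_update {α β : Type*} [Fintype α] [DecidableEq α] [Fintype β] [Nonempty β]
    (a : α) (G : (α → β) → ℝ) :
    𝔼 f, G f = 𝔼 b, 𝔼 f, G (Function.update f a b) := by
  -- Exchanging the new value with the old one is an involution on pairs, so it preserves averages.
  let e : β × (α → β) ≃ β × (α → β) :=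
    { toFun := fun p => (p.2 a, Function.update p.2 a p.1)
      invFun := fun p => (p.2 a, Function.update p.2 a p.1)
      left_inv := fun p => by simp
      right_inv := fun p => by simp }
  have h1 : 𝔼 p : β × (α → β), G p.2 = 𝔼 f, G f := by
    rw [← univ_product_univ, expect_product]
    exact Fintype.expect_const (ι := β) (𝔼 f, G f)
  have h2 : 𝔼 p : β × (α → β), G (Function.update p.2 a p.1) = 𝔼 p : β × (α → β), G p.2 :=
    Fintype.expect_equiv e _ _ fun p => rfl
  rw [← h1, ← h2, ← univ_product_univ, expect_product]

/-- Replace the value of one function of a family at one point. -/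
def Family.set {n : ℕ} (f : Family n) (i : Fin 7) (x : Block n × Block n) (v : Block n) :
    Family n :=
  Function.update f i (Function.update (f i) x v)

theorem Family.set_same {n : ℕ} (f : Family n) (i : Fin 7) (x : Block n × Block n)
    (v : Block n) : f.set i x v i x = v := by
  simp [Family.set]

theorem Family.set_of_ne {n : ℕ} (f : Family n) {i j : Fin 7} {x y : Block n × Block n}
    (v : Block n) (h : ¬(j = i ∧ y = x)) : f.set i x v j y = f j y := by
  unfold Family.set
  by_cases hj : j = i
  · subst hj
    have : y ≠ x := fun hy => h ⟨rfl, hy⟩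
    simp [this]
  · simp [hj]

/-- Resampling happens at two levels: the whole function `f i` is replaced by an independent `g`,
one value of `g` is resampled, and `g` is then absorbed into the family again. -/
theorem expect_family_set {n : ℕ} (i : Fin 7) (x : Block n × Block n) (G : Family n → ℝ) :
    𝔼 f, G f = 𝔼 v, 𝔼 f : Family n, G (f.set i x v) := by
  calc 𝔼 f, G f = 𝔼 g, 𝔼 f, G (Function.update f i g) := expect_update i G
    _ = 𝔼 f : Family n, 𝔼 g, G (Function.update f i g) := expect_comm _ _ _
    _ = 𝔼 f : Family n, 𝔼 g, 𝔼 v, G (Family.set (Function.update f i g) i x v) := by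
        refine expect_congr rfl fun f _ => ?_
        rw [expect_update x (fun g => G (Function.update f i g)), expect_comm univ univ]
        refine expect_congr rfl fun g _ => expect_congr rfl fun v _ => ?_
        simp [Family.set]
    _ = 𝔼 g, 𝔼 f : Family n, 𝔼 v, G (Family.set (Function.update f i g) i x v) :=
        expect_comm _ _ _
    _ = 𝔼 f : Family n, 𝔼 v, G (f.set i x v) :=
        (expect_update i (fun f : Family n => 𝔼 v, G (f.set i x v))).symm
    _ = 𝔼 v, 𝔼 f : Family n, G (f.set i x v) := expect_comm _ _ _

/-! ### The history of the simulator -/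

/-- An answered query to a compression function. -/
structure Entry (n : ℕ) : Type where
  idx : Fin 7
  arg : Block n × Block n
  val : Block n
deriving DecidableEq

/-- Answered queries without repetitions, the most recent one first. -/
abbrev History (n : ℕ) : Type := List (Entry n)

variable {n : ℕ}

/-- The recorded answer to a query. -/
def lookup (σ : History n) (i : Fin 7) (x : Block n × Block n) : Option (Block n) :=
  (σ.find? fun e => e.idx = i ∧ e.arg = x).map Entry.val

theorem lookup_nil (i : Fin 7) (x : Block n × Block n) : lookup ([] : History n) i x = none := rfl

theorem lookup_cons (e : Entry n) (σ : History n) (i : Fin 7) (x : Block n × Block n) :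
    lookup (e :: σ) i x = if e.idx = i ∧ e.arg = x then some e.val else lookup σ i x := by
  unfold lookup
  rw [List.find?_cons]
  by_cases h : e.idx = i ∧ e.arg = x <;> simp [h]

theorem mem_of_lookup {σ : History n} {i : Fin 7} {x : Block n × Block n} {v : Block n}
    (h : lookup σ i x = some v) : ⟨i, x, v⟩ ∈ σ := by
  induction σ with
  | nil => simp [lookup_nil] at h
  | cons e σ ih =>
    rw [lookup_cons] at h
    split_ifs at h with hc
    · obtain ⟨j, y, w⟩ := e
      simp only at hc h
      obtain ⟨rfl, rfl⟩ := hc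
      cases h
      exact List.mem_cons_self
    · exact List.mem_cons_of_mem _ (ih h)

/-- The answers of the history to queries other than root queries are those of `f`. -/
def Agrees (σ : History n) (f : Family n) : Prop := ∀ e ∈ σ, e.idx ≠ 6 → e.val = f e.idx e.arg

theorem Agrees.lookup_eq {σ : History n} {f : Family n} (h : Agrees σ f) {i : Fin 7}
    (hi : i ≠ 6) {x : Block n × Block n} {v : Block n} (hl : lookup σ i x = some v) :
    v = f i x :=
  h _ (mem_of_lookup hl) hi

/-! ### The search of the simulator -/

/-- The indices of one half of the tree, and the input of the root that it feeds. -/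
structure Side (n : ℕ) : Type where
  mid : Fin 7
  leaf₁ : Fin 7
  leaf₂ : Fin 7
  proj : Block n × Block n → Block n
  mid_ne : mid ≠ 6
  leaf₁_ne : leaf₁ ≠ 6
  leaf₂_ne : leaf₂ ≠ 6
  mid_ne_leaf₁ : mid ≠ leaf₁
  mid_ne_leaf₂ : mid ≠ leaf₂
  leaf₁_ne_leaf₂ : leaf₁ ≠ leaf₂

/-- The left half. -/
def left (n : ℕ) : Side n :=
  ⟨4, 0, 1, Prod.fst, by decide, by decide, by decide, by decide, by decide, by decide⟩

/-- The right half. -/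
def right (n : ℕ) : Side n :=
  ⟨5, 2, 3, Prod.snd, by decide, by decide, by decide, by decide, by decide, by decide⟩

/-- The most recent entry with a given index and a given answer. -/
def latest (σ : History n) (i : Fin 7) (v : Block n) : Option (Entry n) :=
  σ.find? fun e => e.idx = i ∧ e.val = v

/-- Complete the entry `e` to a triple with output `y`. -/
def Side.extend (S : Side n) (σ : History n) (y : Block n) (e : Entry n) :
    Option (Entry n × Entry n × Entry n) :=
  if e.idx = S.mid then
    -- The output forces the answer of the second leaf, and the xor relation then forces that of the
    -- first, so no search over pairs is needed.
    (latest σ S.leaf₂ (e.val ^^^ y)).bind fun e₂ =>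
      (latest σ S.leaf₁ ((e.val ^^^ y) ^^^ e.arg.1 ^^^ e.arg.2)).map fun e₁ => (e, e₁, e₂)
  else none

/-- Look for a triple with output `y`. -/
def Side.search (S : Side n) (σ : History n) (y : Block n) :
    Option (Entry n × Entry n × Entry n) :=
  σ.findSome? (S.extend σ y)

/-- The message that consists of a triple in the left half and one in the right half. -/
def assemble (l r : Entry n × Entry n × Entry n) : Message n :=
  ![l.2.1.arg.1, l.2.1.arg.2, l.2.2.arg.1, l.2.2.arg.2,
    r.2.1.arg.1, r.2.1.arg.2, r.2.2.arg.1, r.2.2.arg.2,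
    l.1.arg.2 ^^^ l.2.2.val, r.1.arg.2 ^^^ r.2.2.val]

/-- Look for a message that leads to the input `x` of the root. -/
def findMessage (σ : History n) (x : Block n × Block n) : Option (Message n) :=
  ((left n).search σ x.1).bind fun l => ((right n).search σ x.2).map fun r => assemble l r

/-- The answer to a query that is not in the history. -/
def fresh (F : BigFun n) (f : Family n) (σ : History n) (i : Fin 7) (x : Block n × Block n) :
    Block n :=
  if i = 6 then ((findMessage σ x).map F).getD (f 6 x) else f i x

/-! ### The ideal world with predetermined coins -/

/-- Record the query `(i, x)` with its answer by `f`, unless it is there. -/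
def ask (f : Family n) (σ : History n) (p : Fin 7 × (Block n × Block n)) : History n :=
  match lookup σ p.1 p.2 with
  | some _ => σ
  | none => ⟨p.1, p.2, f p.1 p.2⟩ :: σ

/-- Record a sequence of queries, each of which may depend on the history. -/
def askAll (f : Family n) : List (History n → Fin 7 × (Block n × Block n)) → History n → History n
  | [], σ => σ
  | Q :: l, σ => askAll f l (ask f σ (Q σ))

/-- The recorded answer, or `0`. -/
def value (σ : History n) (i : Fin 7) (x : Block n × Block n) : Block n := (lookup σ i x).getD 0

/-- The queries that lead from a message to the input of the root. -/
def innerQueries (M : Message n) : List (History n → Fin 7 × (Block n × Block n)) :=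
  [fun _ => (0, (M 0, M 1)), fun _ => (1, (M 2, M 3)),
   fun _ => (2, (M 4, M 5)), fun _ => (3, (M 6, M 7)),
   fun σ => (4, (M 8 ^^^ value σ 0 (M 0, M 1), M 8 ^^^ value σ 1 (M 2, M 3))),
   fun σ => (5, (M 9 ^^^ value σ 2 (M 4, M 5), M 9 ^^^ value σ 3 (M 6, M 7)))]

/-- The output of a distinguisher in the ideal world, and the history after all the queries inside
of its construction queries have been appended. The coins of the simulator are `f`. -/
def DecisionTree.play (F : BigFun n) (f : Family n) :
    {q : ℕ} → DecisionTree n q → History n → List (Message n) → Bool × History n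
  -- The simulator must not see the inner queries, but badness is judged on a history that contains
  -- them; hence they are recorded only here, with answers from the same `f`.
  | _, .output b, σ, ms => (b, askAll f (ms.flatMap innerQueries) σ)
  | _, .query (.construction M) next, σ, ms => (next (F M)).play F f σ (M :: ms)
  | _, .query (.primitive i x) next, σ, ms =>
      match lookup σ i x with
      | some v => (next v).play F f σ ms
      | none => (next (fresh F f σ i x)).play F f (⟨i, x, fresh F f σ i x⟩ :: σ) ms

/-! ### Insensitivity to the coins of recorded queries -/

/-- The two families agree on the queries outside of the history. -/
def AgreeOff (σ : History n) (f f' : Family n) : Prop :=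
  ∀ i x, lookup σ i x = none → f i x = f' i x

theorem AgreeOff.cons {σ : History n} {f f' : Family n} (h : AgreeOff σ f f') (e : Entry n) :
    AgreeOff (e :: σ) f f' := by
  intro i x hl
  rw [lookup_cons] at hl
  split_ifs at hl
  exact h i x hl

theorem agreeOff_set (σ : History n) (f : Family n) (i : Fin 7) (x : Block n × Block n)
    (v w : Block n) : AgreeOff (⟨i, x, w⟩ :: σ) (f.set i x v) f := by
  intro j y hl
  rw [lookup_cons] at hl
  split_ifs at hl with hc
  exact f.set_of_ne v fun h => hc ⟨h.1.symm, h.2.symm⟩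

theorem ask_congr {σ : History n} {f f' : Family n} (h : AgreeOff σ f f')
    (p : Fin 7 × (Block n × Block n)) : ask f σ p = ask f' σ p := by
  unfold ask
  split
  · rfl
  · next hl => rw [h _ _ hl]

theorem AgreeOff.ask {σ : History n} {f f' : Family n} (h : AgreeOff σ f f')
    (p : Fin 7 × (Block n × Block n)) : AgreeOff (ask f σ p) f f' := by
  unfold ABRPlus.ask
  split
  · exact h
  · exact h.cons _

theorem askAll_congr {f f' : Family n} (l : List (History n → Fin 7 × (Block n × Block n))) :
    ∀ {σ : History n}, AgreeOff σ f f' → askAll f l σ = askAll f' l σ := by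
  induction l with
  | nil => intro σ _; rfl
  | cons Q l ih =>
    intro σ h
    rw [askAll, askAll, ← ask_congr h]
    exact ih (h.ask _)

theorem fresh_congr {F : BigFun n} {σ : History n} {f f' : Family n} (h : AgreeOff σ f f')
    {i : Fin 7} {x : Block n × Block n} (hl : lookup σ i x = none) :
    fresh F f σ i x = fresh F f' σ i x := by
  unfold fresh
  split_ifs with hi
  · subst hi; rw [h _ _ hl]
  · exact h _ _ hl

/-- A recorded query is never read from `f` again. Its coin can therefore be resampled, which makes
each new coin uniform given the past. -/
theorem play_congr {F : BigFun n} {f f' : Family n} {q : ℕ} (D : DecisionTree n q) :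
    ∀ {σ : History n} {ms : List (Message n)}, AgreeOff σ f f' →
      D.play F f σ ms = D.play F f' σ ms := by
  induction D with
  | output b => intro σ ms h; simp only [DecisionTree.play]; rw [askAll_congr _ h]
  | query x next ih =>
    intro σ ms h
    cases x with
    | construction M => exact ih _ h
    | primitive i x =>
      simp only [DecisionTree.play]
      split
      · exact ih _ h
      · next hl =>
        rw [← fresh_congr h hl]
        exact ih _ (h.cons _)

/-! ### Triples and bad histories -/

/-- The Davies–Meyer style sum of an answer and both blocks of its query. -/
def Entry.dm (e : Entry n) : Block n := e.val ^^^ e.arg.1 ^^^ e.arg.2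

/-- The three entries are the queries of one evaluation of the height-2 tree. -/
def Side.IsTriple (S : Side n) (t : Entry n × Entry n × Entry n) : Prop :=
  t.1.idx = S.mid ∧ t.2.1.idx = S.leaf₁ ∧ t.2.2.idx = S.leaf₂ ∧
    t.1.arg.1 ^^^ t.1.arg.2 = t.2.1.val ^^^ t.2.2.val

/-- The value of the height-2 tree. -/
def out (t : Entry n × Entry n × Entry n) : Block n := t.1.val ^^^ t.2.2.val

/-- All three entries are in the history. -/
def InHist (σ : History n) (t : Entry n × Entry n × Entry n) : Prop :=
  t.1 ∈ σ ∧ t.2.1 ∈ σ ∧ t.2.2 ∈ σ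

/-- The inputs of root queries, and the values of completed evaluations. -/
def Side.Target (S : Side n) (σ : History n) (y : Block n) : Prop :=
  (∃ e ∈ σ, e.idx = 6 ∧ S.proj e.arg = y) ∨ ∃ t, InHist σ t ∧ S.IsTriple t ∧ out t = y

/-- The entry `e` collides with an earlier one. -/
def Collides (e : Entry n) (σ : History n) : Prop :=
  e.idx ≠ 6 ∧ ∃ e' ∈ σ, e'.idx = e.idx ∧ (e'.val = e.val ∨ e'.dm = e.dm)

/-- The entry `e` completes an evaluation whose value is a target. -/
def Side.Hits (S : Side n) (e : Entry n) (σ : History n) : Prop :=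
  ∃ t, InHist (e :: σ) t ∧ (t.1 = e ∨ t.2.1 = e ∨ t.2.2 = e) ∧ S.IsTriple t ∧ S.Target σ (out t)

/-- At some time, an entry has collided or has completed an evaluation whose value was a target. -/
def Side.Bad (S : Side n) : History n → Prop
  | [] => False
  | e :: σ => Side.Bad S σ ∨ Collides e σ ∨ S.Hits e σ

theorem InHist.mono {σ τ : History n} {t : Entry n × Entry n × Entry n} (h : InHist σ t)
    (hs : σ ⊆ τ) : InHist τ t :=
  ⟨hs h.1, hs h.2.1, hs h.2.2⟩

theorem InHist.of_cons {e : Entry n} {σ : History n} {t : Entry n × Entry n × Entry n}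
    (h : InHist (e :: σ) t) : InHist σ t ∨ (t.1 = e ∨ t.2.1 = e ∨ t.2.2 = e) := by
  unfold InHist at *
  simp only [List.mem_cons] at h
  tauto

/-- Of two distinct entries, the later would have collided with the earlier. -/
theorem Side.eq_of_not_bad {S : Side n} {σ : History n} (h : ¬S.Bad σ) {e e' : Entry n}
    (he : e ∈ σ) (he' : e' ∈ σ) (hi : e.idx = e'.idx) (h6 : e.idx ≠ 6)
    (hv : e.val = e'.val ∨ e.dm = e'.dm) : e = e' := by
  induction σ with
  | nil => simp at he
  | cons d σ ih =>
    simp only [Side.Bad, not_or] at h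
    rcases List.mem_cons.1 he with h₁ | h₁ <;> rcases List.mem_cons.1 he' with h₂ | h₂
    · rw [h₁, h₂]
    · subst h₁
      exact absurd ⟨h6, e', h₂, hi.symm, hv.imp Eq.symm Eq.symm⟩ h.2.1
    · subst h₂
      exact absurd ⟨hi ▸ h6, e, h₁, hi, hv⟩ h.2.1
    · exact ih h.1 h₁ h₂

theorem xor_left_cancel {a b c : Block n} (h : a ^^^ b = a ^^^ c) : b = c := by
  simpa using h

theorem xor_right_cancel {a b c : Block n} (h : b ^^^ a = c ^^^ a) : b = c := by
  simpa using h

/-- Consider the newest entry. If it belongs to only one of the triples, the value of the other is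
already a target and the newest entry is a hit. If it belongs to both, it has the same place in
both, and the two xor relations together with the absence of collisions determine the other places.
-/
theorem Side.triple_unique {S : Side n} {σ : History n} (h : ¬S.Bad σ)
    {t t' : Entry n × Entry n × Entry n} (ht : InHist σ t) (ht' : InHist σ t')
    (hS : S.IsTriple t) (hS' : S.IsTriple t') (ho : out t = out t') : t = t' := by
  induction σ with
  | nil => exact absurd ht.1 (by simp)
  | cons d σ ih =>
    have hb := h
    simp only [Side.Bad, not_or] at h
    rcases ht.of_cons with h1 | h1
    · rcases ht'.of_cons with h2 | h2
      · exact ih h.1 h1 h2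
      · exact absurd ⟨t', ht', h2, hS', Or.inr ⟨t, h1, hS, ho⟩⟩ h.2.2
    · rcases ht'.of_cons with h2 | h2
      · exact absurd ⟨t, ht, h1, hS, Or.inr ⟨t', h2, hS', ho.symm⟩⟩ h.2.2
      · obtain ⟨e₀, e₁, e₂⟩ := t
        obtain ⟨e₀', e₁', e₂'⟩ := t'
        obtain ⟨i₀, i₁, i₂, hx⟩ := hS
        obtain ⟨i₀', i₁', i₂', hx'⟩ := hS'
        obtain ⟨m₀, m₁, m₂⟩ := ht
        obtain ⟨m₀', m₁', m₂'⟩ := ht'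
        simp only [out] at *
        have n₀ : e₀.idx ≠ 6 := i₀ ▸ S.mid_ne
        have n₁ : e₁.idx ≠ 6 := i₁ ▸ S.leaf₁_ne
        have n₂ : e₂.idx ≠ 6 := i₂ ▸ S.leaf₂_ne
        have eq₀ := fun hv => Side.eq_of_not_bad hb m₀ m₀' (i₀.trans i₀'.symm) n₀ hv
        have eq₁ := fun hv => Side.eq_of_not_bad hb m₁ m₁' (i₁.trans i₁'.symm) n₁ (Or.inl hv)
        have eq₂ := fun hv => Side.eq_of_not_bad hb m₂ m₂' (i₂.trans i₂'.symm) n₂ (Or.inl hv)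
        have a₁ := S.mid_ne_leaf₁
        have a₂ := S.mid_ne_leaf₂
        have a₃ := S.leaf₁_ne_leaf₂
        rcases h1 with h1 | h1 | h1
        · have : e₀' = e₀ := by
            rcases h2 with h2 | h2 | h2
            · rw [h1, h2]
            · exact absurd (by rw [← i₀, ← i₁', h1, h2]) a₁
            · exact absurd (by rw [← i₀, ← i₂', h1, h2]) a₂
          subst this
          obtain rfl := eq₂ (xor_left_cancel ho)
          obtain rfl := eq₁ (xor_right_cancel (hx.symm.trans hx'))
          rfl
        · have : e₁' = e₁ := by
            rcases h2 with h2 | h2 | h2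
            · exact absurd (by rw [← i₀', ← i₁, h1, h2]) a₁
            · rw [h1, h2]
            · exact absurd (by rw [← i₁, ← i₂', h1, h2]) a₃
          subst this
          -- The second leaf cancels between the two relations: the `dm` of the middle entry is the
          -- answer of the common first leaf xor the output.
          obtain rfl := eq₀ (Or.inr (by
            unfold Entry.dm
            generalize e₀.arg.1 = a, e₀.arg.2 = b, e₀'.arg.1 = a', e₀'.arg.2 = b' at *
            ext i hi
            have p₁ := congrArg (fun z : Block n => z[i]) hx
            have p₂ := congrArg (fun z : Block n => z[i]) hx'
            have p₃ := congrArg (fun z : Block n => z[i]) ho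
            simp only [BitVec.getElem_xor] at p₁ p₂ p₃ ⊢
            grind))
          obtain rfl := eq₂ (xor_left_cancel ho)
          rfl
        · have : e₂' = e₂ := by
            rcases h2 with h2 | h2 | h2
            · exact absurd (by rw [← i₀', ← i₂, h1, h2]) a₂
            · exact absurd (by rw [← i₁', ← i₂, h1, h2]) a₃
            · rw [h1, h2]
          subst this
          obtain rfl := eq₀ (Or.inl (xor_right_cancel ho))
          obtain rfl := eq₁ (xor_right_cancel (hx.symm.trans hx'))
          rfl

/-- An evaluation whose value is the input of a root query was complete before that query. -/
theorem Side.inHist_of_root {S : Side n} {σ τ : History n} {e : Entry n} (h6 : e.idx = 6)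
    (h : ¬S.Bad (τ ++ e :: σ)) {t : Entry n × Entry n × Entry n} (hS : S.IsTriple t)
    (ht : InHist (τ ++ e :: σ) t) (ho : out t = S.proj e.arg) : InHist σ t := by
  induction τ with
  | nil =>
    rcases InHist.of_cons ht with h1 | h1
    · exact h1
    · obtain ⟨i₀, i₁, i₂, -⟩ := hS
      rcases h1 with h1 | h1 | h1
      · exact absurd (by rw [← i₀, h1, h6]) S.mid_ne
      · exact absurd (by rw [← i₁, h1, h6]) S.leaf₁_ne
      · exact absurd (by rw [← i₂, h1, h6]) S.leaf₂_ne
  | cons d τ ih =>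
    simp only [List.cons_append, Side.Bad, not_or] at h
    rcases InHist.of_cons ht with h1 | h1
    · exact ih h.1 h1
    -- The root query has made the value a target, so a later completion is a hit.
    · exact absurd ⟨t, ht, h1, hS, Or.inl ⟨e, by simp, h6, ho.symm⟩⟩ h.2.2

/-! ### The search -/

theorem latest_eq_some {σ : History n} {i : Fin 7} {v : Block n} {e : Entry n}
    (h : latest σ i v = some e) : e ∈ σ ∧ e.idx = i ∧ e.val = v := by
  have := List.find?_some h
  exact ⟨List.mem_of_find?_eq_some h, by simpa using this⟩

theorem latest_ne_none {σ : History n} {e : Entry n} (h : e ∈ σ) :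
    ∃ e', latest σ e.idx e.val = some e' := by
  rw [← Option.isSome_iff_exists]
  unfold latest
  rw [List.find?_isSome]
  exact ⟨e, h, by simp⟩

theorem Side.search_sound {S : Side n} {σ : History n} {y : Block n}
    {t : Entry n × Entry n × Entry n} (h : S.search σ y = some t) :
    InHist σ t ∧ S.IsTriple t ∧ out t = y := by
  obtain ⟨e, he, h⟩ := List.exists_of_findSome?_eq_some h
  unfold Side.extend at h
  split_ifs at h with hi
  simp only [Option.bind_eq_some_iff, Option.map_eq_some_iff] at h
  obtain ⟨e₂, h₂, e₁, h₁, rfl⟩ := h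
  obtain ⟨m₂, i₂, v₂⟩ := latest_eq_some h₂
  obtain ⟨m₁, i₁, v₁⟩ := latest_eq_some h₁
  refine ⟨⟨he, m₁, m₂⟩, ⟨hi, i₁, i₂, ?_⟩, ?_⟩
  · simp only [v₁, v₂]
    generalize e.arg.1 = a, e.arg.2 = b
    ext i hi
    simp only [BitVec.getElem_xor]
    grind
  · simp only [out, v₂]
    rw [← BitVec.xor_assoc]
    simp

/-- The middle entry of the given triple passes both table lookups. The leaves returned need only
have the right answers, so the search may find a different triple. -/
theorem Side.search_complete {S : Side n} {σ : History n} {t : Entry n × Entry n × Entry n}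
    (ht : InHist σ t) (hS : S.IsTriple t) : S.search σ (out t) ≠ none := by
  intro h
  have h := List.findSome?_eq_none_iff.1 h t.1 ht.1
  obtain ⟨i₀, i₁, i₂, hx⟩ := hS
  unfold Side.extend out at h
  have h₂ : t.1.val ^^^ (t.1.val ^^^ t.2.2.val) = t.2.2.val := by
    rw [← BitVec.xor_assoc]
    simp
  have h₁ : t.2.2.val ^^^ t.1.arg.1 ^^^ t.1.arg.2 = t.2.1.val := by
    rw [BitVec.xor_assoc, hx, BitVec.xor_comm, BitVec.xor_assoc]
    simp
  rw [if_pos i₀, h₂, h₁, ← i₁, ← i₂] at h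
  obtain ⟨e₂, he₂⟩ := latest_ne_none ht.2.2
  obtain ⟨e₁, he₁⟩ := latest_ne_none ht.2.1
  simp [he₁, he₂] at h

/-! ### Messages and their pairs of evaluations -/

/-- The input of the root. -/
def inner (f : Family n) (M : Message n) : Block n × Block n :=
  (abr (f 4) (f 0) (f 1) (M 0) (M 1) (M 2) (M 3) (M 8),
   abr (f 5) (f 2) (f 3) (M 4) (M 5) (M 6) (M 7) (M 9))

theorem abrPlus_eq (f : Family n) (M : Message n) : abrPlus f M = f 6 (inner f M) := rfl

/-- The evaluation of a height-2 tree. -/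
def evaluation (f : Family n) (i₀ i₁ i₂ : Fin 7) (x₁ x₂ x₃ x₄ m : Block n) :
    Entry n × Entry n × Entry n :=
  (⟨i₀, (m ^^^ f i₁ (x₁, x₂), m ^^^ f i₂ (x₃, x₄)),
      f i₀ (m ^^^ f i₁ (x₁, x₂), m ^^^ f i₂ (x₃, x₄))⟩,
    ⟨i₁, (x₁, x₂), f i₁ (x₁, x₂)⟩, ⟨i₂, (x₃, x₄), f i₂ (x₃, x₄)⟩)

/-- The evaluation of the left half on a message. -/
def leftTriple (f : Family n) (M : Message n) : Entry n × Entry n × Entry n :=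
  evaluation f 4 0 1 (M 0) (M 1) (M 2) (M 3) (M 8)

/-- The evaluation of the right half on a message. -/
def rightTriple (f : Family n) (M : Message n) : Entry n × Entry n × Entry n :=
  evaluation f 5 2 3 (M 4) (M 5) (M 6) (M 7) (M 9)

theorem xor_evaluation (m r s : Block n) : m ^^^ r ^^^ (m ^^^ s) = r ^^^ s := by
  rw [BitVec.xor_comm m r, BitVec.xor_assoc, ← BitVec.xor_assoc m m s]
  simp

theorem isTriple_leftTriple (f : Family n) (M : Message n) :
    (left n).IsTriple (leftTriple f M) :=
  ⟨rfl, rfl, rfl, xor_evaluation _ _ _⟩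

theorem isTriple_rightTriple (f : Family n) (M : Message n) :
    (right n).IsTriple (rightTriple f M) :=
  ⟨rfl, rfl, rfl, xor_evaluation _ _ _⟩

theorem out_leftTriple (f : Family n) (M : Message n) :
    out (leftTriple f M) = (inner f M).1 := rfl

theorem out_rightTriple (f : Family n) (M : Message n) :
    out (rightTriple f M) = (inner f M).2 := rfl

/-- All queries that lead from `M` to the input of the root are in the history. -/
def Complete (σ : History n) (f : Family n) (M : Message n) : Prop :=
  InHist σ (leftTriple f M) ∧ InHist σ (rightTriple f M)

theorem Complete.mono {σ τ : History n} {f : Family n} {M : Message n} (h : Complete σ f M)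
    (hs : σ ⊆ τ) : Complete τ f M :=
  ⟨h.1.mono hs, h.2.mono hs⟩

theorem assemble_triples (f : Family n) (M : Message n) :
    assemble (leftTriple f M) (rightTriple f M) = M := by
  funext k
  fin_cases k <;> simp [assemble, leftTriple, rightTriple, evaluation]

/-- The choice of `m` makes the second middle input right by cancellation, and the xor relation then
makes the first one right; `Agrees` identifies the recorded answers with those of `f`. -/
theorem evaluation_eq {f : Family n} {i₀ i₁ i₂ : Fin 7} (h₀ : i₀ ≠ 6) (h₁ : i₁ ≠ 6)
    (h₂ : i₂ ≠ 6) {σ : History n} (hσ : Agrees σ f) {t : Entry n × Entry n × Entry n}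
    (ht : InHist σ t) (e₀ : t.1.idx = i₀) (e₁ : t.2.1.idx = i₁) (e₂ : t.2.2.idx = i₂)
    (hx : t.1.arg.1 ^^^ t.1.arg.2 = t.2.1.val ^^^ t.2.2.val) :
    evaluation f i₀ i₁ i₂ t.2.1.arg.1 t.2.1.arg.2 t.2.2.arg.1 t.2.2.arg.2
      (t.1.arg.2 ^^^ t.2.2.val) = t := by
  obtain ⟨⟨j₀, ⟨a₀, b₀⟩, v₀⟩, ⟨j₁, ⟨a₁, b₁⟩, v₁⟩, ⟨j₂, ⟨a₂, b₂⟩, v₂⟩⟩ := t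
  simp only at e₀ e₁ e₂ hx
  subst e₀ e₁ e₂
  have q₀ := hσ _ ht.1 h₀
  have q₁ := hσ _ ht.2.1 h₁
  have q₂ := hσ _ ht.2.2 h₂
  simp only at q₀ q₁ q₂
  have k₁ : b₀ ^^^ v₂ ^^^ v₁ = a₀ := by
    ext i hi
    have p := congrArg (fun z : Block n => z[i]) hx
    simp only [BitVec.getElem_xor] at p ⊢
    grind
  have k₂ : b₀ ^^^ v₂ ^^^ v₂ = b₀ := by simp
  simp only [evaluation, ← q₁, ← q₂, k₁, k₂, ← q₀]

theorem triples_assemble {f : Family n} {σ : History n} (hσ : Agrees σ f)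
    {l r : Entry n × Entry n × Entry n} (hl : InHist σ l) (hr : InHist σ r)
    (hL : (left n).IsTriple l) (hR : (right n).IsTriple r) :
    leftTriple f (assemble l r) = l ∧ rightTriple f (assemble l r) = r := by
  have h₁ := evaluation_eq (left n).mid_ne (left n).leaf₁_ne (left n).leaf₂_ne hσ hl
    hL.1 hL.2.1 hL.2.2.1 hL.2.2.2
  have h₂ := evaluation_eq (right n).mid_ne (right n).leaf₁_ne (right n).leaf₂_ne hσ hr
    hR.1 hR.2.1 hR.2.2.1 hR.2.2.2
  constructor
  · simpa [leftTriple, assemble, left] using h₁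
  · simpa [rightTriple, assemble, right] using h₂

theorem findMessage_sound {f : Family n} {σ : History n} (hσ : Agrees σ f)
    {x : Block n × Block n} {M : Message n} (h : findMessage σ x = some M) :
    Complete σ f M ∧ inner f M = x := by
  unfold findMessage at h
  simp only [Option.bind_eq_some_iff, Option.map_eq_some_iff] at h
  obtain ⟨l, hl, r, hr, rfl⟩ := h
  obtain ⟨l₁, l₂, l₃⟩ := Side.search_sound hl
  obtain ⟨r₁, r₂, r₃⟩ := Side.search_sound hr
  obtain ⟨hL, hR⟩ := triples_assemble hσ l₁ r₁ l₂ r₂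
  have hl' := out_leftTriple f (assemble l r)
  have hr' := out_rightTriple f (assemble l r)
  unfold Complete
  rw [hL] at hl' ⊢
  rw [hR] at hr' ⊢
  exact ⟨⟨l₁, r₁⟩, Prod.ext (hl'.symm.trans l₃) (hr'.symm.trans r₃)⟩

theorem findMessage_complete {f : Family n} {σ : History n} {M : Message n}
    (h : Complete σ f M) : ∃ M', findMessage σ (inner f M) = some M' := by
  have hl := Side.search_complete h.1 (isTriple_leftTriple f M)
  have hr := Side.search_complete h.2 (isTriple_rightTriple f M)
  obtain ⟨l, hl⟩ := Option.ne_none_iff_exists'.1 hl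
  obtain ⟨r, hr⟩ := Option.ne_none_iff_exists'.1 hr
  rw [out_leftTriple] at hl
  rw [out_rightTriple] at hr
  exact ⟨assemble l r, by simp [findMessage, hl, hr]⟩

/-! ### What a good history guarantees -/

/-- The history is bad for one of the two halves. -/
def BadHistory (σ : History n) : Prop := (left n).Bad σ ∨ (right n).Bad σ

/-- A message can be read off its two triples, and each triple is determined by its value. -/
theorem eq_of_inner_eq {f : Family n} {σ : History n} (h : ¬BadHistory σ) {M M' : Message n}
    (hM : Complete σ f M) (hM' : Complete σ f M') (he : inner f M = inner f M') : M = M' := by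
  unfold BadHistory at h
  push Not at h
  rw [← assemble_triples f M, ← assemble_triples f M',
    Side.triple_unique h.1 hM.1 hM'.1 (isTriple_leftTriple f M) (isTriple_leftTriple f M')
      (congrArg Prod.fst he),
    Side.triple_unique h.2 hM.2 hM'.2 (isTriple_rightTriple f M) (isTriple_rightTriple f M')
      (congrArg Prod.snd he)]

/-- This is why searching only the history before a root query misses nothing. -/
theorem complete_of_root {f : Family n} {σ τ : History n} {e : Entry n} (h6 : e.idx = 6)
    (h : ¬BadHistory (τ ++ e :: σ)) {M : Message n} (hM : Complete (τ ++ e :: σ) f M)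
    (he : inner f M = e.arg) : Complete σ f M := by
  unfold BadHistory at h
  push Not at h
  exact ⟨Side.inHist_of_root h6 h.1 (isTriple_leftTriple f M) hM.1 (congrArg Prod.fst he),
    Side.inHist_of_root h6 h.2 (isTriple_rightTriple f M) hM.2 (congrArg Prod.snd he)⟩

/-! ### Multiplicities of sums -/

/-- The number of representations of `z` as a sum of an element of `A` and an element of `B`. -/
def mult (A B : Finset (Block n)) (z : Block n) : ℕ := #{a ∈ A | a ^^^ z ∈ B}

theorem mult_comm (A B : Finset (Block n)) (z : Block n) : mult A B z = mult B A z := by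
  refine card_bij' (fun a _ => a ^^^ z) (fun a _ => a ^^^ z) ?_ ?_ ?_ ?_ <;>
    simp +contextual [mem_filter]

theorem mult_insert_le (A B : Finset (Block n)) (v z : Block n) :
    mult (insert v A) B z ≤ mult A B z + if v ^^^ z ∈ B then 1 else 0 := by
  unfold mult
  rw [filter_insert]
  split_ifs
  · exact card_insert_le _ _
  · simp

/-- The exponential potential of the multiplicities. -/
noncomputable def potential (A B : Finset (Block n)) : ℝ := ∑ z, 2 ^ mult A B z

theorem potential_comm (A B : Finset (Block n)) : potential A B = potential B A := by
  simp only [potential, mult_comm A B]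

theorem potential_nonneg (A B : Finset (Block n)) : 0 ≤ potential A B :=
  sum_nonneg fun _ _ => by positivity

theorem pow_le_potential (A B : Finset (Block n)) (z : Block n) :
    (2 : ℝ) ^ mult A B z ≤ potential A B :=
  single_le_sum (f := fun z => (2 : ℝ) ^ mult A B z) (fun _ _ => by positivity) (mem_univ z)

theorem card_block (n : ℕ) : Fintype.card (Block n) = 2 ^ n := by
  rw [Fintype.card_congr (BitVec.equivFin (m := n)).toEquiv, Fintype.card_fin]

theorem expect_ind_mem (P : Block n → Prop) (s : Finset (Block n)) (h : ∀ v, P v → v ∈ s) :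
    𝔼 v, ind (P v) ≤ #s / 2 ^ n := by
  have : ∀ v, ind (P v) ≤ if v ∈ s then (1 : ℝ) else 0 := by
    intro v
    by_cases hv : P v
    · rw [if_pos (h v hv)]; exact ind_le_one _
    · rw [ind_of_false hv]; split_ifs <;> norm_num
  refine (expect_le_expect fun v _ => this v).trans ?_
  rw [Fintype.expect_eq_sum_div_card, card_block]
  simp

/-- The new element raises the multiplicity of `z`, and so doubles its term, only if its sum with
`z` lies in `B`; this has probability at most `#B / 2 ^ n`. -/
theorem expect_potential_insert (A B : Finset (Block n)) (c : Block n) :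
    𝔼 v, potential (insert (v ^^^ c) A) B ≤ (1 + #B / 2 ^ n) * potential A B := by
  unfold potential
  rw [expect_sum_comm, mul_sum]
  refine sum_le_sum fun z _ => ?_
  have h : ∀ v : Block n, (2 : ℝ) ^ mult (insert (v ^^^ c) A) B z ≤
      2 ^ mult A B z + 2 ^ mult A B z * ind (v ^^^ c ^^^ z ∈ B) := by
    intro v
    refine (pow_le_pow_right₀ (by norm_num) (mult_insert_le A B (v ^^^ c) z)).trans ?_
    rw [pow_add]
    split_ifs with hv
    · rw [ind_of_true hv]; linarith
    · rw [ind_of_false hv]; simp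
  refine (expect_le_expect fun v _ => h v).trans ?_
  rw [expect_add_distrib, ← mul_expect, Fintype.expect_const]
  have := expect_ind_mem (fun v : Block n => v ^^^ c ^^^ z ∈ B)
    (B.image fun b => b ^^^ z ^^^ c) fun v hv => mem_image.2 ⟨_, hv, by simp⟩
  have h2 : (#(B.image fun b => b ^^^ z ^^^ c) : ℝ) ≤ #B := by exact_mod_cast card_image_le
  have h3 : (#(B.image fun b => b ^^^ z ^^^ c) : ℝ) / 2 ^ n ≤ #B / 2 ^ n := by gcongr
  nlinarith [pow_pos (two_pos : (0 : ℝ) < 2) (mult A B z)]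

/-! ### The potential of a history -/

/-- The values of a function on the entries with a given index. -/
def vals (σ : History n) (i : Fin 7) (κ : Entry n → Block n) : Finset (Block n) :=
  ((σ.filter fun e => e.idx = i).map κ).toFinset

theorem mem_vals {σ : History n} {i : Fin 7} {κ : Entry n → Block n} {v : Block n} :
    v ∈ vals σ i κ ↔ ∃ e ∈ σ, e.idx = i ∧ κ e = v := by
  simp [vals, and_assoc]

theorem vals_cons (e : Entry n) (σ : History n) (i : Fin 7) (κ : Entry n → Block n) :
    vals (e :: σ) i κ = if e.idx = i then insert (κ e) (vals σ i κ) else vals σ i κ := by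
  unfold vals
  rw [List.filter_cons]
  split_ifs <;> simp_all

theorem card_vals_le (σ : History n) (i : Fin 7) (κ : Entry n → Block n) :
    #(vals σ i κ) ≤ σ.length :=
  (List.toFinset_card_le _).trans (by rw [List.length_map]; exact List.length_filter_le _ _)

/-- A statistic of entries that is a translate of the answer. -/
def IsTranslate (κ : Entry n → Block n) : Prop :=
  ∀ (i : Fin 7) (x : Block n × Block n), ∃ c, ∀ v, κ ⟨i, x, v⟩ = v ^^^ c

theorem isTranslate_val : IsTranslate (Entry.val : Entry n → Block n) :=
  fun _ _ => ⟨0, fun v => by simp⟩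

theorem isTranslate_dm : IsTranslate (Entry.dm : Entry n → Block n) :=
  fun _ x => ⟨x.1 ^^^ x.2, fun v => by simp [Entry.dm, BitVec.xor_assoc]⟩

/-- Since the indices differ, the new answer enters at most one of the two sets, and it enters as a
translate of a uniform block. -/
theorem expect_potential_vals {σ : History n} {Q : ℕ} (hQ : σ.length ≤ Q) {i₁ i₂ : Fin 7}
    (hi : i₁ ≠ i₂) {κ₁ κ₂ : Entry n → Block n} (h₁ : IsTranslate κ₁) (h₂ : IsTranslate κ₂)
    (i : Fin 7) (x : Block n × Block n) :
    𝔼 v, potential (vals (⟨i, x, v⟩ :: σ) i₁ κ₁) (vals (⟨i, x, v⟩ :: σ) i₂ κ₂) ≤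
      (1 + Q / 2 ^ n) * potential (vals σ i₁ κ₁) (vals σ i₂ κ₂) := by
  have hcard : ∀ j (κ : Entry n → Block n),
      (1 + (#(vals σ j κ) : ℝ) / 2 ^ n) ≤ 1 + Q / 2 ^ n := by
    intro j κ
    have : (#(vals σ j κ) : ℝ) ≤ Q := by exact_mod_cast (card_vals_le σ j κ).trans hQ
    gcongr
  simp only [vals_cons]
  by_cases e₁ : i = i₁
  · subst e₁
    obtain ⟨c, hc⟩ := h₁ i x
    simp only [hi, if_true, if_false, hc]
    exact (expect_potential_insert _ _ c).trans
      (mul_le_mul_of_nonneg_right (hcard _ _) (potential_nonneg _ _))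
  · by_cases e₂ : i = i₂
    · subst e₂
      obtain ⟨c, hc⟩ := h₂ i x
      simp only [e₁, if_true, if_false, hc]
      simp only [potential_comm (vals σ i₁ κ₁)]
      exact (expect_potential_insert _ _ c).trans
        (mul_le_mul_of_nonneg_right (hcard _ _) (potential_nonneg _ _))
    · simp only [e₁, e₂, if_false]
      rw [Fintype.expect_const]
      have : (0 : ℝ) ≤ Q / 2 ^ n := by positivity
      nlinarith [potential_nonneg (vals σ i₁ κ₁) (vals σ i₂ κ₂)]

/-- The total potential of a history. -/
noncomputable def Side.pot (S : Side n) (σ : History n) : ℝ :=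
  potential (vals σ S.leaf₂ Entry.val) (vals σ S.leaf₁ Entry.val) +
    potential (vals σ S.mid Entry.val) (vals σ S.leaf₂ Entry.val) +
    potential (vals σ S.mid Entry.dm) (vals σ S.leaf₁ Entry.val)

theorem Side.pot_nonneg (S : Side n) (σ : History n) : 0 ≤ S.pot σ :=
  add_nonneg (add_nonneg (potential_nonneg _ _) (potential_nonneg _ _)) (potential_nonneg _ _)

theorem Side.expect_pot (S : Side n) {σ : History n} {Q : ℕ} (hQ : σ.length ≤ Q) (i : Fin 7)
    (x : Block n × Block n) :
    𝔼 v, S.pot (⟨i, x, v⟩ :: σ) ≤ (1 + Q / 2 ^ n) * S.pot σ := by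
  unfold Side.pot
  rw [expect_add_distrib, expect_add_distrib, mul_add, mul_add]
  exact add_le_add (add_le_add
    (expect_potential_vals hQ S.leaf₁_ne_leaf₂.symm isTranslate_val isTranslate_val i x)
    (expect_potential_vals hQ S.mid_ne_leaf₂ isTranslate_val isTranslate_val i x))
    (expect_potential_vals hQ S.mid_ne_leaf₁ isTranslate_dm isTranslate_val i x)

/-- No sum occurs more than `k` times. -/
structure Side.Balanced (S : Side n) (σ : History n) (k : ℕ) : Prop where
  leaves : ∀ z, mult (vals σ S.leaf₂ Entry.val) (vals σ S.leaf₁ Entry.val) z ≤ k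
  mid_val : ∀ z, mult (vals σ S.mid Entry.val) (vals σ S.leaf₂ Entry.val) z ≤ k
  mid_dm : ∀ z, mult (vals σ S.mid Entry.dm) (vals σ S.leaf₁ Entry.val) z ≤ k

/-- A single multiplicity above `k` would already contribute at least `2 ^ k`. -/
theorem Side.balanced_of_pot_lt {S : Side n} {σ : History n} {k : ℕ} (h : S.pot σ < 2 ^ k) :
    S.Balanced σ k := by
  have key : ∀ A B : Finset (Block n), potential A B ≤ S.pot σ → ∀ z, mult A B z ≤ k := by
    intro A B hAB z
    by_contra! hk
    have h1 := pow_le_potential A B z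
    have h2 : (2 : ℝ) ^ k ≤ 2 ^ mult A B z := pow_le_pow_right₀ (by norm_num) hk.le
    linarith
  unfold Side.pot at key
  refine ⟨key _ _ ?_, key _ _ ?_, key _ _ ?_⟩ <;>
    linarith [potential_nonneg (vals σ S.leaf₂ Entry.val) (vals σ S.leaf₁ Entry.val),
      potential_nonneg (vals σ S.mid Entry.val) (vals σ S.leaf₂ Entry.val),
      potential_nonneg (vals σ S.mid Entry.dm) (vals σ S.leaf₁ Entry.val)]

/-! ### Counting the bad answers -/

/-- The common pattern of the counts of hits: a target `y` and one of at most `k` representations of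
`z y` determine the answer. -/
theorem card_filter_exists_le {T A B : Finset (Block n)} {k : ℕ} (h : ∀ z, mult A B z ≤ k)
    (z : Block n → Block n) (g : Block n → Block n → Block n) :
    #(T.biUnion fun y => ({a ∈ A | a ^^^ z y ∈ B}).image (g y)) ≤ #T * k :=
  card_biUnion_le_card_mul _ _ _ fun y _ => card_image_le.trans (h (z y))

/-- Each entry accounts for at most `k + 1` targets: its own input, and the outputs of triples in
which it is the middle entry, at most one for each representation of the xor of its inputs by leaf
answers. -/
theorem Side.exists_targets {S : Side n} {σ : History n} {k : ℕ} (h : S.Balanced σ k) :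
    ∃ T : Finset (Block n), (∀ y, S.Target σ y → y ∈ T) ∧ #T ≤ σ.length * (k + 1) := by
  refine ⟨σ.toFinset.biUnion fun e => insert (S.proj e.arg)
    (({s ∈ vals σ S.leaf₂ Entry.val |
      s ^^^ (e.arg.1 ^^^ e.arg.2) ∈ vals σ S.leaf₁ Entry.val}).image fun s => e.val ^^^ s), ?_, ?_⟩
  · rintro y (⟨e, he, -, rfl⟩ | ⟨t, ht, ⟨i₀, i₁, i₂, hx⟩, rfl⟩)
    · exact mem_biUnion.2 ⟨e, List.mem_toFinset.2 he, mem_insert_self _ _⟩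
    · refine mem_biUnion.2 ⟨t.1, List.mem_toFinset.2 ht.1, mem_insert_of_mem (mem_image.2
        ⟨t.2.2.val, mem_filter.2 ⟨mem_vals.2 ⟨_, ht.2.2, i₂, rfl⟩, ?_⟩, rfl⟩)⟩
      refine mem_vals.2 ⟨_, ht.2.1, i₁, ?_⟩
      rw [hx, BitVec.xor_comm]
      simp
  · refine (card_biUnion_le_card_mul _ _ (k + 1) fun e _ => ?_).trans
      (Nat.mul_le_mul_right _ (List.toFinset_card_le σ))
    exact (card_insert_le _ _).trans (Nat.add_le_add_right (card_image_le.trans (h.leaves _)) 1)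

/-- Serves to recover a middle entry, and so the xor of its inputs, from its answer or from its
`dm`. -/
theorem exists_inverse (σ : History n) (i : Fin 7) (κ : Entry n → Block n)
    (h : ∀ e ∈ σ, ∀ e' ∈ σ, e.idx = i → e'.idx = i → κ e = κ e' → e = e') :
    ∃ E : Block n → Entry n, ∀ e ∈ σ, e.idx = i → E (κ e) = e := by
  classical
  -- The default entry is returned only for values that do not occur.
  refine ⟨fun v => if hv : ∃ e ∈ σ, e.idx = i ∧ κ e = v then hv.choose else ⟨i, (0, 0), 0⟩, ?_⟩
  intro e he hi
  have hv : ∃ e' ∈ σ, e'.idx = i ∧ κ e' = κ e := ⟨e, he, hi, rfl⟩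
  beta_reduce
  rw [dif_pos hv]
  exact h _ hv.choose_spec.1 _ he hv.choose_spec.2.1 hi hv.choose_spec.2.2

theorem Side.card_hits_le {S : Side n} {σ : History n} {k : ℕ} (h : S.Balanced σ k)
    (hb : ¬S.Bad σ) (i : Fin 7) (x : Block n × Block n) :
    ∃ s : Finset (Block n), (∀ v, S.Hits ⟨i, x, v⟩ σ → v ∈ s) ∧
      #s ≤ σ.length * (k + 1) * k := by
  obtain ⟨T, hT, hc⟩ := Side.exists_targets h
  have a₁ := S.mid_ne_leaf₁
  have a₂ := S.mid_ne_leaf₂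
  have a₃ := S.leaf₁_ne_leaf₂
  have tail : ∀ {v : Block n} {e : Entry n}, e ∈ (⟨i, x, v⟩ :: σ : History n) → e.idx ≠ i →
      e ∈ σ := by
    intro v e he hi
    rcases List.mem_cons.1 he with rfl | he
    · exact absurd rfl hi
    · exact he
  have index : ∀ {v : Block n} {t : Entry n × Entry n × Entry n}, S.IsTriple t →
      (t.1 = ⟨i, x, v⟩ ∨ t.2.1 = ⟨i, x, v⟩ ∨ t.2.2 = ⟨i, x, v⟩) →
      (t.1 = ⟨i, x, v⟩ ∧ i = S.mid) ∨ (t.2.1 = ⟨i, x, v⟩ ∧ i = S.leaf₁) ∨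
        (t.2.2 = ⟨i, x, v⟩ ∧ i = S.leaf₂) := by
    rintro v t ⟨i₀, i₁, i₂, -⟩ (hv | hv | hv)
    · exact Or.inl ⟨hv, by rw [← i₀, hv]⟩
    · exact Or.inr (Or.inl ⟨hv, by rw [← i₁, hv]⟩)
    · exact Or.inr (Or.inr ⟨hv, by rw [← i₂, hv]⟩)
  by_cases j₀ : i = S.mid
  -- New middle entry: the leaf answers represent the xor of its inputs, and its answer is the
  -- target xor the second leaf answer.
  · refine ⟨_, ?_, (card_filter_exists_le (T := T) h.leaves (fun _ => x.1 ^^^ x.2)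
      fun y s => y ^^^ s).trans (Nat.mul_le_mul_right k hc)⟩
    rintro v ⟨t, ht, he, hS, ho⟩
    have hi := hS
    obtain ⟨i₀, i₁, i₂, hx⟩ := hi
    rcases index hS he with ⟨he, -⟩ | ⟨-, he⟩ | ⟨-, he⟩
    · refine mem_biUnion.2 ⟨_, hT _ ho, mem_image.2 ⟨t.2.2.val, mem_filter.2
        ⟨mem_vals.2 ⟨_, tail ht.2.2 (by rw [i₂, j₀]; exact a₂.symm), i₂, rfl⟩, mem_vals.2
        ⟨_, tail ht.2.1 (by rw [i₁, j₀]; exact a₁.symm), i₁, ?_⟩⟩, ?_⟩⟩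
      · rw [he] at hx
        rw [hx, BitVec.xor_comm]
        simp
      · simp [out, he]
    · exact absurd (j₀.symm.trans he) a₁
    · exact absurd (j₀.symm.trans he) a₂
  by_cases j₁ : i = S.leaf₁
  -- New first leaf: the middle answer and the second leaf answer represent the target. The middle
  -- answer gives back the middle inputs, and the xor relation gives the new answer.
  · obtain ⟨E, hE⟩ := exists_inverse σ S.mid Entry.val fun e he e' he' hi hi' hv =>
      Side.eq_of_not_bad hb he he' (hi.trans hi'.symm) (hi ▸ S.mid_ne) (Or.inl hv)
    refine ⟨_, ?_, (card_filter_exists_le (T := T) h.mid_val (fun y => y)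
      fun y w => (E w).arg.1 ^^^ (E w).arg.2 ^^^ (w ^^^ y)).trans (Nat.mul_le_mul_right k hc)⟩
    rintro v ⟨t, ht, he, hS, ho⟩
    have hi := hS
    obtain ⟨i₀, i₁, i₂, hx⟩ := hi
    rcases index hS he with ⟨-, he⟩ | ⟨he, -⟩ | ⟨-, he⟩
    · exact absurd he j₀
    · have m₀ := tail ht.1 (by rw [i₀]; exact Ne.symm j₀)
      have hw : t.1.val ^^^ out t = t.2.2.val := by
        unfold out
        rw [← BitVec.xor_assoc]
        simp
      refine mem_biUnion.2 ⟨_, hT _ ho, mem_image.2 ⟨t.1.val, mem_filter.2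
        ⟨mem_vals.2 ⟨_, m₀, i₀, rfl⟩, mem_vals.2
        ⟨_, tail ht.2.2 (by rw [i₂, j₁]; exact a₃.symm), i₂, hw.symm⟩⟩, ?_⟩⟩
      rw [hE _ m₀ i₀, hw, hx, he]
      simp
    · exact absurd (j₁.symm.trans he) a₃
  by_cases j₂ : i = S.leaf₂
  -- New second leaf: here the `dm` of the middle entry and the first leaf answer represent the
  -- target, which is why `dm` occurs in the potential.
  · obtain ⟨E, hE⟩ := exists_inverse σ S.mid Entry.dm fun e he e' he' hi hi' hv =>
      Side.eq_of_not_bad hb he he' (hi.trans hi'.symm) (hi ▸ S.mid_ne) (Or.inr hv)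
    refine ⟨_, ?_, (card_filter_exists_le (T := T) h.mid_dm (fun y => y)
      fun y w => (E w).arg.1 ^^^ (E w).arg.2 ^^^ (w ^^^ y)).trans (Nat.mul_le_mul_right k hc)⟩
    rintro v ⟨t, ht, he, hS, ho⟩
    have hi := hS
    obtain ⟨i₀, i₁, i₂, hx⟩ := hi
    rcases index hS he with ⟨-, he⟩ | ⟨-, he⟩ | ⟨he, -⟩
    · exact absurd he j₀
    · exact absurd he j₁
    · have m₀ := tail ht.1 (by rw [i₀]; exact Ne.symm j₀)
      have hw : t.1.dm ^^^ out t = t.2.1.val := by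
        unfold out Entry.dm
        generalize t.1.arg.1 = a, t.1.arg.2 = b at *
        ext i hi
        have p := congrArg (fun z : Block n => z[i]) hx
        simp only [BitVec.getElem_xor] at p ⊢
        grind
      refine mem_biUnion.2 ⟨_, hT _ ho, mem_image.2 ⟨t.1.dm, mem_filter.2
        ⟨mem_vals.2 ⟨_, m₀, i₀, rfl⟩, mem_vals.2
        ⟨_, tail ht.2.1 (by rw [i₁]; exact Ne.symm j₁), i₁, hw.symm⟩⟩, ?_⟩⟩
      rw [hE _ m₀ i₀, hw, hx, he, BitVec.xor_comm t.2.1.val]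
      simp
  · refine ⟨∅, ?_, by simp⟩
    rintro v ⟨t, ht, he, hS, ho⟩
    rcases index hS he with ⟨-, he⟩ | ⟨-, he⟩ | ⟨-, he⟩ <;> contradiction

theorem card_collides_le (σ : History n) (i : Fin 7) (x : Block n × Block n) :
    ∃ s : Finset (Block n), (∀ v, Collides ⟨i, x, v⟩ σ → v ∈ s) ∧ #s ≤ 2 * σ.length := by
  refine ⟨vals σ i Entry.val ∪ (vals σ i Entry.dm).image fun d => d ^^^ x.2 ^^^ x.1, ?_, ?_⟩
  · rintro v ⟨-, e, he, hi, hv | hv⟩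
    · exact mem_union_left _ (mem_vals.2 ⟨e, he, hi, hv⟩)
    · refine mem_union_right _ (mem_image.2 ⟨_, mem_vals.2 ⟨e, he, hi, hv⟩, ?_⟩)
      simp [Entry.dm]
  · refine (card_union_le _ _).trans ?_
    have h1 := card_vals_le σ i Entry.val
    have h2 := (card_image_le (s := vals σ i Entry.dm) (f := fun d => d ^^^ x.2 ^^^ x.1)).trans
      (card_vals_le σ i Entry.dm)
    omega

/-- The bound for the probability that a single answer makes the history bad. -/
noncomputable def stepBound (n Q k : ℕ) : ℝ := (2 * Q + Q * (k + 1) * k) / 2 ^ n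

theorem stepBound_nonneg (n Q k : ℕ) : 0 ≤ stepBound n Q k := by
  unfold stepBound; positivity

theorem Side.expect_bad_cons {S : Side n} {σ : History n} {k Q : ℕ} (h : S.Balanced σ k)
    (hb : ¬S.Bad σ) (hQ : σ.length ≤ Q) (i : Fin 7) (x : Block n × Block n) :
    𝔼 v, ind (S.Bad (⟨i, x, v⟩ :: σ)) ≤ stepBound n Q k := by
  obtain ⟨s, hs, cs⟩ := card_collides_le σ i x
  obtain ⟨t, ht, ct⟩ := Side.card_hits_le h hb i x
  refine (expect_ind_mem _ (s ∪ t) fun v hv => ?_).trans ?_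
  · rcases hv with hv | hv | hv
    · exact absurd hv hb
    · exact mem_union_left _ (hs v hv)
    · exact mem_union_right _ (ht v hv)
  · have h1 : #(s ∪ t) ≤ 2 * Q + Q * (k + 1) * k := by
      refine (card_union_le _ _).trans (add_le_add (cs.trans (by omega)) (ct.trans ?_))
      gcongr
    have h2 : (#(s ∪ t) : ℝ) ≤ 2 * Q + Q * (k + 1) * k := by exact_mod_cast h1
    unfold stepBound
    gcongr

/-! ### The probability of bad histories -/

/-- A bound for the probability that a history becomes bad by `l` further answers. -/
noncomputable def Side.bound (S : Side n) (Q k : ℕ) (σ : History n) (l : ℕ) : ℝ :=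
  ind (S.Bad σ) + l * stepBound n Q k + (1 + Q / 2 ^ n) ^ l * S.pot σ / 2 ^ k

theorem Side.bound_mono (S : Side n) (Q k : ℕ) (σ : History n) {l l' : ℕ} (h : l ≤ l') :
    S.bound Q k σ l ≤ S.bound Q k σ l' := by
  unfold Side.bound
  have h1 := stepBound_nonneg n Q k
  have h2 := S.pot_nonneg σ
  have h3 : (1 : ℝ) ≤ 1 + Q / 2 ^ n := le_add_of_nonneg_right (by positivity)
  gcongr

/-- The induction step of a supermartingale argument. On a bad history the first summand of
`Side.bound` is `1`, and for a potential of at least `2 ^ k` the last one is at least `1`; then `g ≤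
1` suffices. Otherwise the history is balanced, so the new answer makes it bad with probability at
most `stepBound`, and the expected growth of the potential is paid for by one more factor. -/
theorem Side.expect_le_bound {S : Side n} {Q k : ℕ} {σ : History n} (hQ : σ.length ≤ Q) (l : ℕ)
    (i : Fin 7) (x : Block n × Block n) (g : Block n → ℝ) (h1 : ∀ v, g v ≤ 1)
    (h2 : ∀ v, g v ≤ S.bound Q k (⟨i, x, v⟩ :: σ) l) :
    𝔼 v, g v ≤ S.bound Q k σ (l + 1) := by
  have hd := stepBound_nonneg n Q k
  have hp := S.pot_nonneg σ
  have h3 : (1 : ℝ) ≤ 1 + Q / 2 ^ n := le_add_of_nonneg_right (by positivity)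
  have hle : 𝔼 v, g v ≤ 1 := expect_le univ_nonempty fun v _ => h1 v
  have ha : (0 : ℝ) ≤ ((l + 1 : ℕ) : ℝ) * stepBound n Q k := by positivity
  by_cases hb : S.Bad σ
  · refine hle.trans ?_
    unfold Side.bound
    rw [ind_of_true hb]
    have : 0 ≤ (1 + (Q : ℝ) / 2 ^ n) ^ (l + 1) * S.pot σ / 2 ^ k := by positivity
    linarith
  by_cases hk : S.pot σ < 2 ^ k
  · refine (expect_le_expect fun v _ => h2 v).trans ?_
    unfold Side.bound
    rw [expect_add_distrib, expect_add_distrib, Fintype.expect_const, ← expect_div, ← mul_expect,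
      ind_of_false hb]
    have b1 := Side.expect_bad_cons (Side.balanced_of_pot_lt hk) hb hQ i x
    have b2 := S.expect_pot hQ i x
    have b3 : (1 + (Q : ℝ) / 2 ^ n) ^ l * 𝔼 v, S.pot (⟨i, x, v⟩ :: σ) / 2 ^ k ≤
        (1 + (Q : ℝ) / 2 ^ n) ^ (l + 1) * S.pot σ / 2 ^ k := by
      rw [← expect_div, pow_succ, mul_assoc, mul_div_assoc]
      gcongr
    rw [← expect_div] at b3
    push_cast
    rw [mul_div_assoc]
    linarith
  · refine hle.trans ?_
    unfold Side.bound
    have h4 : (1 : ℝ) ≤ (1 + (Q : ℝ) / 2 ^ n) ^ (l + 1) * S.pot σ / 2 ^ k := by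
      rw [le_div_iff₀ (by positivity), one_mul]
      have := one_le_pow₀ h3 (n := l + 1)
      nlinarith
    linarith [ind_nonneg (S.Bad σ)]

theorem Side.expect_askAll_le {S : Side n} {Q k : ℕ}
    (l : List (History n → Fin 7 × (Block n × Block n))) :
    ∀ σ : History n, σ.length + l.length ≤ Q →
      𝔼 f, ind (S.Bad (askAll f l σ)) ≤ S.bound Q k σ l.length := by
  induction l with
  | nil =>
    intro σ _
    simp only [askAll]
    rw [Fintype.expect_const]
    unfold Side.bound
    have := S.pot_nonneg σ
    have : 0 ≤ (1 + (Q : ℝ) / 2 ^ n) ^ 0 * S.pot σ / 2 ^ k := by positivity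
    simp only [List.length_nil, Nat.cast_zero, zero_mul, add_zero]
    linarith
  | cons p l ih =>
    intro σ hσ
    simp only [List.length_cons] at hσ ⊢
    cases hl : lookup σ (p σ).1 (p σ).2 with
    | some v =>
      simp only [askAll, ask, hl]
      exact (ih σ (by omega)).trans (S.bound_mono Q k σ (by omega))
    | none =>
      simp only [askAll, ask, hl]
      -- The query is new, so its coin can be averaged separately, as a uniform answer `v`.
      rw [expect_family_set (p σ).1 (p σ).2]
      refine Side.expect_le_bound (by omega) _ (p σ).1 (p σ).2 _
        (fun v => expect_le univ_nonempty fun _ _ => ind_le_one _) fun v => ?_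
      refine le_trans (le_of_eq ?_) (ih (⟨(p σ).1, (p σ).2, v⟩ :: σ) (by simp; omega))
      refine expect_congr rfl fun f _ => ?_
      rw [Family.set_same, askAll_congr l (agreeOff_set σ f _ _ v v)]

/-- Root entries take part in no collision, triple or multiplicity. This matters because their
answers may be values of a fixed `F` and not uniform coins. -/
theorem Side.bound_root (S : Side n) (Q k : ℕ) (σ : History n) (l : ℕ) (x : Block n × Block n)
    (v : Block n) : S.bound Q k (⟨6, x, v⟩ :: σ) l = S.bound Q k σ l := by
  have hb : S.Bad (⟨6, x, v⟩ :: σ) ↔ S.Bad σ := by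
    refine ⟨?_, Or.inl⟩
    rintro (h | ⟨h, -⟩ | ⟨t, -, h, ⟨i₀, i₁, i₂, -⟩, -⟩)
    · exact h
    · exact absurd rfl h
    · rcases h with h | h | h
      · exact absurd (by rw [← i₀, h]) S.mid_ne
      · exact absurd (by rw [← i₁, h]) S.leaf₁_ne
      · exact absurd (by rw [← i₂, h]) S.leaf₂_ne
  have hp : S.pot (⟨6, x, v⟩ :: σ) = S.pot σ := by
    simp only [Side.pot, vals_cons, S.mid_ne.symm, S.leaf₁_ne.symm, S.leaf₂_ne.symm, if_false]
  unfold Side.bound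
  rw [hp, hb]

theorem length_flatMap_innerQueries (ms : List (Message n)) :
    (ms.flatMap innerQueries).length = 6 * ms.length := by
  induction ms with
  | nil => rfl
  | cons M ms ih =>
    rw [List.flatMap_cons, List.length_append, ih, List.length_cons]
    simp [innerQueries]
    omega

/-- The budget counts six inner queries for each pending construction query and reserves six for
each remaining query. The bound holds for every fixed oracle, since only answers below the root need
to be random. -/
theorem Side.expect_play_le {S : Side n} {Q k : ℕ} (F : BigFun n) {q : ℕ}
    (D : DecisionTree n q) :
    ∀ (σ : History n) (ms : List (Message n)), σ.length + 6 * (ms.length + q) ≤ Q →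
      𝔼 f, ind (S.Bad (D.play F f σ ms).2) ≤ S.bound Q k σ (6 * (ms.length + q)) := by
  induction D with
  | @output q b =>
    intro σ ms h
    simp only [DecisionTree.play]
    have hl := length_flatMap_innerQueries ms
    exact (Side.expect_askAll_le _ σ (by omega)).trans (S.bound_mono Q k σ (by omega))
  | @query q x next ih =>
    intro σ ms h
    cases x with
    | construction M =>
      simp only [DecisionTree.play]
      exact (ih _ σ (M :: ms) (by simp; omega)).trans
        (S.bound_mono Q k σ (by simp; omega))
    | primitive i x =>
      cases hl : lookup σ i x with
      | some v =>
        simp only [DecisionTree.play, hl]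
        exact (ih v σ ms (by omega)).trans (S.bound_mono Q k σ (by omega))
      | none =>
        simp only [DecisionTree.play, hl]
        rw [expect_family_set i x]
        by_cases hi : i = 6
        · subst hi
          -- For a root query the bound holds for each coin `v` separately, without averaging.
          refine expect_le univ_nonempty fun v _ => ?_
          simp only [fresh, if_true, Family.set_same]
          refine le_trans (le_of_eq ?_) ((ih (((findMessage σ x).map F).getD v)
            (⟨6, x, ((findMessage σ x).map F).getD v⟩ :: σ) ms (by simp; omega)).trans ?_)
          · refine expect_congr rfl fun f _ => ?_
            rw [play_congr _ (agreeOff_set σ f _ _ v _)]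
          · rw [S.bound_root]
            exact S.bound_mono Q k σ (by omega)
        · refine (Side.expect_le_bound (k := k) (by omega) (6 * (ms.length + q)) i x _
            (fun v => expect_le univ_nonempty fun _ _ => ind_le_one _) fun v => ?_).trans
            (S.bound_mono Q k σ (by omega))
          refine le_trans (le_of_eq ?_) (ih v (⟨i, x, v⟩ :: σ) ms (by simp; omega))
          refine expect_congr rfl fun f _ => ?_
          simp only [fresh, hi, if_false, Family.set_same]
          rw [play_congr _ (agreeOff_set σ f _ _ v _)]

/-! ### What the final history contains -/

theorem ask_suffix (f : Family n) (σ : History n) (p : Fin 7 × (Block n × Block n)) :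
    σ <:+ ask f σ p := by
  unfold ask
  split
  · exact List.suffix_rfl
  · exact List.suffix_cons _ _

theorem Agrees.cons {σ : History n} {f : Family n} (h : Agrees σ f) {e : Entry n}
    (he : e.idx ≠ 6 → e.val = f e.idx e.arg) : Agrees (e :: σ) f := by
  intro e' he' h6
  rcases List.mem_cons.1 he' with rfl | he'
  · exact he h6
  · exact h e' he' h6

theorem Agrees.ask {σ : History n} {f : Family n} (h : Agrees σ f)
    (p : Fin 7 × (Block n × Block n)) : Agrees (ask f σ p) f := by
  unfold ABRPlus.ask
  split
  · exact h
  · exact h.cons fun _ => rfl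

theorem lookup_ask {σ : History n} {f : Family n} (h : Agrees σ f)
    {p : Fin 7 × (Block n × Block n)} (hp : p.1 ≠ 6) :
    lookup (ask f σ p) p.1 p.2 = some (f p.1 p.2) := by
  unfold ask
  split
  · next v hv => rw [hv, ← h.lookup_eq hp hv]
  · simp [lookup_cons]

theorem lookup_ask_of_some {σ : History n} {f : Family n} {i : Fin 7} {x : Block n × Block n}
    {v : Block n} (hl : lookup σ i x = some v) (p : Fin 7 × (Block n × Block n)) :
    lookup (ask f σ p) i x = some v := by
  unfold ask
  split
  · exact hl
  · next hn =>
    rw [lookup_cons, if_neg, hl]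
    rintro ⟨h1, h2⟩
    simp only at h1 h2
    rw [h1, h2, hl] at hn
    cases hn

theorem askAll_suffix (f : Family n) (l : List (History n → Fin 7 × (Block n × Block n))) :
    ∀ σ : History n, σ <:+ askAll f l σ := by
  induction l with
  | nil => exact fun σ => List.suffix_rfl
  | cons p l ih => exact fun σ => (ask_suffix f σ (p σ)).trans (ih _)

theorem Agrees.askAll {f : Family n} (l : List (History n → Fin 7 × (Block n × Block n))) :
    ∀ {σ : History n}, Agrees σ f → Agrees (askAll f l σ) f := by
  induction l with
  | nil => exact fun h => h
  | cons p l ih => exact fun h => ih (h.ask _)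

theorem askAll_append (f : Family n) (l l' : List (History n → Fin 7 × (Block n × Block n))) :
    ∀ σ : History n, askAll f (l ++ l') σ = askAll f l' (askAll f l σ) := by
  induction l with
  | nil => exact fun σ => rfl
  | cons p l ih => exact fun σ => ih _

theorem complete_askAll {f : Family n} {σ : History n} (h : Agrees σ f) (M : Message n) :
    Complete (askAll f (innerQueries M) σ) f M := by
  simp only [innerQueries, askAll]
  have h1 := h.ask (0, (M 0, M 1))
  have l1 := lookup_ask h (p := (0, (M 0, M 1))) (show (0 : Fin 7) ≠ 6 by decide)
  generalize ask f σ (0, (M 0, M 1)) = σ₁ at *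
  have h2 := h1.ask (1, (M 2, M 3))
  have k1 := lookup_ask_of_some (f := f) l1 (1, (M 2, M 3))
  have k2 := lookup_ask h1 (p := (1, (M 2, M 3))) (show (1 : Fin 7) ≠ 6 by decide)
  clear l1 h1
  generalize ask f σ₁ (1, (M 2, M 3)) = σ₂ at *
  have h3 := h2.ask (2, (M 4, M 5))
  have l1 := lookup_ask_of_some (f := f) k1 (2, (M 4, M 5))
  have l2 := lookup_ask_of_some (f := f) k2 (2, (M 4, M 5))
  have l3 := lookup_ask h2 (p := (2, (M 4, M 5))) (show (2 : Fin 7) ≠ 6 by decide)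
  clear k1 k2 h2
  generalize ask f σ₂ (2, (M 4, M 5)) = σ₃ at *
  have h4 := h3.ask (3, (M 6, M 7))
  have k1 := lookup_ask_of_some (f := f) l1 (3, (M 6, M 7))
  have k2 := lookup_ask_of_some (f := f) l2 (3, (M 6, M 7))
  have k3 := lookup_ask_of_some (f := f) l3 (3, (M 6, M 7))
  have k4 := lookup_ask h3 (p := (3, (M 6, M 7))) (show (3 : Fin 7) ≠ 6 by decide)
  clear l1 l2 l3 h3
  generalize ask f σ₃ (3, (M 6, M 7)) = σ₄ at *
  simp only at k1 k2 k3 k4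
  -- The recorded leaf answers are those of `f`, so the adaptive query to the left middle function
  -- is the one in `leftTriple`.
  have v1 : value σ₄ 0 (M 0, M 1) = f 0 (M 0, M 1) := by rw [value, k1]; rfl
  have v2 : value σ₄ 1 (M 2, M 3) = f 1 (M 2, M 3) := by rw [value, k2]; rfl
  rw [v1, v2]
  generalize hp : ((4 : Fin 7), (M 8 ^^^ f 0 (M 0, M 1), M 8 ^^^ f 1 (M 2, M 3))) = p
  have hp6 : p.1 ≠ 6 := by rw [← hp]; simp
  have h5 := h4.ask p
  have l1 := lookup_ask_of_some (f := f) k1 p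
  have l2 := lookup_ask_of_some (f := f) k2 p
  have l3 := lookup_ask_of_some (f := f) k3 p
  have l4 := lookup_ask_of_some (f := f) k4 p
  have l5 := lookup_ask h4 hp6
  clear k1 k2 k3 k4 h4 v1 v2
  generalize ask f σ₄ p = σ₅ at *
  have v3 : value σ₅ 2 (M 4, M 5) = f 2 (M 4, M 5) := by rw [value, l3]; rfl
  have v4 : value σ₅ 3 (M 6, M 7) = f 3 (M 6, M 7) := by rw [value, l4]; rfl
  rw [v3, v4]
  generalize hr : ((5 : Fin 7), (M 9 ^^^ f 2 (M 4, M 5), M 9 ^^^ f 3 (M 6, M 7))) = r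
  have hr6 : r.1 ≠ 6 := by rw [← hr]; simp
  have k1 := mem_of_lookup (lookup_ask_of_some (f := f) l1 r)
  have k2 := mem_of_lookup (lookup_ask_of_some (f := f) l2 r)
  have k3 := mem_of_lookup (lookup_ask_of_some (f := f) l3 r)
  have k4 := mem_of_lookup (lookup_ask_of_some (f := f) l4 r)
  have k5 := mem_of_lookup (lookup_ask_of_some (f := f) l5 r)
  have k6 := mem_of_lookup (lookup_ask h5 hr6)
  generalize ask f σ₅ r = σ₆ at *
  subst hp hr
  exact ⟨⟨k5, k1, k2⟩, ⟨k6, k3, k4⟩⟩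

theorem complete_askAll_flatMap {f : Family n} {ms : List (Message n)} {M : Message n}
    (hM : M ∈ ms) : ∀ {σ : History n}, Agrees σ f →
      Complete (askAll f (ms.flatMap innerQueries) σ) f M := by
  induction ms with
  | nil => simp at hM
  | cons M' ms ih =>
    intro σ h
    rw [List.flatMap_cons, askAll_append]
    rcases List.mem_cons.1 hM with rfl | hM
    · exact (complete_askAll h M).mono (askAll_suffix _ _ _).subset
    · exact ih hM (h.askAll _)

theorem play_suffix (F : BigFun n) (f : Family n) {q : ℕ} (D : DecisionTree n q) :
    ∀ (σ : History n) (ms : List (Message n)), σ <:+ (D.play F f σ ms).2 := by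
  induction D with
  | output b => intro σ ms; exact askAll_suffix _ _ _
  | query x next ih =>
    intro σ ms
    cases x with
    | construction M => exact ih _ _ _
    | primitive i x =>
      simp only [DecisionTree.play]
      split
      · exact ih _ _ _
      · exact (List.suffix_cons _ _).trans (ih _ _ _)

theorem play_spec (F : BigFun n) (f : Family n) {q : ℕ} (D : DecisionTree n q) :
    ∀ (σ : History n) (ms : List (Message n)), Agrees σ f →
      ∀ M ∈ ms, Complete (D.play F f σ ms).2 f M := by
  induction D with
  | output b => intro σ ms h M hM; exact complete_askAll_flatMap hM h
  | query x next ih =>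
    intro σ ms h N hN
    cases x with
    | construction M => exact ih _ _ _ h _ (List.mem_cons_of_mem _ hN)
    | primitive i x =>
      simp only [DecisionTree.play]
      split
      · exact ih _ _ _ h _ hN
      · exact ih _ _ _ (h.cons fun hi => by simp only at hi; simp [fresh, hi]) _ hN

/-! ### Partially determined random functions -/

/-- Override a function by a partial one. -/
def patch {α β : Type*} (ρ : α → Option β) (h : α → β) : α → β := fun a => (ρ a).getD (h a)

theorem patch_of_some {α β : Type*} {ρ : α → Option β} (h : α → β) {a : α} {b : β}
    (ha : ρ a = some b) : patch ρ h a = b := by simp [patch, ha]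

/-- Lazy sampling: an undetermined point may be fixed to a uniform value at its first use. -/
theorem expect_patch {α β : Type*} [Fintype α] [DecidableEq α] [Fintype β] [Nonempty β]
    {ρ : α → Option β} {a : α} (ha : ρ a = none) (G : (α → β) → ℝ) :
    𝔼 h, G (patch ρ h) = 𝔼 b, 𝔼 h, G (patch (Function.update ρ a (some b)) h) := by
  rw [expect_update a]
  refine expect_congr rfl fun b _ => expect_congr rfl fun h _ => ?_
  congr 1
  funext a'
  by_cases hc : a' = a
  · subst hc; simp [patch, ha]
  · simp [patch, hc]

/-- The family with the root replaced. -/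
def withRoot (f : Family n) (h : Block n × Block n → Block n) : Family n := Function.update f 6 h

theorem withRoot_root (f : Family n) (h : Block n × Block n → Block n) :
    withRoot f h 6 = h := by simp [withRoot]

theorem withRoot_of_ne (f : Family n) (h : Block n × Block n → Block n) {i : Fin 7}
    (hi : i ≠ 6) : withRoot f h i = f i := by simp [withRoot, hi]

theorem inner_withRoot (f : Family n) (h : Block n × Block n → Block n) (M : Message n) :
    inner (withRoot f h) M = inner f M := by
  simp only [inner, withRoot_of_ne f h (show (0 : Fin 7) ≠ 6 by decide),
    withRoot_of_ne f h (show (1 : Fin 7) ≠ 6 by decide),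
    withRoot_of_ne f h (show (2 : Fin 7) ≠ 6 by decide),
    withRoot_of_ne f h (show (3 : Fin 7) ≠ 6 by decide),
    withRoot_of_ne f h (show (4 : Fin 7) ≠ 6 by decide),
    withRoot_of_ne f h (show (5 : Fin 7) ≠ 6 by decide)]

theorem complete_withRoot (σ : History n) (f : Family n) (h : Block n × Block n → Block n)
    (M : Message n) : Complete σ (withRoot f h) M ↔ Complete σ f M := by
  simp only [Complete, leftTriple, rightTriple, evaluation,
    withRoot_of_ne f h (show (0 : Fin 7) ≠ 6 by decide),
    withRoot_of_ne f h (show (1 : Fin 7) ≠ 6 by decide),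
    withRoot_of_ne f h (show (2 : Fin 7) ≠ 6 by decide),
    withRoot_of_ne f h (show (3 : Fin 7) ≠ 6 by decide),
    withRoot_of_ne f h (show (4 : Fin 7) ≠ 6 by decide),
    withRoot_of_ne f h (show (5 : Fin 7) ≠ 6 by decide)]

theorem Agrees.withRoot {σ : History n} {f : Family n} (hσ : Agrees σ f)
    (h : Block n × Block n → Block n) : Agrees σ (withRoot f h) := by
  intro e he hi
  rw [withRoot_of_ne f h hi]
  exact hσ e he hi

/-! ### Both worlds, given the functions other than the root -/

/-- The probability that the output in the real world is `1`. -/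
noncomputable def realProb (f : Family n) {q : ℕ} (D : DecisionTree n q)
    (ρ : Block n × Block n → Option (Block n)) : ℝ :=
  𝔼 h, ind (D.realEval abrPlus (withRoot f (patch ρ h)) = true)

/-- The expectation of a function of the final result in the ideal world. -/
noncomputable def idealMean (Ψ : Bool × History n → ℝ) (f : Family n) {q : ℕ}
    (D : DecisionTree n q) (σ : History n) (ms : List (Message n))
    (α : Message n → Option (Block n)) : ℝ :=
  𝔼 F : BigFun n, 𝔼 g : Block n × Block n → Block n, Ψ (D.play (patch α F) (withRoot f g) σ ms)

/-! ### One query in the real world, with the root sampled lazily -/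

section real

variable {f : Family n} {q q' : ℕ} {D : DecisionTree n q'} {next : Block n → DecisionTree n q}
  {k : Block n × Block n} {ρ : Block n × Block n → Option (Block n)}

/-- The hypothesis `hD` treats construction queries and root queries alike: each reads the root
once, at `k`. -/
theorem realProb_known
    (hD : ∀ H, D.realEval abrPlus (withRoot f H) =
      (next (H k)).realEval abrPlus (withRoot f H))
    {v : Block n} (hk : ρ k = some v) : realProb f D ρ = realProb f (next v) ρ := by
  unfold realProb
  simp only [hD, patch_of_some _ hk]

theorem realProb_fresh
    (hD : ∀ H, D.realEval abrPlus (withRoot f H) =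
      (next (H k)).realEval abrPlus (withRoot f H))
    (hk : ρ k = none) :
    realProb f D ρ = 𝔼 b, realProb f (next b) (Function.update ρ k (some b)) := by
  unfold realProb
  simp only [hD]
  rw [expect_patch hk fun H => ind ((next (H k)).realEval abrPlus (withRoot f H) = true)]
  refine expect_congr rfl fun b _ => expect_congr rfl fun h _ => ?_
  rw [patch_of_some (b := b) _ (by simp)]

theorem realEval_construction (f : Family n) (next : Block n → DecisionTree n q) (M : Message n)
    (H : Block n × Block n → Block n) :
    (DecisionTree.query (.construction M) next).realEval abrPlus (withRoot f H) =
      (next (H (inner f M))).realEval abrPlus (withRoot f H) := by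
  simp only [DecisionTree.realEval]
  rw [abrPlus_eq, withRoot_root, inner_withRoot]

theorem realEval_root (f : Family n) (next : Block n → DecisionTree n q) (x : Block n × Block n)
    (H : Block n × Block n → Block n) :
    (DecisionTree.query (.primitive 6 x) next).realEval abrPlus (withRoot f H) =
      (next (H x)).realEval abrPlus (withRoot f H) := by
  simp only [DecisionTree.realEval]
  rw [withRoot_root]

theorem realProb_primitive (f : Family n) (next : Block n → DecisionTree n q) {i : Fin 7}
    (hi : i ≠ 6) (x : Block n × Block n) (ρ : Block n × Block n → Option (Block n)) :
    realProb f (.query (.primitive i x) next) ρ = realProb f (next (f i x)) ρ := by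
  unfold realProb
  simp only [DecisionTree.realEval, withRoot_of_ne f _ hi]

end real

/-! ### One query in the ideal world, with the oracle sampled lazily -/

section ideal

variable {Ψ : Bool × History n → ℝ} {f : Family n} {q : ℕ} {next : Block n → DecisionTree n q}
  {σ : History n} {ms : List (Message n)} {α : Message n → Option (Block n)}

theorem idealMean_construction_known {M : Message n} {v : Block n} (h : α M = some v) :
    idealMean Ψ f (.query (.construction M) next) σ ms α =
      idealMean Ψ f (next v) σ (M :: ms) α := by
  unfold idealMean
  simp only [DecisionTree.play, patch_of_some _ h]

theorem idealMean_construction_fresh {M : Message n} (h : α M = none) :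
    idealMean Ψ f (.query (.construction M) next) σ ms α =
      𝔼 b, idealMean Ψ f (next b) σ (M :: ms) (Function.update α M (some b)) := by
  unfold idealMean
  simp only [DecisionTree.play]
  rw [expect_patch h fun F =>
    𝔼 g : Block n × Block n → Block n, Ψ ((next (F M)).play F (withRoot f g) σ (M :: ms))]
  refine expect_congr rfl fun b _ => expect_congr rfl fun F _ => ?_
  rw [patch_of_some (b := b) _ (by simp)]

theorem idealMean_lookup {i : Fin 7} {x : Block n × Block n} {v : Block n}
    (h : lookup σ i x = some v) :
    idealMean Ψ f (.query (.primitive i x) next) σ ms α = idealMean Ψ f (next v) σ ms α := by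
  unfold idealMean
  simp only [DecisionTree.play, h]

theorem idealMean_primitive {i : Fin 7} (hi : i ≠ 6) {x : Block n × Block n}
    (h : lookup σ i x = none) :
    idealMean Ψ f (.query (.primitive i x) next) σ ms α =
      idealMean Ψ f (next (f i x)) (⟨i, x, f i x⟩ :: σ) ms α := by
  unfold idealMean
  simp only [DecisionTree.play, h, fresh, hi, if_false, withRoot_of_ne f _ hi]

theorem idealMean_found_known {x : Block n × Block n} (h : lookup σ 6 x = none) {M : Message n}
    (hM : findMessage σ x = some M) {v : Block n} (hα : α M = some v) :
    idealMean Ψ f (.query (.primitive 6 x) next) σ ms α =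
      idealMean Ψ f (next v) (⟨6, x, v⟩ :: σ) ms α := by
  unfold idealMean
  simp only [DecisionTree.play, h, fresh, if_true, hM, Option.map_some, Option.getD_some,
    patch_of_some _ hα]

theorem idealMean_found_fresh {x : Block n × Block n} (h : lookup σ 6 x = none) {M : Message n}
    (hM : findMessage σ x = some M) (hα : α M = none) :
    idealMean Ψ f (.query (.primitive 6 x) next) σ ms α =
      𝔼 b, idealMean Ψ f (next b) (⟨6, x, b⟩ :: σ) ms (Function.update α M (some b)) := by
  unfold idealMean
  simp only [DecisionTree.play, h, fresh, if_true, hM, Option.map_some, Option.getD_some]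
  rw [expect_patch hα fun F => 𝔼 g : Block n × Block n → Block n,
    Ψ ((next (F M)).play F (withRoot f g) (⟨6, x, F M⟩ :: σ) ms)]
  refine expect_congr rfl fun b _ => expect_congr rfl fun F _ => ?_
  rw [patch_of_some (b := b) _ (by simp)]

theorem idealMean_not_found {x : Block n × Block n} (h : lookup σ 6 x = none)
    (hM : findMessage σ x = none) :
    idealMean Ψ f (.query (.primitive 6 x) next) σ ms α =
      𝔼 b, idealMean Ψ f (next b) (⟨6, x, b⟩ :: σ) ms α := by
  unfold idealMean
  simp only [DecisionTree.play, h, fresh, if_true, hM, Option.map_none, Option.getD_none,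
    withRoot_root]
  rw [expect_comm univ univ (fun b (F : BigFun n) => _)]
  refine expect_congr rfl fun F _ => ?_
  -- The root coin at `x` is resampled; once the query is recorded, `play_congr` discards the
  -- change.
  rw [expect_update x]
  refine expect_congr rfl fun b _ => expect_congr rfl fun g _ => ?_
  simp only [Function.update_self]
  rw [play_congr (f' := withRoot f g)]
  intro i y hl
  rw [lookup_cons] at hl
  split_ifs at hl with hc
  by_cases hi : i = 6
  · subst hi
    rw [withRoot_root, withRoot_root, Function.update_of_ne]
    rintro rfl
    exact hc ⟨rfl, rfl⟩
  · rw [withRoot_of_ne _ _ hi, withRoot_of_ne _ _ hi]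

end ideal

/-! ### Both worlds coincide as long as the history is not bad -/

/-- The relation between the values of the root that are determined in the real world and the state
of the ideal world. -/
structure Coupled (f : Family n) (σ : History n) (ms : List (Message n))
    (α : Message n → Option (Block n)) (ρ : Block n × Block n → Option (Block n)) : Prop where
  agrees : Agrees σ f
  -- A root value is determined either by a message or by a recorded root query; no other source
  -- exists.
  rho : ∀ k v, ρ k = some v ↔ (∃ M, α M = some v ∧ inner f M = k) ∨ lookup σ 6 k = some v
  dom : ∀ M, α M ≠ none → M ∈ ms ∨ Complete σ f M
  -- A message found by the search has been passed to the oracle, so its value stays determined.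
  root : ∀ τ e σ', σ = τ ++ e :: σ' → e.idx = 6 →
    ∀ M, findMessage σ' e.arg = some M → α M ≠ none

section coupled

variable {f : Family n} {σ : History n} {ms : List (Message n)}
  {α : Message n → Option (Block n)} {ρ : Block n × Block n → Option (Block n)}

theorem Coupled.root_cons (h : Coupled f σ ms α ρ) {e : Entry n}
    (he : e.idx = 6 → ∀ M, findMessage σ e.arg = some M → α M ≠ none) :
    ∀ τ e' σ', e :: σ = τ ++ e' :: σ' → e'.idx = 6 →
      ∀ M, findMessage σ' e'.arg = some M → α M ≠ none := by
  intro τ e' σ' heq h6 M hM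
  cases τ with
  | nil =>
    simp only [List.nil_append, List.cons.injEq] at heq
    obtain ⟨rfl, rfl⟩ := heq
    exact he h6 M hM
  | cons d τ =>
    simp only [List.cons_append, List.cons.injEq] at heq
    exact h.root τ e' σ' heq.2 h6 M hM

theorem update_ne_none {A B : Type*} [DecidableEq A] {α : A → Option B} {a a' : A} {b : B}
    (h : α a' ≠ none) : Function.update α a (some b) a' ≠ none := by
  by_cases hc : a' = a
  · subst hc; simp
  · rwa [Function.update_of_ne hc]

theorem Coupled.add_message (h : Coupled f σ ms α ρ) (M : Message n) :
    Coupled f σ (M :: ms) α ρ :=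
  ⟨h.agrees, h.rho, fun M' hM' => (h.dom M' hM').imp (List.mem_cons_of_mem _) id, h.root⟩

theorem Coupled.update_message (h : Coupled f σ ms α ρ) {M : Message n} (hα : α M = none)
    (hρ : ρ (inner f M) = none) (hM : M ∈ ms ∨ Complete σ f M) (b : Block n) :
    Coupled f σ ms (Function.update α M (some b)) (Function.update ρ (inner f M) (some b)) where
  agrees := h.agrees
  rho := by
    intro k v
    by_cases hk : k = inner f M
    · subst hk
      rw [Function.update_self]
      constructor
      · intro hv
        exact Or.inl ⟨M, by rwa [Function.update_self], rfl⟩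
      · rintro (⟨M', hM', hi⟩ | hl)
        · by_cases hc : M' = M
          · subst hc; rwa [Function.update_self] at hM'
          · rw [Function.update_of_ne hc] at hM'
            rw [(h.rho _ v).2 (Or.inl ⟨M', hM', hi⟩)] at hρ
            cases hρ
        · rw [(h.rho _ v).2 (Or.inr hl)] at hρ
          cases hρ
    · rw [Function.update_of_ne hk, h.rho]
      refine or_congr_left (exists_congr fun M' => and_congr_left fun hi => ?_)
      rw [Function.update_of_ne]
      rintro rfl
      exact hk hi.symm
  dom := by
    intro M' hM'
    by_cases hc : M' = M
    · subst hc; exact hM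
    · rw [Function.update_of_ne hc] at hM'
      exact h.dom M' hM'
  root := fun τ e σ' he h6 M' hM' => update_ne_none (h.root τ e σ' he h6 M' hM')

theorem Coupled.cons_primitive (h : Coupled f σ ms α ρ) {i : Fin 7} (hi : i ≠ 6)
    (x : Block n × Block n) : Coupled f (⟨i, x, f i x⟩ :: σ) ms α ρ where
  agrees := h.agrees.cons fun _ => rfl
  rho := by
    intro k v
    rw [lookup_cons, if_neg (by simp [hi])]
    exact h.rho k v
  dom := fun M hM => (h.dom M hM).imp id fun hc => hc.mono (List.subset_cons_self _ _)
  root := h.root_cons fun h6 => absurd h6 hi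

theorem Coupled.cons_root (h : Coupled f σ ms α ρ) {x : Block n × Block n} {v : Block n}
    (hρ : ρ x = some v) (hx : ∀ M, findMessage σ x = some M → α M ≠ none) :
    Coupled f (⟨6, x, v⟩ :: σ) ms α ρ where
  agrees := h.agrees.cons fun h6 => absurd rfl h6
  rho := by
    intro k w
    rw [lookup_cons]
    by_cases hk : x = k
    · subst hk
      simp only [and_self, if_true, Option.some.injEq]
      constructor
      · intro hw
        rw [hρ] at hw
        exact Or.inr (Option.some.inj hw)
      · rintro (hw | rfl)
        · exact (h.rho x w).2 (Or.inl hw)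
        · exact hρ
    · rw [if_neg (by simp [hk])]
      exact h.rho k w
  dom := fun M hM => (h.dom M hM).imp id fun hc => hc.mono (List.subset_cons_self _ _)
  root := h.root_cons fun _ => hx

theorem Coupled.cons_root_fresh (h : Coupled f σ ms α ρ) {x : Block n × Block n}
    (hρ : ρ x = none) (hx : findMessage σ x = none) (b : Block n) :
    Coupled f (⟨6, x, b⟩ :: σ) ms α (Function.update ρ x (some b)) where
  agrees := h.agrees.cons fun h6 => absurd rfl h6
  rho := by
    intro k w
    rw [lookup_cons]
    by_cases hk : x = k
    · subst hk
      simp only [and_self, if_true, Function.update_self]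
      constructor
      · exact Or.inr
      · rintro (hw | hw)
        · rw [(h.rho x w).2 (Or.inl hw)] at hρ
          cases hρ
        · exact hw
    · rw [if_neg (by simp [hk]), Function.update_of_ne (Ne.symm hk)]
      exact h.rho k w
  dom := fun M hM => (h.dom M hM).imp id fun hc => hc.mono (List.subset_cons_self _ _)
  root := h.root_cons fun _ M hM => by
    rw [show findMessage σ x = none from hx] at hM
    cases hM

/-- Messages with determined values are complete in every final history. -/
theorem Coupled.complete_final (h : Coupled f σ ms α ρ) {τ : History n} (hs : σ <:+ τ)
    (hm : ∀ M ∈ ms, Complete τ f M) {M : Message n} (hM : α M ≠ none) : Complete τ f M :=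
  (h.dom M hM).elim (hm M) fun hc => hc.mono hs.subset

/-- The root input of the new message is already taken. If another message took it, `eq_of_inner_eq`
fails. If a root query took it, a good history would have had `M` complete before that query; the
search would then have found a message with this root input, necessarily `M`, and determined its
value. -/
theorem Coupled.bad_of_construction (h : Coupled f σ ms α ρ) {M : Message n} (hα : α M = none)
    {v : Block n} (hρ : ρ (inner f M) = some v) {τ : History n} (hs : σ <:+ τ)
    (hm : ∀ M' ∈ M :: ms, Complete τ f M') : BadHistory τ := by
  by_contra hb
  have hc := hm M List.mem_cons_self
  have hd : ∀ {M'}, α M' ≠ none → Complete τ f M' := fun hM' =>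
    h.complete_final hs (fun M' hM' => hm M' (List.mem_cons_of_mem _ hM')) hM'
  rcases (h.rho _ _).1 hρ with ⟨M', hM', hi⟩ | hl
  · have hM'n : α M' ≠ none := by simp [hM']
    have := eq_of_inner_eq hb (hd hM'n) hc hi
    subst this
    exact hM'n hα
  · obtain ⟨l, σ', rfl⟩ := List.append_of_mem (mem_of_lookup hl)
    obtain ⟨l', rfl⟩ := hs
    rw [← List.append_assoc] at hb hc
    have h' := complete_of_root rfl hb hc rfl
    obtain ⟨M', hM'⟩ := findMessage_complete h'
    have hσ' : Agrees σ' f := fun e he => h.agrees e (by simp [he])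
    obtain ⟨h1, h2⟩ := findMessage_sound hσ' hM'
    have hM'n := h.root l _ σ' rfl rfl M' hM'
    have := eq_of_inner_eq hb (h1.mono (by intro e he; simp [he])) hc h2
    subst this
    exact hM'n hα

/-- The root input has not been queried, so its value stems from a message that differs from the one
found but has the same root input. -/
theorem Coupled.bad_of_found (h : Coupled f σ ms α ρ) {x : Block n × Block n}
    (hl : lookup σ 6 x = none) {M : Message n} (hM : findMessage σ x = some M)
    (hα : α M = none) {v : Block n} (hρ : ρ x = some v) {τ : History n} (hs : σ <:+ τ)
    (hm : ∀ M' ∈ ms, Complete τ f M') : BadHistory τ := by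
  by_contra hb
  obtain ⟨h1, h2⟩ := findMessage_sound h.agrees hM
  rcases (h.rho _ _).1 hρ with ⟨M', hM', hi⟩ | hl'
  · have hM'n : α M' ≠ none := by simp [hM']
    have := eq_of_inner_eq hb (h.complete_final hs hm hM'n) (h1.mono hs.subset)
      (hi.trans h2.symm)
    subst this
    exact hM'n hα
  · rw [hl] at hl'
    cases hl'

/-- The value stems from a message that the search missed. In a good history that message would have
been complete before the root query, and the search would have succeeded. -/
theorem Coupled.bad_of_not_found (h : Coupled f σ ms α ρ) {x : Block n × Block n}
    (hl : lookup σ 6 x = none) (hM : findMessage σ x = none) {v w : Block n}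
    (hρ : ρ x = some v) {τ : History n} (hs : (⟨6, x, w⟩ :: σ : History n) <:+ τ)
    (hm : ∀ M' ∈ ms, Complete τ f M') : BadHistory τ := by
  by_contra hb
  rcases (h.rho _ _).1 hρ with ⟨M', hM', hi⟩ | hl'
  · have hc := h.complete_final ((List.suffix_cons _ _).trans hs) hm
      (show α M' ≠ none by simp [hM'])
    obtain ⟨l, rfl⟩ := hs
    obtain ⟨N, hN⟩ := findMessage_complete (complete_of_root rfl hb hc hi)
    rw [hi, hM] at hN
    cases hN
  · rw [hl] at hl'
    cases hl'

end coupled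

theorem abs_expect_sub_le {ι : Type*} [Fintype ι] {a b c : ι → ℝ}
    (h : ∀ i, |a i - b i| ≤ c i) : |𝔼 i, a i - 𝔼 i, b i| ≤ 𝔼 i, c i := by
  rw [← expect_sub_distrib, abs_le]
  constructor
  · rw [← expect_neg_distrib]
    exact expect_le_expect fun i _ => (abs_le.1 (h i)).1
  · exact expect_le_expect fun i _ => (abs_le.1 (h i)).2

/-- The event that the output is `1`. -/
noncomputable def accepts (r : Bool × History n) : ℝ := ind (r.1 = true)

/-- The event that the final history is bad. -/
noncomputable def isBad (r : Bool × History n) : ℝ := ind (BadHistory r.2)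

/-- When badness is certain the right side is `1`, so the worlds need not be compared further. -/
theorem abs_sub_le_of_bad {f : Family n} {q : ℕ} {D : DecisionTree n q} {σ : History n}
    {ms : List (Message n)} {α : Message n → Option (Block n)}
    (h : ∀ F g, BadHistory (D.play (patch α F) (withRoot f g) σ ms).2)
    (ρ : Block n × Block n → Option (Block n)) :
    |realProb f D ρ - idealMean accepts f D σ ms α| ≤ idealMean isBad f D σ ms α := by
  have h1 : idealMean isBad f D σ ms α = 1 := by
    unfold idealMean isBad
    simp only [ind_of_true (h _ _), Fintype.expect_const]
  have h2 : 0 ≤ realProb f D ρ := expect_nonneg fun _ _ => ind_nonneg _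
  have h3 : realProb f D ρ ≤ 1 := expect_le univ_nonempty fun _ _ => ind_le_one _
  have h4 : 0 ≤ idealMean accepts f D σ ms α :=
    expect_nonneg fun _ _ => expect_nonneg fun _ _ => ind_nonneg _
  have h5 : idealMean accepts f D σ ms α ≤ 1 :=
    expect_le univ_nonempty fun _ _ => expect_le univ_nonempty fun _ _ => ind_le_one _
  rw [h1, abs_le]
  constructor <;> linarith

/-- Induction on the distinguisher. A value known in both worlds is reused, and a value new in both
is sampled as one common block. If the real root already has a value that the ideal world would draw
afresh, every continuation ends in a bad history. The converse mismatch is excluded by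
`Coupled.rho`. -/
theorem abs_realProb_sub_le {f : Family n} {q : ℕ} (D : DecisionTree n q) :
    ∀ {σ : History n} {ms : List (Message n)} {α : Message n → Option (Block n)}
      {ρ : Block n × Block n → Option (Block n)}, Coupled f σ ms α ρ →
      |realProb f D ρ - idealMean accepts f D σ ms α| ≤ idealMean isBad f D σ ms α := by
  induction D with
  | @output q b =>
    intro σ ms α ρ _
    have h1 : realProb f (.output b : DecisionTree n q) ρ = ind (b = true) := by
      simp only [realProb, DecisionTree.realEval, Fintype.expect_const]
    have h2 : idealMean accepts f (.output b : DecisionTree n q) σ ms α = ind (b = true) := by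
      simp only [idealMean, accepts, DecisionTree.play, Fintype.expect_const]
    rw [h1, h2, sub_self, abs_zero]
    exact expect_nonneg fun _ _ => expect_nonneg fun _ _ => ind_nonneg _
  | query x next ih =>
    intro σ ms α ρ h
    have facts : ∀ {q : ℕ} (D : DecisionTree n q) (F : BigFun n)
        (g : Block n × Block n → Block n) (σ : History n) (ms : List (Message n)),
        Agrees σ f → ∀ M ∈ ms, Complete (D.play F (withRoot f g) σ ms).2 f M :=
      fun D F g σ ms hσ M hM =>
        (complete_withRoot _ f g M).1 (play_spec F _ D σ ms (hσ.withRoot g) M hM)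
    cases x with
    | construction M =>
      cases hα : α M with
      | some v =>
        have hρ : ρ (inner f M) = some v := (h.rho _ _).2 (Or.inl ⟨M, hα, rfl⟩)
        rw [realProb_known (realEval_construction f next M) hρ,
          idealMean_construction_known hα, idealMean_construction_known hα]
        exact ih v (h.add_message M)
      | none =>
        cases hρ : ρ (inner f M) with
        | none =>
          rw [realProb_fresh (realEval_construction f next M) hρ,
            idealMean_construction_fresh hα, idealMean_construction_fresh hα]
          exact abs_expect_sub_le fun b => ih b
            ((h.add_message M).update_message hα hρ (Or.inl List.mem_cons_self) b)
        | some v =>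
          refine abs_sub_le_of_bad (fun F g => ?_) ρ
          simp only [DecisionTree.play]
          exact h.bad_of_construction hα hρ (play_suffix _ _ _ _ _)
            (facts _ _ _ _ _ h.agrees)
    | primitive i x =>
      by_cases hi : i = 6
      · subst hi
        cases hl : lookup σ 6 x with
        | some v =>
          rw [realProb_known (realEval_root f next x) ((h.rho _ _).2 (Or.inr hl)),
            idealMean_lookup hl, idealMean_lookup hl]
          exact ih v h
        | none =>
          cases hM : findMessage σ x with
          | some M =>
            obtain ⟨h1, rfl⟩ := findMessage_sound h.agrees hM
            cases hα : α M with
            | some v =>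
              have hρ : ρ (inner f M) = some v := (h.rho _ _).2 (Or.inl ⟨M, hα, rfl⟩)
              rw [realProb_known (realEval_root f next _) hρ,
                idealMean_found_known hl hM hα, idealMean_found_known hl hM hα]
              refine ih v (h.cons_root hρ fun M' hM' => ?_)
              rw [hM] at hM'
              cases hM'
              simp [hα]
            | none =>
              cases hρ : ρ (inner f M) with
              | none =>
                rw [realProb_fresh (realEval_root f next _) hρ,
                  idealMean_found_fresh hl hM hα, idealMean_found_fresh hl hM hα]
                refine abs_expect_sub_le fun b => ih b
                  ((h.update_message hα hρ (Or.inr h1) b).cons_root (by simp) fun M' hM' => ?_)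
                rw [hM] at hM'
                cases hM'
                simp
              | some v =>
                refine abs_sub_le_of_bad (fun F g => ?_) ρ
                have hσ := h.agrees.cons (e := ⟨6, inner f M, patch α F M⟩)
                  fun h6 => absurd rfl h6
                simp only [DecisionTree.play, hl, fresh, if_true, hM, Option.map_some,
                  Option.getD_some]
                exact h.bad_of_found hl hM hα hρ
                  ((List.suffix_cons _ _).trans (play_suffix _ _ _ _ _)) (facts _ _ _ _ _ hσ)
          | none =>
            cases hρ : ρ x with
            | none =>
              rw [realProb_fresh (realEval_root f next _) hρ,
                idealMean_not_found hl hM, idealMean_not_found hl hM]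
              exact abs_expect_sub_le fun b => ih b (h.cons_root_fresh hρ hM b)
            | some v =>
              refine abs_sub_le_of_bad (fun F g => ?_) ρ
              have hσ := h.agrees.cons (e := ⟨6, x, g x⟩) fun h6 => absurd rfl h6
              simp only [DecisionTree.play, hl, fresh, if_true, hM, Option.map_none,
                Option.getD_none, withRoot_root]
              exact h.bad_of_not_found hl hM hρ (play_suffix _ _ _ _ _) (facts _ _ _ _ _ hσ)
      · rw [realProb_primitive f next hi]
        cases hl : lookup σ i x with
        | some v =>
          rw [idealMean_lookup hl, idealMean_lookup hl, h.agrees.lookup_eq hi hl]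
          exact ih _ h
        | none =>
          rw [idealMean_primitive hi hl, idealMean_primitive hi hl]
          exact ih _ (h.cons_primitive hi x)

theorem coupled_nil (f : Family n) :
    Coupled f [] [] (fun _ => none) (fun _ => none) where
  agrees := fun e he => by simp at he
  rho := fun k v => by simp [lookup_nil]
  dom := fun M hM => absurd rfl hM
  root := fun τ e σ' he => by simp at he

/-! ### Programs without coins -/

/-- The effect of a program that does not sample. -/
def Program.det (F : BigFun n) : Program → State → State
  | .const r k, s => s.tick.setReg r k
  | .copy r a, s => s.tick.setReg r (s.reg a)
  | .succ r, s => s.tick.setReg r (s.reg r + 1)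
  | .xor r a b, s => s.tick.setReg r (s.reg a ^^^ s.reg b)
  | .load r bank a, s => s.tick.setReg r (s.mem bank (s.reg a))
  | .store bank a r, s => s.tick.setMem bank (s.reg a) (s.reg r)
  -- A junk value: `Program.run_eq_pure` assumes `SampleFree`.
  | .sample _, s => s
  | .call r a, s =>
      s.tick.tickCall.setReg r (F fun k => BitVec.ofNat n (s.reg (a k))).toNat
  | .seq p p', s => p'.det F (p.det F s)
  | .ifEq a b p p', s => if s.reg a = s.reg b then p.det F s.tick else p'.det F s.tick
  | .loop a p, s => (fun t => p.det F t.tick)^[s.reg a] s.tick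

/-- The program does not sample. -/
def Program.SampleFree : Program → Prop
  | .sample _ => False
  | .seq p p' => p.SampleFree ∧ p'.SampleFree
  | .ifEq _ _ p p' => p.SampleFree ∧ p'.SampleFree
  | .loop _ p => p.SampleFree
  | _ => True

theorem iter_pure (g : State → State) (k : ℕ) (s : State) :
    iter (fun t => PMF.pure (g t)) k s = PMF.pure (g^[k] s) := by
  induction k generalizing s with
  | zero => rfl
  | succ k ih => rw [iter, PMF.pure_bind, ih, Function.iterate_succ_apply]

/-- Only `choose` samples, so the other parts of the simulator can be analysed as deterministic
functions. -/
theorem Program.run_eq_pure (F : BigFun n) (p : Program) (h : p.SampleFree) (s : State) :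
    p.run F s = PMF.pure (p.det F s) := by
  induction p generalizing s with
  | sample r => exact h.elim
  | seq p p' ih ih' => rw [Program.run, ih h.1, PMF.pure_bind, ih' h.2, Program.det]
  | ifEq a b p p' ih ih' =>
    rw [Program.run, Program.det]
    split_ifs
    · exact ih h.1 _
    · exact ih' h.2 _
  | loop a p ih =>
    rw [Program.run, Program.det, ← iter_pure]
    congr 1
    funext t
    exact ih h _
  | _ => rfl

/-! ### The simulator

Registers: `0, 1, 2` the query, `3` the number of entries, `4` always `0`, `5` a loop counter,
`6, …, 9` and `18` scratch, `10` the position of the query in the history, `11` the answer,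
`12, 13, 14` and `15, 16, 17` the positions of triples, `20, …, 29` a message.
Banks: `0, …, 3` the index, both blocks of the query and the answer of the entries, numbered
from `1`; bank `4 + i`, at address `v`, the position of the latest entry with index `i < 4` and
answer `v`, or `0`. -/

/-- Do nothing. -/
def skip : Program := .const 6 0

/-- Compare the query with one entry. -/
def scanBody : Program :=
  .seq (.succ 5) <| .seq (.load 6 0 5) <|
  .ifEq 6 0 (.seq (.load 6 1 5) <| .ifEq 6 1 (.seq (.load 6 2 5) <|
    .ifEq 6 2 (.copy 10 5) skip) skip) skip

/-- Look for the query in the history. -/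
def scan : Program := .seq (.const 5 0) <| .seq (.const 10 0) <| .loop 3 scanBody

/-- Complete one entry to a triple whose output is in register `18`. -/
def searchBody (mid leaf₁ leaf₂ : ℕ) : Program :=
  .seq (.succ 5) <| .seq (.load 6 0 5) <| .seq (.const 7 mid) <|
  .ifEq 6 7 (.seq (.load 6 3 5) <| .seq (.xor 6 6 18) <| .seq (.load 8 (4 + leaf₂) 6) <|
    .ifEq 8 4 skip (.seq (.load 7 1 5) <| .seq (.xor 6 6 7) <| .seq (.load 7 2 5) <|
      .seq (.xor 6 6 7) <| .seq (.load 9 (4 + leaf₁) 6) <|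
      .ifEq 9 4 skip (.seq (.copy 12 5) <| .seq (.copy 13 9) <| .copy 14 8))) skip

/-- Look for a triple whose output is in register `18`. -/
def searchProgram (mid leaf₁ leaf₂ : ℕ) : Program :=
  .seq (.const 5 0) <| .seq (.const 12 0) <| .loop 3 (searchBody mid leaf₁ leaf₂)

/-- Look for triples in both halves. -/
def searchBoth : Program :=
  .seq (.copy 18 1) <| .seq (searchProgram 4 0 1) <| .seq (.copy 15 12) <|
  .seq (.copy 16 13) <| .seq (.copy 17 14) <| .seq (.copy 18 2) <| searchProgram 5 2 3

/-- Call the oracle on the message that consists of the two triples. -/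
def fetch : Program :=
  .seq (.load 20 1 16) <| .seq (.load 21 2 16) <| .seq (.load 22 1 17) <|
  .seq (.load 23 2 17) <| .seq (.load 24 1 13) <| .seq (.load 25 2 13) <|
  .seq (.load 26 1 14) <| .seq (.load 27 2 14) <|
  .seq (.load 28 2 15) <| .seq (.load 6 3 17) <| .seq (.xor 28 28 6) <|
  .seq (.load 29 2 12) <| .seq (.load 6 3 14) <| .seq (.xor 29 29 6) <|
  .call 11 fun k => 20 + k

/-- Choose the answer to a new query. -/
def choose : Program :=
  .seq (.const 6 6) <| .ifEq 0 6
    (.seq searchBoth <| .ifEq 15 4 (.sample 11) <| .ifEq 12 4 (.sample 11) fetch)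
    (.sample 11)

/-- Update the table of latest positions. -/
def recordIndex (i : ℕ) : Program :=
  .seq (.const 6 i) <| .ifEq 0 6 (.store (4 + i) 11 3) skip

/-- Append the query and its answer to the history, and answer. -/
def record : Program :=
  .seq (.succ 3) <| .seq (.store 0 3 0) <| .seq (.store 1 3 1) <| .seq (.store 2 3 2) <|
  .seq (.store 3 3 11) <| .seq (recordIndex 0) <| .seq (recordIndex 1) <|
  .seq (recordIndex 2) <| .seq (recordIndex 3) <| .copy 0 11

/-- The simulator. -/
def simulator : Program :=
  .seq scan <| .ifEq 10 4 (.seq choose record) (.load 0 3 10)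

/-! ### The representation of the history -/

/-- The entry `e` is stored at position `k`. -/
def StoredAt (m : ℕ → ℕ → ℕ) (e : Entry n) (k : ℕ) : Prop :=
  m 0 k = e.idx ∧ m 1 k = e.arg.1.toNat ∧ m 2 k = e.arg.2.toNat ∧ m 3 k = e.val.toNat

/-- The history is stored at the positions from `1` on. -/
def Stored (m : ℕ → ℕ → ℕ) : History n → Prop
  | [] => True
  | e :: σ => StoredAt m e (σ.length + 1) ∧ Stored m σ

/-- The position `k ≤ L` is that of an entry, or `0` if there is none. -/
def Points (m : ℕ → ℕ → ℕ) (L k : ℕ) : Option (Entry n) → Prop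
  | none => k = 0
  | some e => 0 < k ∧ k ≤ L ∧ StoredAt m e k

/-- The state of the machine represents a history. -/
structure Rep (s : State) (σ : History n) : Prop where
  count : s.reg 3 = σ.length
  zero : s.reg 4 = 0
  stored : Stored s.mem σ
  latest : ∀ i : Fin 7, (i : ℕ) < 4 → ∀ v : Block n,
    Points s.mem σ.length (s.mem (4 + i) v.toNat) (latest σ i v)

/-- The states have the same memory, and the same contents of the registers outside of `R`. -/
structure Frame (R : List ℕ) (s t : State) : Prop where
  mem : t.mem = s.mem
  reg : ∀ r, r ∉ R → t.reg r = s.reg r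

theorem Frame.refl (R : List ℕ) (s : State) : Frame R s s := ⟨rfl, fun _ _ => rfl⟩

theorem Frame.trans {R : List ℕ} {s t u : State} (h : Frame R s t) (h' : Frame R t u) :
    Frame R s u :=
  ⟨h'.mem.trans h.mem, fun r hr => (h'.reg r hr).trans (h.reg r hr)⟩

theorem Frame.weaken {R R' : List ℕ} {s t : State} (h : Frame R s t) (hR : R ⊆ R') :
    Frame R' s t :=
  ⟨h.mem, fun r hr => h.reg r fun hc => hr (hR hc)⟩

theorem Rep.frame {R : List ℕ} {s t : State} {σ : History n} (h : Rep s σ) (hf : Frame R s t)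
    (h3 : 3 ∉ R) (h4 : 4 ∉ R) : Rep t σ :=
  ⟨(hf.reg 3 h3).trans h.count, (hf.reg 4 h4).trans h.zero, hf.mem ▸ h.stored,
    hf.mem ▸ h.latest⟩

theorem Rep.init : Rep State.init ([] : History n) :=
  ⟨rfl, rfl, trivial, fun _ _ _ => rfl⟩

/-! ### The scan -/

/-- The effect of one iteration of the scan. -/
theorem scanBody_spec (F : BigFun n) (s : State) :
    Frame [5, 6, 10] s (scanBody.det F s) ∧
    (scanBody.det F s).reg 5 = s.reg 5 + 1 ∧
    (scanBody.det F s).reg 10 =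
      (if s.mem 0 (s.reg 5 + 1) = s.reg 0 ∧ s.mem 1 (s.reg 5 + 1) = s.reg 1 ∧
        s.mem 2 (s.reg 5 + 1) = s.reg 2 then s.reg 5 + 1 else s.reg 10) ∧
    (scanBody.det F s).steps ≤ s.steps + 8 ∧ (scanBody.det F s).calls = s.calls := by
  by_cases h0 : s.mem 0 (s.reg 5 + 1) = s.reg 0 <;>
  by_cases h1 : s.mem 1 (s.reg 5 + 1) = s.reg 1 <;>
  by_cases h2 : s.mem 2 (s.reg 5 + 1) = s.reg 2 <;>
  (refine ⟨⟨?_, fun r hr => ?_⟩, ?_, ?_, ?_, ?_⟩ <;>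
    simp_all [scanBody, skip, Program.det, State.tick, State.setReg])

/-- The loop goes from the oldest entry to the newest and overwrites register `10`, so the last
match wins; on a list with the newest entry first this is `find?`. The induction therefore splits
off the last iteration. -/
theorem scan_iterate (F : BigFun n) (i : Fin 7) (x : Block n × Block n) (L : ℕ) (τ : History n)
    (hL : τ.length ≤ L) (s : State) (hs : Stored s.mem τ) (h0 : s.reg 0 = i)
    (h1 : s.reg 1 = x.1.toNat) (h2 : s.reg 2 = x.2.toNat) (h5 : s.reg 5 = 0)
    (h10 : s.reg 10 = 0) :
    let t := (fun t => scanBody.det F t.tick)^[τ.length] s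
    Frame [5, 6, 10] s t ∧ t.reg 5 = τ.length ∧
      Points s.mem L (t.reg 10) (τ.find? fun e => e.idx = i ∧ e.arg = x) ∧
      t.steps ≤ s.steps + 9 * τ.length ∧ t.calls = s.calls := by
  induction τ with
  | nil => exact ⟨Frame.refl _ _, h5, h10, by simp, rfl⟩
  | cons e τ ih =>
    simp only [List.length_cons] at hL
    obtain ⟨f1, f2, f3, f4, f5⟩ := ih (by omega) hs.2
    simp only [List.length_cons, Function.iterate_succ_apply']
    generalize (fun t => scanBody.det F t.tick)^[τ.length] s = u at *
    obtain ⟨g1, g2, g3, g4, g5⟩ := scanBody_spec F u.tick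
    generalize scanBody.det F u.tick = t at *
    simp only [State.tick] at g2 g4 g5
    replace g3 : t.reg 10 = if u.mem 0 (u.reg 5 + 1) = u.reg 0 ∧
        u.mem 1 (u.reg 5 + 1) = u.reg 1 ∧ u.mem 2 (u.reg 5 + 1) = u.reg 2 then u.reg 5 + 1
      else u.reg 10 := g3
    have hf : Frame [5, 6, 10] s t := f1.trans ⟨g1.mem, g1.reg⟩
    obtain ⟨e0, e1, e2, e3⟩ := hs.1
    refine ⟨hf, by omega, ?_, by omega, by omega⟩
    rw [g3, f2, f1.mem, f1.reg 0 (by simp), f1.reg 1 (by simp), f1.reg 2 (by simp), e0, e1, e2,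
      h0, h1, h2, List.find?_cons]
    have hiff : ((e.idx : ℕ) = i ∧ e.arg.1.toNat = x.1.toNat ∧ e.arg.2.toNat = x.2.toNat) ↔
        (e.idx = i ∧ e.arg = x) := by
      rw [Fin.val_inj, BitVec.toNat_inj, BitVec.toNat_inj, Prod.ext_iff]
    by_cases hc : e.idx = i ∧ e.arg = x
    · rw [if_pos (hiff.2 hc)]
      simp only [hc, and_self, decide_true]
      exact ⟨by omega, hL, hs.1⟩
    · rw [if_neg (fun h => hc (hiff.1 h))]
      simp only [hc, decide_false]
      exact f3

theorem scan_spec (F : BigFun n) (i : Fin 7) (x : Block n × Block n) {σ : History n} {s : State}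
    (h : Rep s σ) (h0 : s.reg 0 = i) (h1 : s.reg 1 = x.1.toNat) (h2 : s.reg 2 = x.2.toNat) :
    let t := scan.det F s
    Frame [5, 6, 10] s t ∧
      Points s.mem σ.length (t.reg 10) (σ.find? fun e => e.idx = i ∧ e.arg = x) ∧
      t.steps ≤ s.steps + 9 * σ.length + 3 ∧ t.calls = s.calls := by
  obtain ⟨u, hu⟩ : ∃ u, u = (((s.tick.setReg 5 0).tick).setReg 10 0).tick := ⟨_, rfl⟩
  have ht : scan.det F s = (fun t => scanBody.det F t.tick)^[σ.length] u := by
    rw [← h.count, hu]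
    simp [scan, Program.det, State.tick, State.setReg]
  have fr : Frame [5, 6, 10] s u := by
    subst hu
    refine ⟨rfl, fun r hr => ?_⟩
    simp_all [State.tick, State.setReg]
  have us : u.steps = s.steps + 3 := by subst hu; rfl
  have uc : u.calls = s.calls := by subst hu; rfl
  have key := scan_iterate F i x σ.length σ le_rfl u (fr.mem ▸ h.stored)
    ((fr.reg 0 (by simp)).trans h0) ((fr.reg 1 (by simp)).trans h1)
    ((fr.reg 2 (by simp)).trans h2) (by subst hu; simp [State.tick, State.setReg])
    (by subst hu; simp [State.tick, State.setReg])
  simp only [← ht] at key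
  obtain ⟨k1, -, k3, k4, k5⟩ := key
  exact ⟨fr.trans k1, fr.mem ▸ k3, by omega, by omega⟩

/-! ### The search for triples -/

/-- The three positions are those of a triple, or the first one is `0` if there is none. -/
def PointsTriple (m : ℕ → ℕ → ℕ) (k₀ k₁ k₂ : ℕ) : Option (Entry n × Entry n × Entry n) → Prop
  | none => k₀ = 0
  | some t => 0 < k₀ ∧ StoredAt m t.1 k₀ ∧ StoredAt m t.2.1 k₁ ∧ StoredAt m t.2.2 k₂

/-- The effect of one iteration of the search. -/
theorem searchBody_frame (F : BigFun n) (a b c : ℕ) (s : State) :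
    Frame [5, 6, 7, 8, 9, 12, 13, 14] s ((searchBody a b c).det F s) ∧
    ((searchBody a b c).det F s).reg 5 = s.reg 5 + 1 ∧
    ((searchBody a b c).det F s).steps ≤ s.steps + 17 ∧
    ((searchBody a b c).det F s).calls = s.calls := by
  by_cases h0 : s.mem 0 (s.reg 5 + 1) = a
  · by_cases h1 : s.mem (4 + c) (s.mem 3 (s.reg 5 + 1) ^^^ s.reg 18) = s.reg 4
    · refine ⟨⟨?_, fun r hr => ?_⟩, ?_, ?_, ?_⟩ <;>
        simp_all [searchBody, skip, Program.det, State.tick, State.setReg]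
    · by_cases h2 : s.mem (4 + b) (s.mem 3 (s.reg 5 + 1) ^^^ s.reg 18 ^^^
        s.mem 1 (s.reg 5 + 1) ^^^ s.mem 2 (s.reg 5 + 1)) = s.reg 4 <;>
      (refine ⟨⟨?_, fun r hr => ?_⟩, ?_, ?_, ?_⟩ <;>
        simp_all [searchBody, skip, Program.det, State.tick, State.setReg])
  · refine ⟨⟨?_, fun r hr => ?_⟩, ?_, ?_, ?_⟩ <;>
      simp_all [searchBody, skip, Program.det, State.tick, State.setReg]

theorem searchBody_found (F : BigFun n) (a b c : ℕ) (s : State)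
    (h0 : s.mem 0 (s.reg 5 + 1) = a)
    (h1 : s.mem (4 + c) (s.mem 3 (s.reg 5 + 1) ^^^ s.reg 18) ≠ s.reg 4)
    (h2 : s.mem (4 + b) (s.mem 3 (s.reg 5 + 1) ^^^ s.reg 18 ^^^
        s.mem 1 (s.reg 5 + 1) ^^^ s.mem 2 (s.reg 5 + 1)) ≠ s.reg 4) :
    ((searchBody a b c).det F s).reg 12 = s.reg 5 + 1 ∧
    ((searchBody a b c).det F s).reg 13 = s.mem (4 + b) (s.mem 3 (s.reg 5 + 1) ^^^ s.reg 18 ^^^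
        s.mem 1 (s.reg 5 + 1) ^^^ s.mem 2 (s.reg 5 + 1)) ∧
    ((searchBody a b c).det F s).reg 14 =
      s.mem (4 + c) (s.mem 3 (s.reg 5 + 1) ^^^ s.reg 18) := by
  simp [searchBody, skip, Program.det, State.tick, State.setReg, h0, h1,
    h2]

theorem searchBody_not_found (F : BigFun n) (a b c : ℕ) (s : State)
    (h : s.mem 0 (s.reg 5 + 1) ≠ a ∨
      s.mem (4 + c) (s.mem 3 (s.reg 5 + 1) ^^^ s.reg 18) = s.reg 4 ∨
      s.mem (4 + b) (s.mem 3 (s.reg 5 + 1) ^^^ s.reg 18 ^^^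
        s.mem 1 (s.reg 5 + 1) ^^^ s.mem 2 (s.reg 5 + 1)) = s.reg 4) :
    ((searchBody a b c).det F s).reg 12 = s.reg 12 ∧
    ((searchBody a b c).det F s).reg 13 = s.reg 13 ∧
    ((searchBody a b c).det F s).reg 14 = s.reg 14 := by
  by_cases h0 : s.mem 0 (s.reg 5 + 1) = a
  · by_cases h1 : s.mem (4 + c) (s.mem 3 (s.reg 5 + 1) ^^^ s.reg 18) = s.reg 4
    · simp [searchBody, skip, Program.det, State.tick, State.setReg, h0, h1]
    · have h2 : s.mem (4 + b) (s.mem 3 (s.reg 5 + 1) ^^^ s.reg 18 ^^^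
        s.mem 1 (s.reg 5 + 1) ^^^ s.mem 2 (s.reg 5 + 1)) = s.reg 4 := by tauto
      simp [searchBody, skip, Program.det, State.tick, State.setReg, h0, h1,
        h2]
  · simp [searchBody, skip, Program.det, State.tick, State.setReg, h0]

theorem Points.eq_zero_or {m : ℕ → ℕ → ℕ} {L k : ℕ} {o : Option (Entry n)}
    (h : Points m L k o) : (k = 0 ∧ o = none) ∨ (k ≠ 0 ∧ ∃ e, o = some e ∧ StoredAt m e k) := by
  cases o with
  | none => exact Or.inl ⟨h, rfl⟩
  | some e => exact Or.inr ⟨by have := h.1; omega, e, rfl, h.2.2⟩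

/-- The machine knows the latest positions of the leaves of a half. -/
def Side.Indexed (S : Side n) (m : ℕ → ℕ → ℕ) (σ : History n) : Prop :=
  (∀ v : Block n, Points m σ.length (m (4 + S.leaf₁) v.toNat) (latest σ S.leaf₁ v)) ∧
    ∀ v : Block n, Points m σ.length (m (4 + S.leaf₂) v.toNat) (latest σ S.leaf₂ v)

/-- The entries of `τ` are the candidates for the middle, while the leaf tables refer to the whole
history `σ`, as in `Side.extend`. -/
theorem search_iterate (F : BigFun n) (S : Side n) (y : Block n) {σ : History n} (τ : History n)
    (s : State) (hs : Stored s.mem τ) (hI : S.Indexed s.mem σ) (h4 : s.reg 4 = 0)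
    (h18 : s.reg 18 = y.toNat) (h5 : s.reg 5 = 0) (h12 : s.reg 12 = 0) :
    let t := (fun t => (searchBody S.mid S.leaf₁ S.leaf₂).det F t.tick)^[τ.length] s
    Frame [5, 6, 7, 8, 9, 12, 13, 14] s t ∧ t.reg 5 = τ.length ∧
      PointsTriple s.mem (t.reg 12) (t.reg 13) (t.reg 14) (τ.findSome? (S.extend σ y)) ∧
      t.steps ≤ s.steps + 18 * τ.length ∧ t.calls = s.calls := by
  induction τ with
  | nil => exact ⟨Frame.refl _ _, h5, h12, by simp, rfl⟩
  | cons e τ ih =>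
    obtain ⟨f1, f2, f3, f4, f5⟩ := ih hs.2
    simp only [List.length_cons, Function.iterate_succ_apply']
    generalize (fun t => (searchBody S.mid S.leaf₁ S.leaf₂).det F t.tick)^[τ.length] s = u at *
    obtain ⟨g1, g2, g4, g5⟩ := searchBody_frame F S.mid S.leaf₁ S.leaf₂ u.tick
    have gf := searchBody_found F S.mid S.leaf₁ S.leaf₂ u.tick
    have gn := searchBody_not_found F S.mid S.leaf₁ S.leaf₂ u.tick
    generalize (searchBody S.mid S.leaf₁ S.leaf₂).det F u.tick = t at *
    simp only [State.tick] at g2 g4 g5 gf gn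
    have hf : Frame [5, 6, 7, 8, 9, 12, 13, 14] s t := f1.trans ⟨g1.mem, g1.reg⟩
    have hst := hs.1
    obtain ⟨e0, e1, e2, e3⟩ := hs.1
    refine ⟨hf, by omega, ?_, by omega, by omega⟩
    rw [f2, f1.mem, f1.reg 4 (by simp), f1.reg 18 (by simp), e0, e1, e2, e3, h4, h18,
      ← BitVec.toNat_xor, ← BitVec.toNat_xor, ← BitVec.toNat_xor, Fin.val_inj] at gf
    rw [f2, f1.mem, f1.reg 4 (by simp), f1.reg 18 (by simp), e0, e1, e2, e3, h4, h18,
      ← BitVec.toNat_xor, ← BitVec.toNat_xor, ← BitVec.toNat_xor, Ne, Fin.val_inj] at gn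
    rw [List.findSome?_cons]
    by_cases hi : e.idx = S.mid
    · rcases (hI.2 (e.val ^^^ y)).eq_zero_or with ⟨k2, o2⟩ | ⟨k2, e₂, o2, s2⟩
      · obtain ⟨r1, r2, r3⟩ := gn (Or.inr (Or.inl k2))
        have : S.extend σ y e = none := by simp [Side.extend, hi, o2]
        rw [this, r1, r2, r3]
        exact f3
      · rcases (hI.1 (e.val ^^^ y ^^^ e.arg.1 ^^^ e.arg.2)).eq_zero_or with
          ⟨k1, o1⟩ | ⟨k1, e₁, o1, s1⟩
        · obtain ⟨r1, r2, r3⟩ := gn (Or.inr (Or.inr k1))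
          have : S.extend σ y e = none := by simp [Side.extend, hi, o2, o1]
          rw [this, r1, r2, r3]
          exact f3
        · obtain ⟨r1, r2, r3⟩ := gf hi k2 k1
          have : S.extend σ y e = some (e, e₁, e₂) := by simp [Side.extend, hi, o2, o1]
          rw [this, r1, r2, r3]
          exact ⟨by omega, hst, s1, s2⟩
    · obtain ⟨r1, r2, r3⟩ := gn (Or.inl hi)
      have : S.extend σ y e = none := by simp [Side.extend, hi]
      rw [this, r1, r2, r3]
      exact f3

theorem searchProgram_spec (F : BigFun n) (S : Side n) (y : Block n) {σ : History n} {s : State}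
    (h : Rep s σ) (hI : S.Indexed s.mem σ) (h18 : s.reg 18 = y.toNat) :
    let t := (searchProgram S.mid S.leaf₁ S.leaf₂).det F s
    Frame [5, 6, 7, 8, 9, 12, 13, 14] s t ∧
      PointsTriple s.mem (t.reg 12) (t.reg 13) (t.reg 14) (S.search σ y) ∧
      t.steps ≤ s.steps + 18 * σ.length + 3 ∧ t.calls = s.calls := by
  obtain ⟨u, hu⟩ : ∃ u, u = (((s.tick.setReg 5 0).tick).setReg 12 0).tick := ⟨_, rfl⟩
  have ht : (searchProgram S.mid S.leaf₁ S.leaf₂).det F s =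
      (fun t => (searchBody S.mid S.leaf₁ S.leaf₂).det F t.tick)^[σ.length] u := by
    rw [← h.count, hu]
    simp [searchProgram, Program.det, State.tick, State.setReg]
  have fr : Frame [5, 6, 7, 8, 9, 12, 13, 14] s u := by
    subst hu
    refine ⟨rfl, fun r hr => ?_⟩
    simp_all [State.tick, State.setReg]
  have us : u.steps = s.steps + 3 := by subst hu; rfl
  have uc : u.calls = s.calls := by subst hu; rfl
  have key := search_iterate F S y σ u (fr.mem ▸ h.stored) (fr.mem ▸ hI)
    ((fr.reg 4 (by simp)).trans h.zero) ((fr.reg 18 (by simp)).trans h18)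
    (by subst hu; simp [State.tick, State.setReg])
    (by subst hu; simp [State.tick, State.setReg])
  simp only [← ht] at key
  obtain ⟨k1, -, k3, k4, k5⟩ := key
  exact ⟨fr.trans k1, fr.mem ▸ k3, by omega, by omega⟩

theorem Rep.indexed_left {s : State} {σ : History n} (h : Rep s σ) :
    (left n).Indexed s.mem σ :=
  ⟨h.latest 0 (by decide), h.latest 1 (by decide)⟩

theorem Rep.indexed_right {s : State} {σ : History n} (h : Rep s σ) :
    (right n).Indexed s.mem σ :=
  ⟨h.latest 2 (by decide), h.latest 3 (by decide)⟩

theorem searchBoth_spec (F : BigFun n) (x : Block n × Block n) {σ : History n} {s : State}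
    (h : Rep s σ) (h1 : s.reg 1 = x.1.toNat) (h2 : s.reg 2 = x.2.toNat) :
    let t := searchBoth.det F s
    Frame [5, 6, 7, 8, 9, 12, 13, 14, 15, 16, 17, 18] s t ∧
      PointsTriple s.mem (t.reg 15) (t.reg 16) (t.reg 17) ((left n).search σ x.1) ∧
      PointsTriple s.mem (t.reg 12) (t.reg 13) (t.reg 14) ((right n).search σ x.2) ∧
      t.steps ≤ s.steps + 36 * σ.length + 11 ∧ t.calls = s.calls := by
  have e1 : searchBoth.det F s = (searchProgram 5 2 3).det F
      ((Program.seq (.copy 15 12) (.seq (.copy 16 13) (.seq (.copy 17 14) (.copy 18 2)))).det F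
        ((searchProgram 4 0 1).det F (s.tick.setReg 18 (s.reg 1)))) := rfl
  rw [e1]
  have f1 : Frame [18] s (s.tick.setReg 18 (s.reg 1)) :=
    ⟨rfl, fun r hr => by simp_all [State.tick, State.setReg]⟩
  have r1 := h.frame f1 (by simp) (by simp)
  have y1 : (s.tick.setReg 18 (s.reg 1)).reg 18 = x.1.toNat := by
    simp [State.tick, State.setReg, h1]
  have t1 : (s.tick.setReg 18 (s.reg 1)).steps = s.steps + 1 := rfl
  have c1 : (s.tick.setReg 18 (s.reg 1)).calls = s.calls := rfl
  generalize s.tick.setReg 18 (s.reg 1) = s₁ at *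
  obtain ⟨f2, p2, t2, c2⟩ := searchProgram_spec F (left n) x.1 r1 r1.indexed_left y1
  have r2 := r1.frame f2 (by simp) (by simp)
  change Frame _ _ ((searchProgram 4 0 1).det F s₁) at f2
  change PointsTriple _ (((searchProgram 4 0 1).det F s₁).reg 12)
    (((searchProgram 4 0 1).det F s₁).reg 13) (((searchProgram 4 0 1).det F s₁).reg 14) _ at p2
  change ((searchProgram 4 0 1).det F s₁).steps ≤ _ at t2
  change ((searchProgram 4 0 1).det F s₁).calls = _ at c2
  change Rep ((searchProgram 4 0 1).det F s₁) _ at r2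
  generalize (searchProgram 4 0 1).det F s₁ = s₂ at *
  obtain ⟨s₃, hs₃⟩ : ∃ s₃, s₃ = (Program.seq (.copy 15 12)
    (.seq (.copy 16 13) (.seq (.copy 17 14) (.copy 18 2)))).det F s₂ := ⟨_, rfl⟩
  rw [← hs₃]
  have f3 : Frame [15, 16, 17, 18] s₂ s₃ := by
    subst hs₃
    exact ⟨rfl, fun r hr => by simp_all [Program.det, State.tick, State.setReg]⟩
  have r3 := r2.frame f3 (by simp) (by simp)
  have a1 : s₃.reg 15 = s₂.reg 12 := by simp [hs₃, Program.det, State.tick, State.setReg]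
  have a2 : s₃.reg 16 = s₂.reg 13 := by simp [hs₃, Program.det, State.tick, State.setReg]
  have a3 : s₃.reg 17 = s₂.reg 14 := by simp [hs₃, Program.det, State.tick, State.setReg]
  have a4 : s₃.reg 18 = s₂.reg 2 := by simp [hs₃, Program.det, State.tick, State.setReg]
  have t3 : s₃.steps = s₂.steps + 4 := by rw [hs₃]; rfl
  have c3 : s₃.calls = s₂.calls := by rw [hs₃]; rfl
  clear hs₃
  have y3 : s₃.reg 18 = x.2.toNat := by
    rw [a4, f2.reg 2 (by simp), f1.reg 2 (by simp), h2]
  obtain ⟨f4, p4, t4, c4⟩ := searchProgram_spec F (right n) x.2 r3 r3.indexed_right y3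
  change Frame _ _ ((searchProgram 5 2 3).det F s₃) at f4
  change PointsTriple _ (((searchProgram 5 2 3).det F s₃).reg 12)
    (((searchProgram 5 2 3).det F s₃).reg 13) (((searchProgram 5 2 3).det F s₃).reg 14) _ at p4
  change ((searchProgram 5 2 3).det F s₃).steps ≤ _ at t4
  change ((searchProgram 5 2 3).det F s₃).calls = _ at c4
  generalize (searchProgram 5 2 3).det F s₃ = s₄ at *
  have m3 : s₃.mem = s.mem := by rw [f3.mem, f2.mem, f1.mem]
  refine ⟨(((f1.weaken ?_).trans (f2.weaken ?_)).trans (f3.weaken ?_)).trans (f4.weaken ?_),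
    ?_, ?_, by omega, by omega⟩
  · simp
  · simp
  · simp
  · simp
  · rw [f4.reg 15 (by simp), f4.reg 16 (by simp), f4.reg 17 (by simp), a1, a2, a3, ← f1.mem]
    exact p2
  · rw [← m3]
    exact p4

theorem fetch_spec (F : BigFun n) {s : State} {l r : Entry n × Entry n × Entry n}
    (hl : StoredAt s.mem l.1 (s.reg 15) ∧ StoredAt s.mem l.2.1 (s.reg 16) ∧
      StoredAt s.mem l.2.2 (s.reg 17))
    (hr : StoredAt s.mem r.1 (s.reg 12) ∧ StoredAt s.mem r.2.1 (s.reg 13) ∧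
      StoredAt s.mem r.2.2 (s.reg 14)) :
    let t := fetch.det F s
    t.mem = s.mem ∧ (∀ a, a ≤ 4 → t.reg a = s.reg a) ∧ t.reg 11 = (F (assemble l r)).toNat ∧
      t.steps = s.steps + 15 ∧ t.calls = s.calls + 1 := by
  obtain ⟨⟨-, -, a1, -⟩, ⟨-, b1, b2, -⟩, ⟨-, c1, c2, c3⟩⟩ := hl
  obtain ⟨⟨-, -, d1, -⟩, ⟨-, e1, e2, -⟩, ⟨-, g1, g2, g3⟩⟩ := hr
  refine ⟨rfl, fun a ha => ?_, ?_, rfl, rfl⟩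
  · have : a = 0 ∨ a = 1 ∨ a = 2 ∨ a = 3 ∨ a = 4 := by omega
    rcases this with rfl | rfl | rfl | rfl | rfl <;>
      simp [fetch, Program.det, State.tick, State.tickCall, State.setReg]
  · simp only [fetch, Program.det]
    simp only [State.setReg, Function.update_self]
    congr 2
    funext k
    fin_cases k <;>
      simp [State.tick, assemble, a1, b1, b2, c1, c2, c3, d1, e1, e2, g1, g2, g3,
        ← BitVec.toNat_xor]

/-! ### The answer to a new query -/

/-- The distribution of the answer to a query that is not in the history. -/
noncomputable def freshDist (F : BigFun n) (σ : History n) (i : Fin 7) (x : Block n × Block n) :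
    PMF (Block n) :=
  if i = 6 then
    match findMessage σ x with
    | some M => PMF.pure (F M)
    | none => PMF.uniformOfFintype (Block n)
  else PMF.uniformOfFintype (Block n)

/-- The state `t` has the same history and input as `s`, and the answer `z` in register `11`. -/
structure Chosen (s t : State) (L : ℕ) (z : Block n) : Prop where
  mem : t.mem = s.mem
  reg : ∀ a, a ≤ 4 → t.reg a = s.reg a
  answer : t.reg 11 = z.toNat
  steps : t.steps ≤ s.steps + 36 * L + 40
  calls : t.calls ≤ s.calls + 1

theorem run_sample (F : BigFun n) (r : ℕ) (s : State) :
    (Program.sample r).run F s =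
      (PMF.uniformOfFintype (Block n)).map fun z => s.tick.setReg r z.toNat := rfl

theorem chosen_sample {s u : State} {L : ℕ} (hm : u.mem = s.mem)
    (hr : ∀ a, a ≤ 4 → u.reg a = s.reg a) (hs : u.steps ≤ s.steps + 36 * L + 39)
    (hc : u.calls ≤ s.calls + 1) (z : Block n) :
    Chosen s (u.tick.setReg 11 z.toNat) L z where
  mem := hm
  reg := fun a ha => by
    rw [← hr a ha]
    exact Function.update_of_ne (by omega) _ _
  answer := by simp [State.setReg]
  steps := by change u.steps + 1 ≤ _; omega
  calls := hc

theorem Frame.reg_le {R : List ℕ} {s t : State} (h : Frame R s t) (hR : ∀ r ∈ R, 4 < r) (a : ℕ)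
    (ha : a ≤ 4) : t.reg a = s.reg a :=
  h.reg a fun hc => by have := hR a hc; omega

/-- The restriction to the support is needed when the search succeeds: `g` is then constant, and it
stores the only block of positive probability. -/
theorem choose_spec (F : BigFun n) (i : Fin 7) (x : Block n × Block n) {σ : History n} {s : State}
    (h : Rep s σ) (h0 : s.reg 0 = i) (h1 : s.reg 1 = x.1.toNat) (h2 : s.reg 2 = x.2.toNat) :
    ∃ g : Block n → State, choose.run F s = (freshDist F σ i x).map g ∧
      ∀ z ∈ (freshDist F σ i x).support, Chosen s (g z) σ.length z := by
  have e1 : choose.run F s = (Program.ifEq 0 6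
      (.seq searchBoth <| .ifEq 15 4 (.sample 11) <| .ifEq 12 4 (.sample 11) fetch)
      (.sample 11)).run F (s.tick.setReg 6 6) := by
    simp only [choose, Program.run, PMF.pure_bind]
  rw [e1]
  have f1 : Frame [6] s (s.tick.setReg 6 6) :=
    ⟨rfl, fun r hr => by simp_all [State.tick, State.setReg]⟩
  have r6 : (s.tick.setReg 6 6).reg 6 = 6 := by simp [State.setReg]
  have t1 : (s.tick.setReg 6 6).steps = s.steps + 1 := rfl
  have c1 : (s.tick.setReg 6 6).calls = s.calls := rfl
  generalize s.tick.setReg 6 6 = s₁ at *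
  rw [Program.run]
  have hi : s₁.reg 0 = s₁.reg 6 ↔ i = 6 := by
    rw [f1.reg 0 (by simp), r6, h0]
    exact ⟨fun hv => Fin.ext hv, fun hv => by rw [hv]; rfl⟩
  have f2 : Frame [6] s s₁.tick := ⟨f1.mem, f1.reg⟩
  have t2 : s₁.tick.steps = s.steps + 2 := by change s₁.steps + 1 = _; omega
  have c2 : s₁.tick.calls = s.calls := c1
  by_cases hi6 : i = 6
  · rw [if_pos (hi.2 hi6)]
    rw [Program.run, Program.run_eq_pure F searchBoth (by
      simp [searchBoth, searchProgram, searchBody, skip, Program.SampleFree]), PMF.pure_bind]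
    obtain ⟨f3, pl, pr, t3, c3⟩ := searchBoth_spec F x (h.frame f2 (by simp) (by simp))
      ((f2.reg 1 (by simp)).trans h1) ((f2.reg 2 (by simp)).trans h2)
    generalize searchBoth.det F s₁.tick = s₂ at *
    have m2 : s₂.mem = s.mem := f3.mem.trans f2.mem
    have g2 : ∀ a, a ≤ 4 → s₂.reg a = s.reg a := fun a ha =>
      (f3.reg_le (by simp) a ha).trans (f2.reg_le (by simp) a ha)
    have z2 : s₂.reg 4 = 0 := (g2 4 le_rfl).trans h.zero
    rw [f2.mem] at pl pr
    have none_case : findMessage σ x = none →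
        freshDist F σ i x = PMF.uniformOfFintype (Block n) := fun hn => by
      unfold freshDist
      rw [if_pos hi6, hn]
    rw [Program.run]
    cases hL : (left n).search σ x.1 with
    | none =>
      rw [hL] at pl
      have : s₂.reg 15 = s₂.reg 4 := pl.trans z2.symm
      rw [if_pos this, run_sample, none_case (by simp [findMessage, hL])]
      exact ⟨_, rfl, fun z _ => chosen_sample (u := s₂.tick) m2 g2
        (by change s₂.steps + 1 ≤ _; omega) (by change s₂.calls ≤ _; omega) z⟩
    | some l =>
      rw [hL] at pl
      have : s₂.reg 15 ≠ s₂.reg 4 := by rw [z2]; exact pl.1.ne'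
      rw [if_neg this, Program.run]
      cases hR : (right n).search σ x.2 with
      | none =>
        rw [hR] at pr
        have : s₂.tick.reg 12 = s₂.tick.reg 4 := pr.trans z2.symm
        rw [if_pos this, run_sample, none_case (by simp [findMessage, hL, hR])]
        exact ⟨_, rfl, fun z _ => chosen_sample (u := s₂.tick.tick) m2 g2
          (by change s₂.steps + 1 + 1 ≤ _; omega) (by change s₂.calls ≤ _; omega) z⟩
      | some r =>
        rw [hR] at pr
        have : s₂.tick.reg 12 ≠ s₂.tick.reg 4 := by
          change s₂.reg 12 ≠ s₂.reg 4
          rw [z2]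
          exact pr.1.ne'
        have hM : findMessage σ x = some (assemble l r) := by simp [findMessage, hL, hR]
        have hd : freshDist F σ i x = PMF.pure (F (assemble l r)) := by
          unfold freshDist
          rw [if_pos hi6, hM]
        rw [if_neg this, Program.run_eq_pure F fetch (by simp [fetch, Program.SampleFree]), hd]
        rw [← m2] at pl pr
        obtain ⟨k1, k2, k3, k4, k5⟩ := fetch_spec F (s := s₂.tick.tick) pl.2 pr.2
        refine ⟨fun _ => fetch.det F s₂.tick.tick, by rw [PMF.pure_map], fun z hz => ?_⟩
        rw [PMF.support_pure, Set.mem_singleton_iff] at hz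
        subst hz
        change _ = s₂.steps + 1 + 1 + 15 at k4
        change _ = s₂.calls + 1 at k5
        exact ⟨k1.trans m2, fun a ha => (k2 a ha).trans (g2 a ha), k3, by beta_reduce; omega, by beta_reduce; omega⟩
  · rw [if_neg (fun hc => hi6 (hi.1 hc)), run_sample]
    have hd : freshDist F σ i x = PMF.uniformOfFintype (Block n) := by
      unfold freshDist
      rw [if_neg hi6]
    rw [hd]
    exact ⟨_, rfl, fun z _ => chosen_sample (u := s₁.tick) f2.mem
      (f2.reg_le (by simp)) (by omega) (by omega) z⟩

/-! ### Recording an answer -/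

theorem recordIndex_spec (F : BigFun n) (i : ℕ) (s : State) :
    let t := (recordIndex i).det F s
    (∀ b a, t.mem b a =
      if s.reg 0 = i ∧ b = 4 + i ∧ a = s.reg 11 then s.reg 3 else s.mem b a) ∧
    (∀ r, r ≠ 6 → t.reg r = s.reg r) ∧ t.steps = s.steps + 3 ∧ t.calls = s.calls := by
  by_cases h : s.reg 0 = i
  · refine ⟨fun b a => ?_, fun r hr => ?_, ?_, ?_⟩
    · by_cases hb : b = 4 + i
      · subst hb
        by_cases ha : a = s.reg 11 <;>
          simp [recordIndex, Program.det, State.tick, State.setReg, State.setMem, h, ha]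
      · simp [recordIndex, Program.det, State.tick, State.setReg, State.setMem, h, hb]
    · simp [recordIndex, Program.det, State.tick, State.setReg, State.setMem, h, hr]
    · simp [recordIndex, Program.det, State.tick, State.setReg, State.setMem, h]
    · simp [recordIndex, Program.det, State.tick, State.setReg, State.setMem, h]
  · refine ⟨fun b a => ?_, fun r hr => ?_, ?_, ?_⟩
    · simp [recordIndex, skip, Program.det, State.tick, State.setReg, h]
    · simp [recordIndex, skip, Program.det, State.tick, State.setReg, h, hr]
    · simp [recordIndex, skip, Program.det, State.tick, State.setReg, h]
    · simp [recordIndex, skip, Program.det, State.tick, State.setReg, h]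

theorem Stored.congr {m m' : ℕ → ℕ → ℕ} {σ : History n} (h : Stored m σ)
    (hm : ∀ b, b < 4 → ∀ a, a ≤ σ.length → m' b a = m b a) : Stored m' σ := by
  induction σ with
  | nil => trivial
  | cons e σ ih =>
    simp only [List.length_cons] at hm
    refine ⟨?_, ih h.2 fun b hb a ha => hm b hb a (by omega)⟩
    obtain ⟨h0, h1, h2, h3⟩ := h.1
    exact ⟨(hm 0 (by omega) _ le_rfl).trans h0, (hm 1 (by omega) _ le_rfl).trans h1,
      (hm 2 (by omega) _ le_rfl).trans h2, (hm 3 (by omega) _ le_rfl).trans h3⟩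

/-- The bound `k ≤ L` in `Points` protects old pointers, because a new entry is written at position
`L + 1`. -/
theorem Points.congr {m m' : ℕ → ℕ → ℕ} {L k : ℕ} {o : Option (Entry n)} (h : Points m L k o)
    (hm : ∀ b, b < 4 → ∀ a, a ≤ L → m' b a = m b a) : Points m' (L + 1) k o := by
  cases o with
  | none => exact h
  | some e =>
    obtain ⟨hk, hL, h0, h1, h2, h3⟩ := h
    exact ⟨hk, by omega, (hm 0 (by omega) _ hL).trans h0, (hm 1 (by omega) _ hL).trans h1,
      (hm 2 (by omega) _ hL).trans h2, (hm 3 (by omega) _ hL).trans h3⟩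

theorem record_spec (F : BigFun n) (i : Fin 7) (x : Block n × Block n) (z : Block n)
    {σ : History n} {s : State} (h : Rep s σ) (h0 : s.reg 0 = i) (h1 : s.reg 1 = x.1.toNat)
    (h2 : s.reg 2 = x.2.toNat) (h11 : s.reg 11 = z.toNat) :
    let t := record.det F s
    Rep t (⟨i, x, z⟩ :: σ) ∧ t.reg 0 = z.toNat ∧ t.steps = s.steps + 18 ∧ t.calls = s.calls := by
  obtain ⟨u, hu⟩ : ∃ u, u = (Program.seq (.succ 3) <| .seq (.store 0 3 0) <|
    .seq (.store 1 3 1) <| .seq (.store 2 3 2) (.store 3 3 11)).det F s := ⟨_, rfl⟩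
  have e1 : record.det F s = (Program.copy 0 11).det F ((recordIndex 3).det F
      ((recordIndex 2).det F ((recordIndex 1).det F ((recordIndex 0).det F u)))) := by
    rw [hu]; rfl
  rw [e1]
  have ur : ∀ r, r ≠ 3 → u.reg r = s.reg r := by
    intro r hr
    simp [hu, Program.det, State.tick, State.setReg, State.setMem, hr]
  have u3 : u.reg 3 = σ.length + 1 := by
    rw [← h.count]
    simp [hu, Program.det, State.tick, State.setReg, State.setMem]
  have um : ∀ b, 4 ≤ b → u.mem b = s.mem b := by
    intro b hb
    have : b ≠ 0 ∧ b ≠ 1 ∧ b ≠ 2 ∧ b ≠ 3 := by omega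
    simp [hu, Program.det, State.tick, State.setReg, State.setMem, this]
  have uo : ∀ b a, a ≠ σ.length + 1 → u.mem b a = s.mem b a := by
    intro b a ha
    rw [← h.count] at ha
    by_cases b0 : b = 0
    · subst b0; simp [hu, Program.det, State.tick, State.setReg, State.setMem, ha]
    by_cases b1 : b = 1
    · subst b1; simp [hu, Program.det, State.tick, State.setReg, State.setMem, ha]
    by_cases b2 : b = 2
    · subst b2; simp [hu, Program.det, State.tick, State.setReg, State.setMem, ha]
    by_cases b3 : b = 3
    · subst b3; simp [hu, Program.det, State.tick, State.setReg, State.setMem, ha]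
    rw [um b (by omega)]
  have un : StoredAt u.mem (⟨i, x, z⟩ : Entry n) (σ.length + 1) := by
    rw [← h.count]
    refine ⟨?_, ?_, ?_, ?_⟩ <;>
      simp [hu, Program.det, State.tick, State.setReg, State.setMem, h0, h1, h2, h11]
  have us : u.steps = s.steps + 5 := by rw [hu]; rfl
  have uc : u.calls = s.calls := by rw [hu]; rfl
  clear hu e1
  obtain ⟨ma, ra, ta, ca⟩ := recordIndex_spec F 0 u
  generalize (recordIndex 0).det F u = sa at *
  obtain ⟨mb, rb, tb, cb⟩ := recordIndex_spec F 1 sa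
  generalize (recordIndex 1).det F sa = sb at *
  obtain ⟨mc, rc, tc, cc⟩ := recordIndex_spec F 2 sb
  generalize (recordIndex 2).det F sb = sc at *
  obtain ⟨md, rd, td, cd⟩ := recordIndex_spec F 3 sc
  generalize (recordIndex 3).det F sc = sd at *
  have rall : ∀ r, r ≠ 6 → sd.reg r = u.reg r := fun r hr => by
    rw [rd r hr, rc r hr, rb r hr, ra r hr]
  have hlow : ∀ b, b < 4 → ∀ a, sd.mem b a = u.mem b a := by
    intro b hb a
    rw [md, if_neg (by omega), mc, if_neg (by omega), mb, if_neg (by omega), ma,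
      if_neg (by omega)]
  have hhigh : ∀ j, j < 4 → ∀ a, sd.mem (4 + j) a =
      if (i : ℕ) = j ∧ a = z.toNat then σ.length + 1 else s.mem (4 + j) a := by
    intro j hj a
    have k0 : u.reg 0 = i := (ur 0 (by simp)).trans h0
    have k11 : u.reg 11 = z.toNat := (ur 11 (by simp)).trans h11
    rw [md, mc, mb, ma, rc 0 (by simp), rc 11 (by simp), rc 3 (by simp), rb 0 (by simp),
      rb 11 (by simp), rb 3 (by simp), ra 0 (by simp), ra 11 (by simp), ra 3 (by simp),
      k0, k11, u3, um (4 + j) (by omega)]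
    have : j = 0 ∨ j = 1 ∨ j = 2 ∨ j = 3 := by omega
    rcases this with rfl | rfl | rfl | rfl <;> simp
  have old : ∀ b, b < 4 → ∀ a, a ≤ σ.length → sd.mem b a = s.mem b a := fun b hb a ha =>
    (hlow b hb a).trans (uo b a (by omega))
  have new : StoredAt sd.mem (⟨i, x, z⟩ : Entry n) (σ.length + 1) := by
    obtain ⟨n0, n1, n2, n3⟩ := un
    exact ⟨(hlow 0 (by omega) _).trans n0, (hlow 1 (by omega) _).trans n1,
      (hlow 2 (by omega) _).trans n2, (hlow 3 (by omega) _).trans n3⟩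
  refine ⟨⟨?_, ?_, ⟨new, h.stored.congr old⟩, ?_⟩, ?_, ?_, ?_⟩
  · simp [Program.det, State.tick, State.setReg, rall 3, u3]
  · simp [Program.det, State.tick, State.setReg, rall 4, ur 4, h.zero]
  · intro j hj v
    change Points sd.mem (σ.length + 1) (sd.mem (4 + j) v.toNat) _
    rw [hhigh j hj, latest, List.find?_cons]
    by_cases hc : i = j ∧ z = v
    · obtain ⟨rfl, rfl⟩ := hc
      simp only [and_self, if_true, decide_true]
      exact ⟨by omega, le_rfl, new⟩
    · rw [if_neg (fun hc' => hc ⟨Fin.ext hc'.1, (BitVec.eq_of_toNat_eq hc'.2).symm⟩)]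
      simp only [hc, decide_false]
      exact (h.latest j hj v).congr old
  · simp [Program.det, State.setReg, rall 11, ur 11, h11]
  · change sd.steps + 1 = _
    omega
  · change sd.calls = _
    omega

/-! ### One invocation -/

/-- The distribution of the answer to a query. -/
noncomputable def answerDist (F : BigFun n) (σ : History n) (i : Fin 7) (x : Block n × Block n) :
    PMF (Block n) :=
  match lookup σ i x with
  | some v => PMF.pure v
  | none => freshDist F σ i x

/-- The history after a query. -/
def extendHistory (σ : History n) (i : Fin 7) (x : Block n × Block n) (z : Block n) : History n :=
  match lookup σ i x with
  | some _ => σ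
  | none => ⟨i, x, z⟩ :: σ

theorem input_frame (s : State) (i : Fin 7) (x : Block n × Block n) :
    Frame [0, 1, 2] s (s.input i x) :=
  ⟨rfl, fun r hr => by simp_all [State.input, State.setReg]⟩

/-- With `L` entries, the scan costs at most `9 L + 3`, the test `1`, the choice `36 L + 40` and the
recording `18`; the sum is below `65 (L + 1)`. -/
theorem invoke_spec (F : BigFun n) (i : Fin 7) (x : Block n × Block n) {σ : History n} {s : State}
    (h : Rep s σ) :
    ∃ g : Block n → State, invoke simulator F i x s = (answerDist F σ i x).map g ∧
      ∀ z ∈ (answerDist F σ i x).support, Rep (g z) (extendHistory σ i x z) ∧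
        (g z).answer n = z ∧ (g z).steps ≤ s.steps + 65 * (σ.length + 1) ∧
        (g z).calls ≤ s.calls + 1 := by
  have hin := input_frame s i x
  have i0 : (s.input i x).reg 0 = i := by simp [State.input, State.setReg]
  have i1 : (s.input i x).reg 1 = x.1.toNat := by simp [State.input, State.setReg]
  have i2 : (s.input i x).reg 2 = x.2.toNat := by simp [State.input, State.setReg]
  have is : (s.input i x).steps = s.steps := rfl
  have ic : (s.input i x).calls = s.calls := rfl
  have hr := h.frame hin (by simp) (by simp)
  unfold invoke
  generalize s.input i x = s₁ at *
  rw [simulator, Program.run, Program.run_eq_pure F scan (by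
    simp [scan, scanBody, skip, Program.SampleFree]), PMF.pure_bind]
  obtain ⟨f2, p2, t2, c2⟩ := scan_spec F i x hr i0 i1 i2
  have r2 := hr.frame f2 (by simp) (by simp)
  generalize scan.det F s₁ = s₂ at *
  rw [Program.run]
  cases hl : σ.find? (fun e => e.idx = i ∧ e.arg = x) with
  | none =>
    rw [hl] at p2
    have hlook : lookup σ i x = none := by rw [lookup, hl]; rfl
    have : s₂.reg 10 = s₂.reg 4 := p2.trans r2.zero.symm
    rw [if_pos this, Program.run]
    have r3 : Rep s₂.tick σ := ⟨r2.count, r2.zero, r2.stored, r2.latest⟩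
    obtain ⟨g, hg, hz⟩ := choose_spec F i x r3 ((f2.reg 0 (by simp)).trans i0)
      ((f2.reg 1 (by simp)).trans i1) ((f2.reg 2 (by simp)).trans i2)
    have hd : answerDist F σ i x = freshDist F σ i x := by
      unfold answerDist
      rw [hlook]
    rw [hg, hd]
    refine ⟨fun z => record.det F (g z), ?_, fun z hzs => ?_⟩
    · have : record.run F = fun t => PMF.pure (record.det F t) := by
        funext t
        exact Program.run_eq_pure F record (by
          simp [record, recordIndex, skip, Program.SampleFree]) t
      rw [this]
      change PMF.map (record.det F) _ = _
      rw [PMF.map_comp]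
      rfl
    · have hc := hz z hzs
      have rg : Rep (g z) σ :=
        ⟨(hc.reg 3 (by omega)).trans r3.count, (hc.reg 4 le_rfl).trans r3.zero,
          hc.mem ▸ r3.stored, hc.mem ▸ r3.latest⟩
      obtain ⟨q1, q2, q3, q4⟩ := record_spec F i x z rg
        ((hc.reg 0 (by omega)).trans ((f2.reg 0 (by simp)).trans i0))
        ((hc.reg 1 (by omega)).trans ((f2.reg 1 (by simp)).trans i1))
        ((hc.reg 2 (by omega)).trans ((f2.reg 2 (by simp)).trans i2)) hc.answer
      have st := hc.steps
      have sc := hc.calls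
      change _ ≤ s₂.steps + 1 + _ + _ at st
      change _ ≤ s₂.calls + 1 at sc
      refine ⟨?_, ?_, by beta_reduce; omega, by beta_reduce; omega⟩
      · unfold extendHistory
        rw [hlook]
        exact q1
      · rw [State.answer, q2, BitVec.ofNat_toNat]
        simp
  | some e =>
    rw [hl] at p2
    have hlook : lookup σ i x = some e.val := by rw [lookup, hl]; rfl
    have : s₂.reg 10 ≠ s₂.reg 4 := by
      rw [r2.zero]
      exact p2.1.ne'
    have hd : answerDist F σ i x = PMF.pure e.val := by
      unfold answerDist
      rw [hlook]
    rw [if_neg this, hd, Program.run]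
    refine ⟨fun _ => s₂.tick.tick.setReg 0 (s₂.tick.mem 3 (s₂.tick.reg 10)),
      by rw [PMF.pure_map], fun z hz => ?_⟩
    rw [PMF.support_pure, Set.mem_singleton_iff] at hz
    subst hz
    have hv : s₂.mem 3 (s₂.reg 10) = e.val.toNat := by
      rw [f2.mem]
      exact p2.2.2.2.2.2
    have f3 : Frame [0] s₂ (s₂.tick.tick.setReg 0 (s₂.tick.mem 3 (s₂.tick.reg 10))) :=
      ⟨rfl, fun r hr => by simp_all [State.tick, State.setReg]⟩
    refine ⟨?_, ?_, ?_, ?_⟩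
    · unfold extendHistory
      rw [hlook]
      exact r2.frame f3 (by simp) (by simp)
    · simp [State.answer, State.setReg, State.tick, hv]
    · change s₂.steps + 1 + 1 ≤ _
      omega
    · change s₂.calls ≤ _
      omega

/-! ### The ideal world with predetermined coins is the ideal world -/

theorem toReal_uniform_bind {α : Type*} [Fintype α] [Nonempty α] (g : α → PMF Bool) (b : Bool) :
    (((PMF.uniformOfFintype α).bind g) b).toReal = 𝔼 a, (g a b).toReal := by
  rw [PMF.bind_apply, tsum_fintype, ENNReal.toReal_sum, Fintype.expect_eq_sum_div_card,
    Finset.sum_div]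
  · refine sum_congr rfl fun a _ => ?_
    rw [ENNReal.toReal_mul, PMF.uniformOfFintype_apply, ENNReal.toReal_inv,
      ENNReal.toReal_natCast, div_eq_inv_mul]
  · exact fun a _ => ENNReal.mul_ne_top (PMF.apply_ne_top _ _) (PMF.apply_ne_top _ _)

theorem toReal_pure (b : Bool) : ((PMF.pure b) true).toReal = ind (b = true) := by
  cases b <;> simp [ind]

theorem fresh_set {F : BigFun n} {σ : History n} {i : Fin 7} {x : Block n × Block n}
    (h : i = 6 → findMessage σ x = none) (f : Family n) (v : Block n) :
    fresh F (f.set i x v) σ i x = v := by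
  unfold fresh
  split_ifs with hi
  · rw [h hi]
    subst hi
    simp [Family.set_same]
  · exact f.set_same i x v

theorem idealEval_eq (F : BigFun n) {q : ℕ} (D : DecisionTree n q) :
    ∀ {s : State} {σ : History n} (ms : List (Message n)), Rep s σ →
      ((D.idealEval simulator F s) true).toReal = 𝔼 f, ind ((D.play F f σ ms).1 = true) := by
  induction D with
  | output b =>
    intro s σ ms _
    simp only [DecisionTree.idealEval, DecisionTree.play, Fintype.expect_const]
    exact toReal_pure b
  | query y next ih =>
    intro s σ ms h
    cases y with
    | construction M => exact ih _ (M :: ms) h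
    | primitive i x =>
      obtain ⟨g, hg, hz⟩ := invoke_spec F i x h
      have e1 : DecisionTree.idealEval simulator F (.query (.primitive i x) next) s =
          (answerDist F σ i x).bind
            fun z => (next ((g z).answer n)).idealEval simulator F (g z) := by
        rw [DecisionTree.idealEval, hg, PMF.bind_map]
        rfl
      rw [e1]
      have key : ∀ z ∈ (answerDist F σ i x).support,
          (((next ((g z).answer n)).idealEval simulator F (g z)) true).toReal =
            𝔼 f, ind (((next z).play F f (extendHistory σ i x z) ms).1 = true) := by
        intro z hzs
        obtain ⟨h1, h2, -, -⟩ := hz z hzs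
        rw [h2]
        exact ih z ms h1
      simp only [DecisionTree.play]
      cases hl : lookup σ i x with
      | some v =>
        have hd : answerDist F σ i x = PMF.pure v := by simp only [answerDist, hl]
        rw [hd] at key ⊢
        rw [PMF.pure_bind, key v (by simp)]
        simp only [extendHistory, hl]
      | none =>
        simp only [extendHistory, hl] at key
        have hd : answerDist F σ i x = freshDist F σ i x := by simp only [answerDist, hl]
        rw [hd] at key ⊢
        by_cases hc : i = 6 → findMessage σ x = none
        -- The block that the program samples is identified with the coin of `f` at this query,
        -- which is not read again.
        · have hu : freshDist F σ i x = PMF.uniformOfFintype (Block n) := by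
            unfold freshDist
            split_ifs with hi
            · rw [hc hi]
            · rfl
          rw [hu] at key ⊢
          rw [toReal_uniform_bind, expect_family_set i x]
          refine expect_congr rfl fun v _ => ?_
          rw [key v (by simp)]
          refine expect_congr rfl fun f _ => ?_
          rw [fresh_set hc, play_congr _ (agreeOff_set σ f i x v v)]
        -- A message is found: both answers are `F M`, whatever the coins.
        · push Not at hc
          obtain ⟨hi, hM⟩ := hc
          obtain ⟨M, hM⟩ := Option.ne_none_iff_exists'.1 hM
          have hu : freshDist F σ i x = PMF.pure (F M) := by
            unfold freshDist
            rw [if_pos hi, hM]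
          have hf : ∀ f, fresh F f σ i x = F M := fun f => by
            unfold fresh
            rw [if_pos hi, hM]
            rfl
          rw [hu] at key ⊢
          rw [PMF.pure_bind, key (F M) (by simp)]
          simp only [hf]

/-! ### The cost of the simulator -/

theorem length_extendHistory_le (σ : History n) (i : Fin 7) (x : Block n × Block n)
    (z : Block n) : (extendHistory σ i x z).length ≤ σ.length + 1 := by
  unfold extendHistory
  split <;> simp

theorem mem_support_invoke {F : BigFun n} {i : Fin 7} {x : Block n × Block n} {σ : History n}
    {s s' : State} (h : Rep s σ) (hs : s' ∈ (invoke simulator F i x s).support) :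
    (∃ σ' : History n, Rep s' σ' ∧ σ'.length ≤ σ.length + 1) ∧
      s'.steps ≤ s.steps + 65 * (σ.length + 1) ∧ s'.calls ≤ s.calls + 1 := by
  obtain ⟨g, hg, hz⟩ := invoke_spec F i x h
  rw [hg, PMF.mem_support_map_iff] at hs
  obtain ⟨z, hzs, rfl⟩ := hs
  obtain ⟨h1, -, h3, h4⟩ := hz z hzs
  exact ⟨⟨_, h1, length_extendHistory_le σ i x z⟩, h3, h4⟩

/-- With at most `m` entries recorded, the next invocation costs at most `65 (m + 1)`, and `m² + (m
+ 1) ≤ (m + 1)²`. -/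
theorem mem_support_invokeAll {F : BigFun n} (l : List (Fin 7 × (Block n × Block n))) :
    ∀ {s s' : State} {σ : History n} {m : ℕ}, Rep s σ → σ.length ≤ m → s.steps ≤ 65 * m ^ 2 →
      s' ∈ (invokeAll simulator F l s).support →
      (∃ σ' : History n, Rep s' σ') ∧ s'.steps ≤ 65 * (m + l.length) ^ 2 := by
  induction l with
  | nil =>
    intro s s' σ m h _ ht hs
    rw [invokeAll, PMF.support_pure, Set.mem_singleton_iff] at hs
    subst hs
    exact ⟨⟨σ, h⟩, ht⟩
  | cons p l ih =>
    intro s s' σ m h hm ht hs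
    obtain ⟨i, x⟩ := p
    rw [invokeAll, PMF.mem_support_bind_iff] at hs
    obtain ⟨u, hu, hs⟩ := hs
    obtain ⟨⟨σ', hr, hl⟩, hst, -⟩ := mem_support_invoke h hu
    have := ih (m := m + 1) hr (by omega) (by nlinarith) hs
    rw [List.length_cons, show m + (l.length + 1) = m + 1 + l.length by ring]
    exact this

theorem runsInTime_simulator (n q : ℕ) : RunsInTime n simulator q (65 * q ^ 2) := by
  intro F l hl s hs
  have h := (mem_support_invokeAll (m := 0) l Rep.init le_rfl (Nat.zero_le _) hs).2
  refine h.trans ?_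
  rw [zero_add]
  gcongr

theorem callsPerInvocation_simulator (n : ℕ) : CallsPerInvocation n simulator 1 := by
  intro F l s hs i x s' hs'
  obtain ⟨σ, h⟩ := (mem_support_invokeAll (m := 0) l Rep.init le_rfl (Nat.zero_le _) hs).1
  exact (mem_support_invoke h hs').2.2

/-! ### The advantage of a deterministic distinguisher -/

theorem expect_withRoot (G : Family n → ℝ) : 𝔼 f, G f = 𝔼 f, 𝔼 g, G (withRoot f g) := by
  rw [expect_update 6 G, expect_comm univ univ]
  rfl

theorem abs_sub_le_expect_bad {q : ℕ} (D : DecisionTree n q) :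
    |𝔼 f, ind (D.realEval abrPlus f = true) -
        𝔼 F, 𝔼 f, ind ((D.play F f [] []).1 = true)| ≤
      𝔼 F, 𝔼 f, ind (BadHistory (D.play F f [] []).2) := by
  have h1 : 𝔼 f, ind (D.realEval abrPlus f = true) = 𝔼 f, realProb f D fun _ => none :=
    expect_withRoot _
  have h2 : ∀ Ψ : Bool × History n → ℝ, 𝔼 F, 𝔼 f, Ψ (D.play F f [] []) =
      𝔼 f, idealMean Ψ f D [] [] fun _ => none := by
    intro Ψ
    rw [expect_comm univ univ]
    rw [expect_withRoot]
    refine expect_congr rfl fun f _ => ?_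
    rw [expect_comm univ univ]
    rfl
  have h3 := h2 accepts
  have h4 := h2 isBad
  unfold accepts at h3
  unfold isBad at h4
  rw [h1, h3, h4]
  exact abs_expect_sub_le fun f => abs_realProb_sub_le D (coupled_nil f)

theorem pot_nil (S : Side n) : S.pot [] = 3 * 2 ^ n := by
  have : potential (∅ : Finset (Block n)) ∅ = 2 ^ n := by
    simp [potential, mult, card_block]
  simp only [Side.pot, vals, List.filter_nil, List.map_nil, List.toFinset_nil, this]
  ring

/-- The choice `k = 2 n` beats the initial potential `3 · 2 ^ n` by a factor of order `2 ^ n`, while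
`stepBound` grows only quadratically in `n`. -/
theorem bound_nil_le (S : Side n) (hn : 1 ≤ n) {q : ℕ} (hq : 1 ≤ q)
    (hQ : (6 * q : ℝ) ^ 2 ≤ 2 ^ n) :
    S.bound (6 * q) (2 * n) [] (6 * q) ≤ 297 * ((n : ℝ) ^ 2 * (q : ℝ) ^ 2 / 2 ^ n) := by
  have hN : (0 : ℝ) < 2 ^ n := by positivity
  have hn' : (1 : ℝ) ≤ n := by exact_mod_cast hn
  have hq' : (1 : ℝ) ≤ q := by exact_mod_cast hq
  unfold Side.bound
  rw [ind_of_false (show ¬S.Bad [] from id), pot_nil, stepBound]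
  push_cast
  -- By `1 + t ≤ exp t` and `hQ`, the growth over all `6 q` answers is at most `exp 1 < 3`.
  have h1 : (1 + 6 * (q : ℝ) / 2 ^ n) ^ (6 * q) ≤ 3 := by
    have a1 : 1 + 6 * (q : ℝ) / 2 ^ n ≤ Real.exp (6 * q / 2 ^ n) := by
      linarith [Real.add_one_le_exp (6 * (q : ℝ) / 2 ^ n)]
    have a2 : (1 + 6 * (q : ℝ) / 2 ^ n) ^ (6 * q) ≤ Real.exp (6 * q / 2 ^ n) ^ (6 * q) :=
      pow_le_pow_left₀ (by positivity) a1 _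
    rw [← Real.exp_nat_mul] at a2
    have a3 : ((6 * q : ℕ) : ℝ) * (6 * q / 2 ^ n) ≤ 1 := by
      push_cast
      rw [← mul_div_assoc, div_le_one hN, ← sq]
      exact hQ
    linarith [Real.exp_le_exp.2 a3, Real.exp_one_lt_d9]
  have h2 : (1 + 6 * (q : ℝ) / 2 ^ n) ^ (6 * q) * (3 * 2 ^ n) / 2 ^ (2 * n) ≤ 9 / 2 ^ n := by
    rw [two_mul, pow_add, div_le_div_iff₀ (by positivity) hN]
    nlinarith [mul_le_mul_of_nonneg_right h1 (mul_pos hN hN).le]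
  -- The constant is `297 = 36 · 8 + 9`: `b4` supplies the `8`, and the potential term the `9`.
  have h3 : 6 * (q : ℝ) * ((2 * (6 * q) + 6 * q * (2 * n + 1) * (2 * n)) / 2 ^ n) + 9 / 2 ^ n ≤
      297 * ((n : ℝ) ^ 2 * (q : ℝ) ^ 2 / 2 ^ n) := by
    rw [← mul_div_assoc, ← add_div, ← mul_div_assoc]
    gcongr
    have b1 : (1 : ℝ) ≤ n ^ 2 := one_le_pow₀ hn'
    have b2 : (1 : ℝ) ≤ q ^ 2 := one_le_pow₀ hq'
    have b3 : (n : ℝ) ≤ n ^ 2 := by nlinarith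
    have b4 : (2 : ℝ) + (2 * n + 1) * (2 * n) ≤ 8 * n ^ 2 := by nlinarith
    have b5 := mul_le_mul_of_nonneg_left b4 (by positivity : (0 : ℝ) ≤ 36 * q ^ 2)
    have b6 : (1 : ℝ) ≤ n ^ 2 * q ^ 2 := by nlinarith
    nlinarith
  linarith

/-- With blocks of no bits, both worlds are the same. -/
theorem play_zero (F : BigFun 0) (f f' : Family 0) {q : ℕ} (D : DecisionTree 0 q) :
    ∀ (σ : History 0) (ms : List (Message 0)),
      (D.play F f σ ms).1 = D.realEval abrPlus f' := by
  have hs : ∀ a b : Block 0, a = b := fun a b => by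
    rw [BitVec.eq_nil a, BitVec.eq_nil b]
  induction D with
  | output b => intro σ ms; rfl
  | query y next ih =>
    intro σ ms
    cases y with
    | construction M =>
      simp only [DecisionTree.play, DecisionTree.realEval]
      rw [hs (abrPlus f' M) (F M)]
      exact ih _ _ _
    | primitive i x =>
      simp only [DecisionTree.play, DecisionTree.realEval]
      split
      · next v _ =>
        rw [hs (f' i x) v]
        exact ih _ _ _
      · rw [hs (f' i x) (fresh F f σ i x)]
        exact ih _ _ _

theorem abs_sub_le (n q : ℕ) (D : DecisionTree n q) :
    |𝔼 f, ind (D.realEval abrPlus f = true) -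
        𝔼 F, 𝔼 f, ind ((D.play F f [] []).1 = true)| ≤
      594 * ((n : ℝ) ^ 2 * (q : ℝ) ^ 2 / 2 ^ n) := by
  -- For `n = 0` the claimed bound is `0`, so the worlds must agree exactly.
  rcases Nat.eq_zero_or_pos n with rfl | hn
  · have : ∀ (F : BigFun 0) (f : Family 0), (D.play F f [] []).1 =
        D.realEval abrPlus (fun _ _ => 0) := fun F f => play_zero F f _ D [] []
    have h' : ∀ f : Family 0, D.realEval abrPlus f = D.realEval abrPlus (fun _ _ => 0) :=
      fun f => (play_zero (fun _ => 0) f f D [] []).symm.trans (this _ f)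
    simp only [this, h', Fintype.expect_const]
    simp
  -- For `q = 0` the bound is again `0`, and the distinguisher can only output a constant.
  rcases Nat.eq_zero_or_pos q with rfl | hq
  · cases D with
    | output b =>
      simp only [DecisionTree.realEval, DecisionTree.play, Fintype.expect_const]
      simp
  by_cases hQ : (6 * q : ℝ) ^ 2 ≤ 2 ^ n
  · refine (abs_sub_le_expect_bad D).trans (expect_le univ_nonempty fun F _ => ?_)
    have hb : ∀ S : Side n, 𝔼 f, ind (S.Bad (D.play F f [] []).2) ≤
        297 * ((n : ℝ) ^ 2 * (q : ℝ) ^ 2 / 2 ^ n) := by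
      intro S
      refine (Side.expect_play_le (Q := 6 * q) (k := 2 * n) F D [] [] (by simp)).trans ?_
      simpa using bound_nil_le S hn hq hQ
    have hor : ∀ f, ind (BadHistory (D.play F f [] []).2) ≤
        ind ((left n).Bad (D.play F f [] []).2) + ind ((right n).Bad (D.play F f [] []).2) :=
      fun f => ind_or_le _ _
    refine (expect_le_expect fun f _ => hor f).trans ?_
    rw [expect_add_distrib]
    -- The union over the two halves gives `594 = 2 · 297`.
    linarith [hb (left n), hb (right n)]
  -- Beyond the birthday range, `36 q² > 2 ^ n` makes the claimed bound exceed `1`.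
  · have h1 : |𝔼 f, ind (D.realEval abrPlus f = true) -
        𝔼 F, 𝔼 f, ind ((D.play F f [] []).1 = true)| ≤ 1 := by
      refine (abs_sub_le_expect_bad D).trans ?_
      exact expect_le univ_nonempty fun _ _ => expect_le univ_nonempty fun _ _ => ind_le_one _
    refine h1.trans ?_
    push Not at hQ
    have hn' : (1 : ℝ) ≤ (n : ℝ) ^ 2 := one_le_pow₀ (by exact_mod_cast hn)
    rw [← mul_div_assoc, le_div_iff₀ (by positivity), one_mul]
    nlinarith [sq_nonneg (q : ℝ)]

/-! ### Randomized distinguishers -/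

/-- The comparison takes place in `ENNReal`, where sums over the coins need no summability; the
total mass `1` of `A` leaves `ε` unchanged. -/
theorem toReal_bind_le {α : Type*} (A : PMF α) (g₁ g₂ : α → PMF Bool) {ε : ℝ}
    (h : ∀ a, ((g₁ a) true).toReal ≤ ((g₂ a) true).toReal + ε) (hε : 0 ≤ ε) :
    ((A.bind g₁) true).toReal ≤ ((A.bind g₂) true).toReal + ε := by
  have h1 : (A.bind g₁) true ≤ (A.bind g₂) true + ENNReal.ofReal ε := by
    rw [PMF.bind_apply, PMF.bind_apply]
    have h2 : ∀ a, A a * (g₁ a) true ≤ A a * (g₂ a) true + A a * ENNReal.ofReal ε := by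
      intro a
      rw [← mul_add]
      refine mul_le_mul_right ?_ _
      rw [← ENNReal.ofReal_toReal (PMF.apply_ne_top (g₁ a) true),
        ← ENNReal.ofReal_toReal (PMF.apply_ne_top (g₂ a) true),
        ← ENNReal.ofReal_add ENNReal.toReal_nonneg hε]
      exact ENNReal.ofReal_le_ofReal (h a)
    refine (ENNReal.tsum_le_tsum h2).trans ?_
    rw [ENNReal.tsum_add, ENNReal.tsum_mul_right, PMF.tsum_coe, one_mul]
  have h3 : (A.bind g₂) true ≠ ⊤ := PMF.apply_ne_top _ _
  have h4 := ENNReal.toReal_mono (ENNReal.add_ne_top.2 ⟨h3, ENNReal.ofReal_ne_top⟩) h1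
  rwa [ENNReal.toReal_add h3 ENNReal.ofReal_ne_top, ENNReal.toReal_ofReal hε] at h4

theorem advantage_le (n q : ℕ) (A : Distinguisher n q) :
    advantage abrPlus simulator A ≤ 594 * ((n : ℝ) ^ 2 * (q : ℝ) ^ 2 / 2 ^ n) := by
  have hε : (0 : ℝ) ≤ 594 * ((n : ℝ) ^ 2 * (q : ℝ) ^ 2 / 2 ^ n) := by positivity
  have hreal : ∀ D : DecisionTree n q, (((PMF.uniformOfFintype (Family n)).map
      fun f => D.realEval abrPlus f) true).toReal =
      𝔼 f, ind (D.realEval abrPlus f = true) := by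
    intro D
    rw [← PMF.bind_pure_comp, toReal_uniform_bind]
    exact expect_congr rfl fun f _ => toReal_pure _
  have hideal : ∀ D : DecisionTree n q, (((PMF.uniformOfFintype (BigFun n)).bind
      fun F => D.idealEval simulator F State.init) true).toReal =
      𝔼 F, 𝔼 f, ind ((D.play F f [] []).1 = true) := by
    intro D
    rw [toReal_uniform_bind]
    exact expect_congr rfl fun F _ => idealEval_eq F D [] Rep.init
  have key : ∀ D : DecisionTree n q, _ := fun D => abs_le.1 (abs_sub_le n q D)
  unfold advantage realGame idealGame
  rw [abs_le]
  constructor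
  · rw [neg_le_sub_iff_le_add]
    refine toReal_bind_le A _ _ (fun D => ?_) hε
    rw [hreal, hideal]
    linarith [(key D).1]
  · rw [sub_le_iff_le_add']
    refine toReal_bind_le A _ _ (fun D => ?_) hε
    rw [hreal, hideal]
    linarith [(key D).2]

end ABRPlus

theorem mainTheorem3 :
    ∃ (S : ABRPlus.Program) (c : ℕ) (K : ℝ), ∀ n q : ℕ,
      ABRPlus.IndifferentiableVia (n := n) ABRPlus.abrPlus S
        (c * q ^ 2) 1 q (K * ((n : ℝ) ^ 2 * (q : ℝ) ^ 2 / 2 ^ n)) :=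
  ⟨ABRPlus.simulator, 65, 594, fun n q =>
    ⟨ABRPlus.runsInTime_simulator n q, ABRPlus.callsPerInvocation_simulator n,
      ABRPlus.advantage_le n q⟩⟩
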